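/- **Setting.** Let $\mathcal O\mapsto\mathfrak A(\mathcal O)$ be a local net of von Neumann algebras (indexed by bounded open regions of Minkowski space of dimension $s+1\ge 3$) on a Hilbert space $\mathcal H$, with a strongly continuous unitary representation $U(x,\Lambda)$ of the proper orthochronous Poincaré group and an invariant unit vector $\Omega$, satisfying isotony, locality, covariance, positivity of energy (the joint spectrum of the translation generators lies in the closed forward light cone) and uniqueness of the translation-invariant vector $\Omega$ up to scalars. Write $U(t)=e^{itH}$ for the time translations, $R=(1+H)^{-1}$, $P(E)$ for the spectral projector of $H$ for $[0,E]$, and $\mathfrak A(r)$ for the algebra of the double cone of radius $r$ centred at the origin. Let $\Sigma$ be the space of ultraweakly continuous functionals on $\mathfrak B(\mathcal H)$; for $\sigma\in\Sigma$, $\ell>0$ put $\|\sigma\|_\ell=\|\sigma(R^{-\ell}\,\cdot\,R^{-\ell})\|$; let $\mathcal C^\infty(\Sigma)=\{\sigma\in\Sigma:\|\sigma\|_\ell<\infty\ \forall\ell>0\}$ with the Fréchet topology of these norms, $\mathcal C^\infty(\Sigma)^*$ its dual with the weak* topology, and $\|\cdot\|_{-\ell}$ the norm dual to $\|\cdot\|_\ell$.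 Put $\Sigma(E)=\{\sigma(P(E)\cdot P(E)):\sigma\in\Sigma\}$ and $\phi^*(\sigma)=\overline{\phi(\sigma^*)}$, where $\sigma^*(A)=\overline{\sigma(A^*)}$. *Phase space condition (assumed):* for every $\gamma\ge0$ there is a continuous linear finite-rank map $\psi:\mathcal C^\infty(\Sigma)\to\Sigma$ such that for all sufficiently large $\ell$, $r^{-\gamma}\sup\{|\sigma(A)-\psi(\sigma)(A)|:\|\sigma\|_\ell\le1,\ A\in\mathfrak A(r),\ \|A\|\le1\}\to0$ as $r\to0$. Let $\Phi_\gamma\subset\mathcal C^\infty(\Sigma)^*$ be the image of the dual map $\psi^*:\mathfrak B(\mathcal H)\to\mathcal C^\infty(\Sigma)^*$ for such a $\psi$ of minimal rank (the image does not depend on the choice), and $\Phi_{\rm FH}=\bigcup_{\gamma\ge0}\Phi_\gamma$ the space of pointlike fields. For $f\in\mathcal D(\mathbb R)$ let $\phi(f)=\int dt\,f(t)\,U(t)\phi U(t)^*$. Let $\mathcal K$ be the space of analytic functions $F$ on the open lower half plane such that $\sup_{-1\le{\rm Im} z<0}|F(z)||{\rm Im} z|^{\ell}<\infty$ for some $\ell>0$,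 and $\mathcal K_+\subset\mathcal K$ the set of those whose boundary value $F(x-i0)$ is a distribution of positive type: $\int ds\,ds'\,F(s'-i0)\,\bar g(s+s'/2)\,g(s-s'/2)\ge0$ for all $g\in\mathcal S(\mathbb R)$. The set of *classically positive* products is $$\Phi_{\rm pos}=\Big\{\sum_{j}K_j\otimes\phi_j^*\otimes\phi_j\ \text{(finite sums)}:\ K_j\in\mathcal K_+,\ \phi_j\in\Phi_{\rm FH}\Big\}\subset\mathcal K\otimes\mathcal C^\infty(\Sigma)^*\otimes\mathcal C^\infty(\Sigma)^* .$$ For $d>0$, $m\in\mathbb N$ put $\|f\|_{d,m}=\max_{0\le n\le m}d^n\|f^{(n)}\|_1$ on $\mathcal D(-d,d)$. A $\mathcal C^\infty(\Sigma)^*$-valued distribution is a linear map $T:\mathcal D(\mathbb R)\to\mathcal C^\infty(\Sigma)^*$ for which there are $\ell>0$, $m$ and, for each $d>0$, a constant $c_d$ with $\|T(f)\|_{-\ell}\le c_d\|f\|_{d,m}$ for $f\in\mathcal D(-d,d)$. To a product $\Pi=\sum_jK_j\otimes\phi_j\otimes\phi_j'$ one associates the $\mathcal C^\infty(\Sigma)^*$-valued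 distribution $T_\Pi$ determined by $$\sigma(T_\Pi(f))=\sum_j\int ds'\,f(s')\,K_j(s'-i0)\,\sigma\big(\phi_j(s'/2-i0)\,\phi_j'(-s'/2+i0)\big),\qquad \sigma\in\bigcup_{E>0}\Sigma(E),$$ where $\sigma(\phi_j(s'/2-i0)\phi'_j(-s'/2+i0))$ is the boundary value at $z=s'-i0$ of the analytic function $\sigma(e^{izH/2}\phi_je^{-izH}\phi_j'e^{izH/2})$, ${\rm Im}\,z<0$. For a map $T:\mathcal D(\mathbb R)\to\mathcal C^\infty(\Sigma)^*$ put $$T\langle g_1,g_2\rangle=\int ds\,U(s)\,T\big(g_1(s+\tfrac{\cdot}{2})\,g_2(s-\tfrac{\cdot}{2})\big)\,U(s)^*\quad\text{(weak integral)}.$$ Let $\alpha\ge0$. A continuous projector $p$ in $\mathcal C^\infty(\Sigma)^*$ that is hermitean ($p(\phi^*)=p(\phi)^*$) and has finite-dimensional image contained in $\Phi_{\rm FH}$ is called *$\alpha$-approximating* for $\Pi$ if there are $\ell>0$ and $m\in\mathbb N$ such that, with $T=T_\Pi-p\,T_\Pi$, $$\sup\Big\{\frac{\|T\langle g_1,g_2\rangle\|_{-\ell}}{\|g_1\|_{d,m}\|g_2\|_{d,m}}:\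 0\ne g_1,g_2\in\mathcal D(-d,d)\Big\}=o(d^\alpha)\quad\text{as }d\to0 .$$ **Theorem.** Let $\alpha\ge0$ and $\Pi\in\Phi_{\rm pos}\setminus\{0\}$. Suppose that the vacuum vector $\Omega$ is separating for the smeared fields: $\phi(f)\Omega=0$ implies $\phi(f)=0$, for all $\phi\in\Phi_{\rm FH}$ and $f\in\mathcal D(\mathbb R)$. If $p$ is an $\alpha$-approximating projector for $\Pi$, then $p\ne0$. -/

import Mathlib

open scoped Matrix TensorProduct InnerProductSpace ComplexConjugate SchwartzMap Topology Distributions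

namespace PointlikeQFT

noncomputable section

/-! ### Minkowski space and the proper orthochronous Lorentz group -/

/-- Minkowski space with `s` spatial dimensions; coordinate `0` is time. -/
abbrev Spacetime (s : ℕ) : Type := Fin (s + 1) → ℝ

/-- The Minkowski metric `diag(1, -1, …, -1)`. -/
def minkowskiMetric (s : ℕ) : Matrix (Fin (s + 1)) (Fin (s + 1)) ℝ :=
  Matrix.diagonal (Fin.cons 1 (fun _ => -1))

/-- The Lorentz square `x ⬝ x = (x⁰)² - ∑ᵢ (xⁱ)²`. -/
def lorentzSq {s : ℕ} (x : Spacetime s) : ℝ := x 0 ^ 2 - ∑ i : Fin s, x i.succ ^ 2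

/-- The set of matrices `Λ` with `Λᵀ η Λ = η`, `det Λ = 1`, `Λ⁰₀ > 0`. -/
def IsProperOrthochronous {s : ℕ} (Λ : Matrix (Fin (s + 1)) (Fin (s + 1)) ℝ) : Prop :=
  Λᵀ * minkowskiMetric s * Λ = minkowskiMetric s ∧ Λ.det = 1 ∧ 0 < Λ 0 0

theorem minkowskiMetric_mul_self (s : ℕ) : minkowskiMetric s * minkowskiMetric s = 1 := by
  unfold minkowskiMetric
  rw [Matrix.diagonal_mul_diagonal, ← Matrix.diagonal_one]
  congr 1
  funext i
  refine Fin.cases ?_ (fun j => ?_) i <;> simp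

theorem IsProperOrthochronous.col_sq {s : ℕ} {Λ : Matrix (Fin (s + 1)) (Fin (s + 1)) ℝ}
    (h : Λᵀ * minkowskiMetric s * Λ = minkowskiMetric s) :
    Λ 0 0 ^ 2 = 1 + ∑ i : Fin s, Λ i.succ 0 ^ 2 := by
  have h0 := congrFun (congrFun h 0) 0
  rw [Matrix.mul_apply] at h0
  simp only [minkowskiMetric, Matrix.mul_diagonal, Matrix.transpose_apply,
    Fin.sum_univ_succ, Fin.cons_zero, Fin.cons_succ, Matrix.diagonal_apply_eq] at h0
  have h1 : ∑ i : Fin s, Λ i.succ 0 * -1 * Λ i.succ 0 = - ∑ i : Fin s, Λ i.succ 0 ^ 2 := by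
    rw [← Finset.sum_neg_distrib]
    exact Finset.sum_congr rfl fun i _ => by ring
  rw [h1] at h0
  linarith

theorem IsProperOrthochronous.transpose_rel {s : ℕ}
    {Λ : Matrix (Fin (s + 1)) (Fin (s + 1)) ℝ}
    (h : Λᵀ * minkowskiMetric s * Λ = minkowskiMetric s) :
    Λᵀᵀ * minkowskiMetric s * Λᵀ = minkowskiMetric s := by
  have h1 : (minkowskiMetric s * Λᵀ * minkowskiMetric s) * Λ = 1 := by
    rw [Matrix.mul_assoc, Matrix.mul_assoc, ← Matrix.mul_assoc Λᵀ, h, minkowskiMetric_mul_self]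
  have h2 := mul_eq_one_comm.mp h1
  rw [Matrix.transpose_transpose]
  calc Λ * minkowskiMetric s * Λᵀ
      = Λ * (minkowskiMetric s * Λᵀ * minkowskiMetric s) * minkowskiMetric s := by
        simp only [Matrix.mul_assoc, minkowskiMetric_mul_self, Matrix.mul_one]
    _ = minkowskiMetric s := by rw [h2, Matrix.one_mul]

/-- The proper orthochronous Lorentz group, as a monoid under matrix multiplication. -/
def Lorentz (s : ℕ) : Submonoid (Matrix (Fin (s + 1)) (Fin (s + 1)) ℝ) where
  carrier := {Λ | IsProperOrthochronous Λ}
  one_mem' := ⟨by simp, by simp, by simp⟩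
  mul_mem' := by
    rintro A B ⟨hA, hdA, hA0⟩ ⟨hB, hdB, hB0⟩
    refine ⟨?_, by simp [hdA, hdB], ?_⟩
    · calc (A * B)ᵀ * minkowskiMetric s * (A * B)
          = Bᵀ * (Aᵀ * minkowskiMetric s * A) * B := by
            simp only [Matrix.transpose_mul, Matrix.mul_assoc]
        _ = minkowskiMetric s := by rw [hA, hB]
    · have ha := IsProperOrthochronous.col_sq (IsProperOrthochronous.transpose_rel hA)
      have hb := IsProperOrthochronous.col_sq hB
      simp only [Matrix.transpose_apply] at ha
      have hcs := Finset.sum_mul_sq_le_sq_mul_sq Finset.univ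
        (fun i : Fin s => A 0 i.succ) (fun i : Fin s => B i.succ 0)
      rw [Matrix.mul_apply, Fin.sum_univ_succ]
      have hSa : 0 ≤ ∑ i : Fin s, A 0 i.succ ^ 2 := Finset.sum_nonneg fun i _ => sq_nonneg _
      have hSb : 0 ≤ ∑ i : Fin s, B i.succ 0 ^ 2 := Finset.sum_nonneg fun i _ => sq_nonneg _
      have hlt : (∑ i : Fin s, A 0 i.succ * B i.succ 0) ^ 2 < (A 0 0 * B 0 0) ^ 2 := by
        rw [mul_pow, ha, hb]
        nlinarith
      have := abs_lt_of_sq_lt_sq hlt (mul_pos hA0 hB0).le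
      have := (abs_lt.mp this).1
      linarith

/-- A region: a bounded open subset of Minkowski space. -/
def IsRegion {s : ℕ} (O : Set (Spacetime s)) : Prop := IsOpen O ∧ Bornology.IsBounded O

/-- Spacelike separation of two subsets of Minkowski space. -/
def SpacelikeSeparated {s : ℕ} (O₁ O₂ : Set (Spacetime s)) : Prop :=
  ∀ x ∈ O₁, ∀ y ∈ O₂, lorentzSq (x - y) < 0

/-- The standard double cone of radius `r` centred at the origin. -/
def doubleCone (s : ℕ) (r : ℝ) : Set (Spacetime s) :=
  {x | |x 0| + Real.sqrt (∑ i : Fin s, x i.succ ^ 2) < r}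

/-- The closed forward light cone. -/
def forwardCone (s : ℕ) : Set (Spacetime s) := {p | 0 ≤ p 0 ∧ 0 ≤ lorentzSq p}

/-! ### Local nets of von Neumann algebras in the vacuum sector -/

/-- A local net of von Neumann algebras `O ↦ 𝔄(O)` over Minkowski space in the vacuum sector
(only the values on regions matter), with a strongly continuous unitary representation `U` of the
proper orthochronous Poincaré group and vacuum vector `Ω`. -/
structure LocalNet (s : ℕ) (H : Type*) [NormedAddCommGroup H] [InnerProductSpace ℂ H]
    [CompleteSpace H] where
  /-- the local algebras -/
  alg : Set (Spacetime s) → VonNeumannAlgebra H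
  /-- the representation `U(x, Λ)` -/
  U : Spacetime s → Lorentz s → unitary (H →L[ℂ] H)
  /-- the vacuum vector -/
  Ω : H
  U_mul : ∀ (x y : Spacetime s) (Λ Λ' : Lorentz s),
    U x Λ * U y Λ' = U (x + Λ.1 *ᵥ y) (Λ * Λ')
  U_continuous : ∀ ψ : H,
    Continuous fun g : Spacetime s × Lorentz s => (U g.1 g.2 : H →L[ℂ] H) ψ
  norm_vacuum : ‖Ω‖ = 1
  U_vacuum : ∀ (x : Spacetime s) (Λ : Lorentz s), (U x Λ : H →L[ℂ] H) Ω = Ω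
  isotony : ∀ O₁ O₂ : Set (Spacetime s), IsRegion O₁ → IsRegion O₂ → O₁ ⊆ O₂ →
    ∀ A ∈ alg O₁, A ∈ alg O₂
  locality : ∀ O₁ O₂ : Set (Spacetime s), IsRegion O₁ → IsRegion O₂ → SpacelikeSeparated O₁ O₂ →
    ∀ A₁ ∈ alg O₁, ∀ A₂ ∈ alg O₂, A₁ * A₂ = A₂ * A₁
  covariance : ∀ (x : Spacetime s) (Λ : Lorentz s) (O : Set (Spacetime s)), IsRegion O →
    (fun A : H →L[ℂ] H => (U x Λ : H →L[ℂ] H) * A * star (U x Λ : H →L[ℂ] H)) '' (alg O)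
      = (alg ((fun y => Λ.1 *ᵥ y + x) '' O) : Set (H →L[ℂ] H))
  /-- Positivity of energy: the joint spectrum of the generators `P` of `U(x, 1) = exp (i P·x)`
  lies in the closed forward light cone, i.e. the joint spectral measure of `P` in every vector
  vanishes off that cone. -/
  positiveEnergy : ∀ ψ : H, ∃ μ : MeasureTheory.Measure (Spacetime s),
    MeasureTheory.IsFiniteMeasure μ ∧ μ (forwardCone s)ᶜ = 0 ∧
    ∀ x : Spacetime s,
      ⟪ψ, (U x 1 : H →L[ℂ] H) ψ⟫_ℂ
        = ∫ p, Complex.exp (Complex.I * ((∑ μ, p μ * x μ : ℝ) : ℂ)) ∂μ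
  vacuum_unique : ∀ ψ : H, (∀ x : Spacetime s, (U x 1 : H →L[ℂ] H) ψ = ψ) → ∃ c : ℂ, ψ = c • Ω

/-! ### Normal functionals -/

section Normal

variable {H : Type*} [NormedAddCommGroup H] [InnerProductSpace ℂ H]

/-- Ultraweakly continuous functionals on `𝔅(ℋ)`: those of the form
`σ(A) = ∑ₙ ⟨ξₙ, A ηₙ⟩` with `∑ ‖ξₙ‖², ∑ ‖ηₙ‖² < ∞`. -/
def IsNormalFunctional (σ : StrongDual ℂ (H →L[ℂ] H)) : Prop :=
  ∃ ξ η : ℕ → H, (Summable fun n => ‖ξ n‖ ^ 2) ∧ (Summable fun n => ‖η n‖ ^ 2) ∧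
    ∀ A : H →L[ℂ] H, HasSum (fun n => ⟪ξ n, A (η n)⟫_ℂ) (σ A)

theorem summable_interleave {E : Type*} [NormedAddCommGroup E] {x y : ℕ → E}
    (hx : Summable fun n => ‖x n‖ ^ 2) (hy : Summable fun n => ‖y n‖ ^ 2) :
    Summable fun n => ‖(if n % 2 = 0 then x (n / 2) else y (n / 2))‖ ^ 2 := by
  refine (HasSum.even_add_odd (m := ∑' n, ‖x n‖ ^ 2) (m' := ∑' n, ‖y n‖ ^ 2) ?_ ?_).summable
  · convert hx.hasSum using 2 with k
    simp
  · convert hy.hasSum using 2 with k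
    have h1 : (2 * k + 1) % 2 = 1 := by omega
    have h2 : (2 * k + 1) / 2 = k := by omega
    simp [h1, h2]

variable (H) in
/-- The space `Σ` of ultraweakly continuous functionals, with the norm of `𝔅(ℋ)*`. -/
def NormalFunctional : Submodule ℂ (StrongDual ℂ (H →L[ℂ] H)) where
  carrier := {σ | IsNormalFunctional σ}
  zero_mem' := ⟨0, 0, by simp, by simp, fun A => by simp [hasSum_zero]⟩
  add_mem' := by
    rintro σ τ ⟨ξ, η, hξ, hη, h⟩ ⟨ξ', η', hξ', hη', h'⟩
    refine ⟨_, _, summable_interleave hξ hξ', summable_interleave hη hη', fun A => ?_⟩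
    refine HasSum.even_add_odd ?_ ?_
    · have hk : (fun k => ⟪ξ k, A (η k)⟫_ℂ) = fun k =>
          ⟪(if 2 * k % 2 = 0 then ξ (2 * k / 2) else ξ' (2 * k / 2)),
            A (if 2 * k % 2 = 0 then η (2 * k / 2) else η' (2 * k / 2))⟫_ℂ := by
        funext k
        simp
      exact hk ▸ h A
    · have hk : (fun k => ⟪ξ' k, A (η' k)⟫_ℂ) = fun k =>
          ⟪(if (2 * k + 1) % 2 = 0 then ξ ((2 * k + 1) / 2) else ξ' ((2 * k + 1) / 2)),
            A (if (2 * k + 1) % 2 = 0 then η ((2 * k + 1) / 2)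
              else η' ((2 * k + 1) / 2))⟫_ℂ := by
        funext k
        have h1 : (2 * k + 1) % 2 = 1 := by omega
        have h2 : (2 * k + 1) / 2 = k := by omega
        simp [h1, h2]
      exact hk ▸ h' A
  smul_mem' := by
    rintro c σ ⟨ξ, η, hξ, hη, h⟩
    refine ⟨ξ, fun n => c • η n, hξ, ?_, fun A => ?_⟩
    · simpa [norm_smul, mul_pow] using hη.mul_left (‖c‖ ^ 2)
    · simpa [inner_smul_right] using (h A).mul_left c

end Normal

section Functionals

variable {H : Type*} [NormedAddCommGroup H] [InnerProductSpace ℂ H] [CompleteSpace H]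

/-- `σ ↦ σ(V · V*)`. -/
def conjFunctional (V : H →L[ℂ] H) (σ : StrongDual ℂ (H →L[ℂ] H)) : StrongDual ℂ (H →L[ℂ] H) :=
  σ.comp (ContinuousLinearMap.mulLeftRight ℂ (H →L[ℂ] H) V (star V))

theorem conjFunctional_apply (V : H →L[ℂ] H) (σ : StrongDual ℂ (H →L[ℂ] H)) (A : H →L[ℂ] H) :
    conjFunctional V σ A = σ (V * A * star V) := by
  simp [conjFunctional]

/-- The hermitean conjugate `σ*(A) = conj (σ(A*))`. -/
def starFunctional (σ : StrongDual ℂ (H →L[ℂ] H)) : StrongDual ℂ (H →L[ℂ] H) where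
  toFun A := conj (σ (star A))
  map_add' A B := by simp
  map_smul' c A := by simp
  cont := by fun_prop

theorem starFunctional_apply (σ : StrongDual ℂ (H →L[ℂ] H)) (A : H →L[ℂ] H) :
    starFunctional σ A = conj (σ (star A)) := rfl

theorem conjFunctional_normal (V : H →L[ℂ] H) {σ : StrongDual ℂ (H →L[ℂ] H)}
    (hσ : IsNormalFunctional σ) : IsNormalFunctional (conjFunctional V σ) := by
  obtain ⟨ξ, η, hξ, hη, h⟩ := hσ
  have hs : ∀ x : ℕ → H, (Summable fun n => ‖x n‖ ^ 2) →
      Summable fun n => ‖(star V) (x n)‖ ^ 2 := by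
    intro x hx
    refine Summable.of_nonneg_of_le (fun n => by positivity) (fun n => ?_)
      (hx.mul_left (‖star V‖ ^ 2))
    rw [← mul_pow]
    exact pow_le_pow_left₀ (norm_nonneg _) ((star V).le_opNorm _) 2
  refine ⟨fun n => (star V) (ξ n), fun n => (star V) (η n), hs ξ hξ, hs η hη, fun A => ?_⟩
  rw [conjFunctional_apply]
  convert h (V * A * star V) using 2 with n
  simp [ContinuousLinearMap.star_eq_adjoint, ContinuousLinearMap.adjoint_inner_left]

theorem starFunctional_normal {σ : StrongDual ℂ (H →L[ℂ] H)}
    (hσ : IsNormalFunctional σ) : IsNormalFunctional (starFunctional σ) := by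
  obtain ⟨ξ, η, hξ, hη, h⟩ := hσ
  refine ⟨η, ξ, hη, hξ, fun A => ?_⟩
  rw [starFunctional_apply]
  have h2 : HasSum (fun n => conj ⟪ξ n, (star A) (η n)⟫_ℂ) (conj (σ (star A))) :=
    (h (star A)).map (starRingEnd ℂ) Complex.continuous_conj
  convert h2 using 2 with n
  simp [ContinuousLinearMap.star_eq_adjoint, ContinuousLinearMap.adjoint_inner_right]

end Functionals

/-! ### Test functions and boundary values of analytic functions -/

/-- `𝒟(ℝ)`. -/
abbrev Test : Type := 𝓓((⊤ : TopologicalSpace.Opens ℝ), ℂ)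

/-- Membership in `𝒟(-d, d)`. -/
def SupportedIn (d : ℝ) (f : Test) : Prop := tsupport (f : ℝ → ℂ) ⊆ Set.Ioo (-d) d

/-- The norm `‖f‖_{d,m} = max_{0 ≤ n ≤ m} dⁿ ‖f⁽ⁿ⁾‖₁`. -/
def sobNorm (d : ℝ) (m : ℕ) (f : Test) : ℝ :=
  (Finset.range (m + 1)).sup' Finset.nonempty_range_add_one
    fun n => d ^ n * ∫ x, ‖iteratedDeriv n (f : ℝ → ℂ) x‖

/-- The test function `s' ↦ (g₁ ⋄ g₂)(s, s') = g₁(s + s'/2) g₂(s - s'/2)`. -/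
def diamond (g₁ g₂ : Test) (s : ℝ) : Test where
  toFun s' := g₁ (s + s' / 2) * g₂ (s - s' / 2)
  contDiff' := by
    have h1 := g₁.contDiff
    have h2 := g₂.contDiff
    exact (h1.comp (by fun_prop : ContDiff ℝ _ fun s' : ℝ => s + s' / 2)).mul
      (h2.comp (by fun_prop : ContDiff ℝ _ fun s' : ℝ => s - s' / 2))
  hasCompactSupport' := by
    have hc : Topology.IsClosedEmbedding fun s' : ℝ => s + s' / 2 := by
      have := ((Homeomorph.mulRight₀ (2⁻¹ : ℝ) (by norm_num)).trans
        (Homeomorph.addLeft s)).isClosedEmbedding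
      have he : (fun s' : ℝ => s + s' / 2) = ⇑((Homeomorph.mulRight₀ (2⁻¹ : ℝ) (by norm_num)).trans
          (Homeomorph.addLeft s)) := by
        funext s'
        simp [div_eq_mul_inv]
      rw [he]
      exact this
    exact (g₁.hasCompactSupport.comp_isClosedEmbedding hc).mul_right
  tsupport_subset' := by simp

/-- `F` is analytic on the lower half plane and satisfies
`sup_{-1 ≤ Im z < 0} |F(z)| |Im z|^ℓ < ∞` for some `ℓ > 0`.  Functions on the lower half plane
are represented by their extension by zero. -/
def RegularAtBoundary (F : ℂ → ℂ) : Prop :=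
  DifferentiableOn ℂ F {z | z.im < 0} ∧ (∀ z : ℂ, 0 ≤ z.im → F z = 0) ∧
    ∃ ℓ : ℝ, 0 < ℓ ∧ ∃ C : ℝ, ∀ z : ℂ, -1 ≤ z.im → z.im < 0 → ‖F z‖ * |z.im| ^ ℓ ≤ C

/-- The space `𝒦` of analytic functions on the lower half plane that are regular at the
boundary. -/
def Kernel : Submodule ℂ (ℂ → ℂ) where
  carrier := {F | RegularAtBoundary F}
  zero_mem' := ⟨differentiableOn_const (0 : ℂ), by simp, 1, one_pos, 0, by simp⟩
  add_mem' := by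
    rintro F G ⟨hF, hF0, ℓ, hℓ, C, hC⟩ ⟨hG, hG0, m, hm, D, hD⟩
    refine ⟨hF.add hG, fun z hz => by simp [hF0 z hz, hG0 z hz], ℓ + m, by positivity, C + D,
      fun z hz1 hz2 => ?_⟩
    have h0 : 0 < |z.im| := abs_pos.mpr hz2.ne
    have h1 : |z.im| ≤ 1 := by rw [abs_of_neg hz2]; linarith
    have hl : |z.im| ^ ℓ ≤ 1 := Real.rpow_le_one h0.le h1 hℓ.le
    have hm' : |z.im| ^ m ≤ 1 := Real.rpow_le_one h0.le h1 hm.le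
    have hl0 : 0 < |z.im| ^ ℓ := Real.rpow_pos_of_pos h0 _
    have hm0 : 0 < |z.im| ^ m := Real.rpow_pos_of_pos h0 _
    rw [Real.rpow_add h0, Pi.add_apply]
    calc ‖F z + G z‖ * (|z.im| ^ ℓ * |z.im| ^ m)
        ≤ (‖F z‖ + ‖G z‖) * (|z.im| ^ ℓ * |z.im| ^ m) := by
          gcongr
          exact norm_add_le _ _
      _ = (‖F z‖ * |z.im| ^ ℓ) * |z.im| ^ m + (‖G z‖ * |z.im| ^ m) * |z.im| ^ ℓ := by ring
      _ ≤ (‖F z‖ * |z.im| ^ ℓ) * 1 + (‖G z‖ * |z.im| ^ m) * 1 := by gcongr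
      _ ≤ C + D := by
          have := hC z hz1 hz2
          have := hD z hz1 hz2
          linarith
  smul_mem' := by
    rintro c F ⟨hF, hF0, ℓ, hℓ, C, hC⟩
    refine ⟨hF.const_smul c, fun z hz => by simp [hF0 z hz], ℓ, hℓ, ‖c‖ * C, fun z h1 h2 => ?_⟩
    rw [Pi.smul_apply, norm_smul, mul_assoc]
    exact mul_le_mul_of_nonneg_left (hC z h1 h2) (norm_nonneg _)

/-- `c = ∫ f(x) F(x - i0) dx`, the boundary value distribution of `F` evaluated at `f`. -/
def HasBoundaryValue (F : ℂ → ℂ) (f : ℝ → ℂ) (c : ℂ) : Prop :=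
  Filter.Tendsto (fun y : ℝ => ∫ x : ℝ, f x * F (x - y * Complex.I)) (𝓝[>] 0) (𝓝 c)

/-- Membership in `𝒦₊`: the boundary value `K(x - i0)` is a distribution of positive type, i.e.
`∫ ds ds' K(s' - i0) conj (g(s + s'/2)) g(s - s'/2) ≥ 0` for all Schwartz functions `g`. -/
def IsPositiveType (K : Kernel) : Prop :=
  ∀ g : 𝓢(ℝ, ℂ), ∃ c : ℝ, 0 ≤ c ∧
    HasBoundaryValue K.1 (fun s' => ∫ s : ℝ, conj (g (s + s' / 2)) * g (s - s' / 2)) c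

namespace LocalNet

variable {s : ℕ} {H : Type*} [NormedAddCommGroup H] [InnerProductSpace ℂ H] [CompleteSpace H]
variable (N : LocalNet s H)

/-! ### The Hamiltonian and its functional calculus -/

/-- Time translations `U(t) = exp (i t H)`. -/
def timeU (t : ℝ) : H →L[ℂ] H := (N.U (Pi.single 0 t) 1 : H →L[ℂ] H)

/-- `μ` is the spectral measure in the vector `ψ` of the Hamiltonian, i.e. of the generator of
time translations: `⟨ψ, U(t) ψ⟩ = ∫ exp (i t λ) dμ(λ)`. -/
def IsEnergyMeasure (ψ : H) (μ : MeasureTheory.Measure ℝ) : Prop :=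
  MeasureTheory.IsFiniteMeasure μ ∧
    ∀ t : ℝ, ⟪ψ, N.timeU t ψ⟫_ℂ = ∫ e : ℝ, Complex.exp (Complex.I * ((t * e : ℝ) : ℂ)) ∂μ

/-- `B` is the function `b(H)` of the Hamiltonian: `⟨ψ, B ψ⟩ = ∫ b dμ_ψ` with `μ_ψ` the spectral
measure of the Hamiltonian in `ψ`. -/
def IsEnergyFunction (b : ℝ → ℂ) (B : H →L[ℂ] H) : Prop :=
  ∀ (ψ : H) (μ : MeasureTheory.Measure ℝ), N.IsEnergyMeasure ψ μ → ⟪ψ, B ψ⟫_ℂ = ∫ e, b e ∂μ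

open Classical in
/-- The bounded operator `b(H)`, for a function `b` that is Borel on `ℝ` and bounded on the
spectrum of the Hamiltonian, which is contained in `[0, ∞)`. -/
def energyFunction (b : ℝ → ℂ) : H →L[ℂ] H :=
  if h : ∃ B, N.IsEnergyFunction b B then h.choose else 0

/-- `R^ℓ = (1 + H)^{-ℓ}`. -/
def R (ℓ : ℝ) : H →L[ℂ] H := N.energyFunction fun e => (((1 + e) ^ (-ℓ) : ℝ) : ℂ)

/-- The spectral projector `P(E)` of the Hamiltonian for the interval `[0, E]`. -/
def P (E : ℝ) : H →L[ℂ] H := N.energyFunction ((Set.Icc 0 E).indicator 1)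

theorem exists_energyMeasure (ψ : H) : ∃ μ, N.IsEnergyMeasure ψ μ := by
  obtain ⟨μ, hfin, -, h⟩ := N.positiveEnergy ψ
  have hm : Measurable fun p : Spacetime s => p 0 := measurable_pi_apply 0
  refine ⟨μ.map fun p => p 0, inferInstance, fun t => ?_⟩
  rw [timeU, h, MeasureTheory.integral_map hm.aemeasurable
    (Measurable.aestronglyMeasurable (by fun_prop))]
  congr 1
  funext p
  congr 3
  rw [Finset.sum_eq_single 0] <;> simp +contextual [mul_comm]

theorem IsEnergyFunction.unique {b : ℝ → ℂ} {B B' : H →L[ℂ] H} (h : N.IsEnergyFunction b B)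
    (h' : N.IsEnergyFunction b B') : B = B' := by
  have : ((B : H →ₗ[ℂ] H)) = (B' : H →ₗ[ℂ] H) := by
    refine (ext_inner_map _ _).mp fun ψ => ?_
    obtain ⟨μ, hμ⟩ := N.exists_energyMeasure ψ
    have h1 := (h ψ μ hμ).trans (h' ψ μ hμ).symm
    rw [← inner_conj_symm, ← inner_conj_symm (B'.toLinearMap ψ)]
    exact congrArg conj h1
  ext x
  exact LinearMap.congr_fun this x

theorem energyFunction_cases (b : ℝ → ℂ) :
    N.IsEnergyFunction b (N.energyFunction b) ∨ N.energyFunction b = 0 := by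
  unfold energyFunction
  split_ifs with h
  · exact Or.inl h.choose_spec
  · exact Or.inr rfl

theorem clm_mul_app (A B : H →L[ℂ] H) (x : H) : (A * B) x = A (B x) := rfl

theorem timeU_mul (t t' : ℝ) : N.timeU t * N.timeU t' = N.timeU (t + t') := by
  have h := N.U_mul (Pi.single 0 t) (Pi.single 0 t') 1 1
  simp only [mul_one, Submonoid.coe_one, Matrix.one_mulVec] at h
  rw [← Pi.single_add] at h
  exact congrArg Subtype.val h

theorem timeU_star_mul (t : ℝ) : star (N.timeU t) * N.timeU t = 1 :=
  Unitary.star_mul_self_of_mem (N.U _ _).2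

theorem timeU_mul_star (t : ℝ) : N.timeU t * star (N.timeU t) = 1 :=
  Unitary.mul_star_self_of_mem (N.U _ _).2

theorem inner_timeU (t : ℝ) (x y : H) : ⟪N.timeU t x, N.timeU t y⟫_ℂ = ⟪x, y⟫_ℂ := by
  rw [← ContinuousLinearMap.adjoint_inner_right, ← ContinuousLinearMap.star_eq_adjoint,
    ← clm_mul_app, timeU_star_mul]
  rfl

theorem isEnergyMeasure_timeU (t : ℝ) {ψ : H} {μ : MeasureTheory.Measure ℝ}
    (h : N.IsEnergyMeasure ψ μ) : N.IsEnergyMeasure (N.timeU t ψ) μ := by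
  refine ⟨h.1, fun t' => ?_⟩
  rw [← h.2, ← clm_mul_app, timeU_mul, add_comm, ← timeU_mul,
    clm_mul_app, inner_timeU]

theorem isEnergyMeasure_of_timeU (t : ℝ) {ψ : H} {μ : MeasureTheory.Measure ℝ}
    (h : N.IsEnergyMeasure (N.timeU t ψ) μ) : N.IsEnergyMeasure ψ μ := by
  refine ⟨h.1, fun t' => ?_⟩
  rw [← h.2, ← clm_mul_app (N.timeU t'), timeU_mul, add_comm, ← timeU_mul,
    clm_mul_app, inner_timeU]

theorem timeU_commute_energyFunction (t : ℝ) (b : ℝ → ℂ) :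
    N.timeU t * N.energyFunction b = N.energyFunction b * N.timeU t := by
  rcases N.energyFunction_cases b with h | h
  · have h2 : N.IsEnergyFunction b (star (N.timeU t) * N.energyFunction b * N.timeU t) := by
      intro ψ μ hμ
      rw [← h _ μ (N.isEnergyMeasure_timeU t hμ)]
      simp [ContinuousLinearMap.star_eq_adjoint, ContinuousLinearMap.adjoint_inner_right]
    have h3 := IsEnergyFunction.unique N h h2
    calc N.timeU t * N.energyFunction b
        = N.timeU t * (star (N.timeU t) * N.energyFunction b * N.timeU t) := by rw [← h3]
      _ = (N.timeU t * star (N.timeU t)) * (N.energyFunction b * N.timeU t) := by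
          simp only [mul_assoc]
      _ = N.energyFunction b * N.timeU t := by rw [timeU_mul_star, one_mul]
  · rw [h, mul_zero, zero_mul]

theorem star_R (ℓ : ℝ) : star (N.R ℓ) = N.R ℓ := by
  rcases N.energyFunction_cases (fun e => (((1 + e) ^ (-ℓ) : ℝ) : ℂ)) with h | h
  · refine (IsEnergyFunction.unique N h fun ψ μ hμ => ?_).symm
    have h1 : ⟪ψ, (N.R ℓ) ψ⟫_ℂ = ∫ e : ℝ, (((1 + e) ^ (-ℓ) : ℝ) : ℂ) ∂μ := h ψ μ hμ
    rw [integral_complex_ofReal] at h1 ⊢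
    rw [ContinuousLinearMap.star_eq_adjoint, ContinuousLinearMap.adjoint_inner_right,
      ← inner_conj_symm]
    rw [h1]
    exact Complex.conj_ofReal _
  · change N.R ℓ = 0 at h
    rw [h, star_zero]

/-! ### Smooth functionals `𝒞^∞(Σ)` -/

/-- `C` is a bound for `‖σ‖_ℓ = ‖σ((1+H)^ℓ · (1+H)^ℓ)‖`.  The bounded operators on which
`σ((1+H)^ℓ · (1+H)^ℓ)` is defined are the `R^ℓ A R^ℓ`, with value `σ(A)`. -/
def EnergyBound (ℓ : ℝ) (σ : StrongDual ℂ (H →L[ℂ] H)) (C : ℝ) : Prop :=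
  0 ≤ C ∧ ∀ A : H →L[ℂ] H, ‖σ A‖ ≤ C * ‖N.R ℓ * A * N.R ℓ‖

/-- `𝒞^∞(Σ)` as a subspace of `Σ`: all `σ` with `‖σ‖_ℓ < ∞` for every `ℓ > 0`. -/
def smoothSubmodule : Submodule ℂ (StrongDual ℂ (H →L[ℂ] H)) where
  carrier := {σ | IsNormalFunctional σ ∧ ∀ ℓ : ℝ, 0 < ℓ → ∃ C, N.EnergyBound ℓ σ C}
  zero_mem' := ⟨(NormalFunctional H).zero_mem, fun ℓ _ => ⟨0, le_rfl, by simp⟩⟩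
  add_mem' := by
    rintro σ τ ⟨hσ, h⟩ ⟨hτ, h'⟩
    refine ⟨(NormalFunctional H).add_mem hσ hτ, fun ℓ hℓ => ?_⟩
    obtain ⟨C, hC0, hC⟩ := h ℓ hℓ
    obtain ⟨D, hD0, hD⟩ := h' ℓ hℓ
    refine ⟨C + D, by positivity, fun A => ?_⟩
    rw [add_mul]
    exact (norm_add_le _ _).trans (add_le_add (hC A) (hD A))
  smul_mem' := by
    rintro c σ ⟨hσ, h⟩
    refine ⟨(NormalFunctional H).smul_mem c hσ, fun ℓ hℓ => ?_⟩
    obtain ⟨C, hC0, hC⟩ := h ℓ hℓ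
    refine ⟨‖c‖ * C, by positivity, fun A => ?_⟩
    rw [smul_apply, norm_smul, mul_assoc]
    exact mul_le_mul_of_nonneg_left (hC A) (norm_nonneg _)

/-- The space `𝒞^∞(Σ)`; a separate type, because its topology is not the norm topology. -/
def Smooth : Type _ := ↥N.smoothSubmodule

instance : AddCommGroup N.Smooth := inferInstanceAs (AddCommGroup ↥N.smoothSubmodule)

instance : Module ℂ N.Smooth := inferInstanceAs (Module ℂ ↥N.smoothSubmodule)

/-- The inclusion `Ξ : 𝒞^∞(Σ) → Σ`. -/
def incl : N.Smooth →ₗ[ℂ] NormalFunctional H where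
  toFun σ := ⟨σ.1, σ.2.1⟩
  map_add' _ _ := rfl
  map_smul' _ _ := rfl

instance : CoeFun N.Smooth fun _ => (H →L[ℂ] H) → ℂ := ⟨fun σ A => σ.1 A⟩

/-- The norm `‖σ‖_ℓ` on `𝒞^∞(Σ)`. -/
def energyNorm (ℓ : ℝ) (σ : N.Smooth) : ℝ := sInf {C | N.EnergyBound ℓ σ.1 C}

theorem energyNorm_le {ℓ : ℝ} {σ : N.Smooth} {C : ℝ} (h : N.EnergyBound ℓ σ.1 C) :
    N.energyNorm ℓ σ ≤ C :=
  csInf_le ⟨0, fun _ hD => hD.1⟩ h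

theorem energyBound_energyNorm {ℓ : ℝ} (hℓ : 0 < ℓ) (σ : N.Smooth) :
    N.EnergyBound ℓ σ.1 (N.energyNorm ℓ σ) := by
  have hne : {C | N.EnergyBound ℓ σ.1 C}.Nonempty := σ.2.2 ℓ hℓ
  refine ⟨le_csInf hne fun _ hC => hC.1, fun A => ?_⟩
  rcases (norm_nonneg (N.R ℓ * A * N.R ℓ)).eq_or_lt with h0 | h0
  · obtain ⟨C, hC⟩ := hne
    have := hC.2 A
    rw [← h0, mul_zero] at this ⊢
    exact this
  · rw [← div_le_iff₀ h0]
    exact le_csInf hne fun C hC => (div_le_iff₀ h0).mpr (hC.2 A)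

/-- The seminorms defining the topology of `𝒞^∞(Σ)`. -/
def energySeminorm (ℓ : {ℓ : ℝ // 0 < ℓ}) : Seminorm ℂ N.Smooth :=
  Seminorm.ofSMulLE (N.energyNorm ℓ.1)
    (le_antisymm (N.energyNorm_le ⟨le_rfl, fun A => by
      change ‖(0 : StrongDual ℂ (H →L[ℂ] H)) A‖ ≤ _
      simp⟩) (N.energyBound_energyNorm ℓ.2 0).1)
    (fun σ τ => by
      obtain ⟨h0, h⟩ := N.energyBound_energyNorm ℓ.2 σ
      obtain ⟨h0', h'⟩ := N.energyBound_energyNorm ℓ.2 τ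
      refine N.energyNorm_le ⟨add_nonneg h0 h0', fun A => ?_⟩
      rw [add_mul]
      exact (norm_add_le (σ.1 A) (τ.1 A)).trans (add_le_add (h A) (h' A)))
    (fun c σ => by
      obtain ⟨h0, h⟩ := N.energyBound_energyNorm ℓ.2 σ
      refine N.energyNorm_le ⟨mul_nonneg (norm_nonneg _) h0, fun A => ?_⟩
      change ‖c • σ.1 A‖ ≤ _
      rw [norm_smul, mul_assoc]
      exact mul_le_mul_of_nonneg_left (h A) (norm_nonneg _))

/-- The family of all norms `‖·‖_ℓ`, `ℓ > 0`. -/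
def seminormFamily : SeminormFamily ℂ N.Smooth {ℓ : ℝ // 0 < ℓ} := fun ℓ => N.energySeminorm ℓ

instance : Nonempty {ℓ : ℝ // 0 < ℓ} := ⟨⟨1, one_pos⟩⟩

/-- The Fréchet topology of `𝒞^∞(Σ)`. -/
instance : TopologicalSpace N.Smooth := N.seminormFamily.moduleFilterBasis.topology

theorem withSeminorms : WithSeminorms N.seminormFamily := ⟨rfl⟩

/-- `𝒞^∞(Σ)*` with its weak-* topology. -/
abbrev SmoothDual : Type _ := WeakDual ℂ N.Smooth

/-- The action `σ ↦ σ(U(t) · U(t)*)` of time translations on `𝒞^∞(Σ)`. -/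
def translate (t : ℝ) (σ : N.Smooth) : N.Smooth :=
  ⟨conjFunctional (N.timeU t) σ.1, conjFunctional_normal _ σ.2.1, fun ℓ hℓ => by
    obtain ⟨C, hC0, hC⟩ := σ.2.2 ℓ hℓ
    refine ⟨C, hC0, fun A => ?_⟩
    rw [conjFunctional_apply]
    refine (hC _).trans_eq ?_
    have h1 : N.R ℓ * N.timeU t = N.timeU t * N.R ℓ := (N.timeU_commute_energyFunction t _).symm
    have h2 : star (N.timeU t) * N.R ℓ = N.R ℓ * star (N.timeU t) := by
      have := congrArg star h1
      simpa [N.star_R] using this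
    have h3 : N.R ℓ * (N.timeU t * A * star (N.timeU t)) * N.R ℓ
        = N.timeU t * (N.R ℓ * A * N.R ℓ) * star (N.timeU t) := by
      calc N.R ℓ * (N.timeU t * A * star (N.timeU t)) * N.R ℓ
          = (N.R ℓ * N.timeU t) * A * (star (N.timeU t) * N.R ℓ) := by simp only [mul_assoc]
        _ = _ := by rw [h1, h2]; simp only [mul_assoc]
    have hU : N.timeU t ∈ unitary (H →L[ℂ] H) := (N.U _ _).2
    rw [h3, CStarRing.norm_mul_mem_unitary _ (Unitary.star_mem hU),
      CStarRing.norm_mem_unitary_mul _ hU]⟩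

/-- Hermitean conjugation `σ*(A) = conj (σ(A*))` on `𝒞^∞(Σ)`. -/
def starSmooth (σ : N.Smooth) : N.Smooth :=
  ⟨starFunctional σ.1, starFunctional_normal σ.2.1, fun ℓ hℓ => by
    obtain ⟨C, hC0, hC⟩ := σ.2.2 ℓ hℓ
    refine ⟨C, hC0, fun A => ?_⟩
    rw [starFunctional_apply, RCLike.norm_conj]
    refine (hC _).trans_eq ?_
    rw [← norm_star (N.R ℓ * A * N.R ℓ)]
    simp [N.star_R, mul_assoc]⟩

theorem energyNorm_starSmooth_le (ℓ : {ℓ : ℝ // 0 < ℓ}) (σ : N.Smooth) :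
    N.energyNorm ℓ.1 (N.starSmooth σ) ≤ N.energyNorm ℓ.1 σ := by
  obtain ⟨h0, h⟩ := N.energyBound_energyNorm ℓ.2 σ
  refine N.energyNorm_le ⟨h0, fun A => ?_⟩
  change ‖starFunctional σ.1 A‖ ≤ _
  rw [starFunctional_apply, RCLike.norm_conj]
  refine (h _).trans_eq ?_
  rw [← norm_star (N.R ℓ.1 * A * N.R ℓ.1)]
  simp [N.star_R, mul_assoc]

/-- Hermitean conjugation as a conjugate-linear map. -/
def starSmoothₗ : N.Smooth →ₛₗ[starRingEnd ℂ] N.Smooth where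
  toFun := N.starSmooth
  map_add' σ τ := Subtype.ext <| ContinuousLinearMap.ext fun A =>
    map_add (starRingEnd ℂ) (σ.1 (star A)) (τ.1 (star A))
  map_smul' c σ := Subtype.ext <| ContinuousLinearMap.ext fun A =>
    map_mul (starRingEnd ℂ) c (σ.1 (star A))

theorem continuous_starSmooth : Continuous N.starSmooth := by
  refine WithSeminorms.continuous_of_isBounded N.withSeminorms N.withSeminorms N.starSmoothₗ ?_
  intro ℓ
  refine ⟨{ℓ}, 1, fun σ => ?_⟩
  have h := N.energyNorm_starSmooth_le ℓ σ
  rw [Finset.sup_singleton, one_smul]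
  exact h

/-- Hermitean conjugation on the dual: `φ*(σ) = conj (φ(σ*))`. -/
def starDual (φ : N.SmoothDual) : N.SmoothDual :=
  StrongDual.toWeakDual
    { toFun := fun σ => conj (φ (N.starSmooth σ))
      map_add' := fun σ τ => by
        change conj (φ (N.starSmoothₗ (σ + τ))) = _
        rw [map_add, map_add, map_add]
        rfl
      map_smul' := fun c σ => by
        change conj (φ (N.starSmoothₗ (c • σ))) = _
        rw [map_smulₛₗ, map_smul, smul_eq_mul, map_mul, Complex.conj_conj]
        rfl
      cont := Complex.continuous_conj.comp ((map_continuous φ).comp N.continuous_starSmooth) }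

/-- `Σ(E) = {σ(P(E) · P(E)) | σ ∈ Σ}`. -/
def IsEnergyBounded (E : ℝ) (σ : StrongDual ℂ (H →L[ℂ] H)) : Prop :=
  ∃ τ : StrongDual ℂ (H →L[ℂ] H), IsNormalFunctional τ ∧
    ∀ A : H →L[ℂ] H, σ A = τ (N.P E * A * N.P E)

/-! ### The phase space condition and pointlike fields -/

/-- `r^{-γ} ‖(Ξ - ψ) ⌈ 𝔄(r)‖_ℓ → 0` as `r → 0` for all sufficiently large `ℓ`, where the norm is
that of maps from `𝒞^∞(Σ)` with `‖·‖_ℓ` to functionals on `𝔄(r) = 𝔄(𝒪_r)`; and `ψ` has finite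
rank. -/
def Approximates (γ : ℝ) (ψ : N.Smooth →L[ℂ] NormalFunctional H) : Prop :=
  Module.Finite ℂ (LinearMap.range (ψ : N.Smooth →ₗ[ℂ] NormalFunctional H)) ∧
  ∃ ℓ₀ : ℝ, 0 < ℓ₀ ∧ ∀ ℓ : ℝ, ℓ₀ ≤ ℓ → ∃ ε : ℝ → ℝ,
    Filter.Tendsto (fun r => r ^ (-γ) * ε r) (𝓝[>] 0) (𝓝 0) ∧
    ∀ r : ℝ, 0 < r → ∀ (σ : N.Smooth), ∀ A ∈ N.alg (doubleCone s r),
      ‖(N.incl σ - ψ σ).1 A‖ ≤ ε r * N.energyNorm ℓ σ * ‖A‖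

/-- The microscopic phase space condition. -/
def MicroscopicPhaseSpaceCondition : Prop :=
  ∀ γ : ℝ, 0 ≤ γ → ∃ ψ : N.Smooth →L[ℂ] NormalFunctional H, N.Approximates γ ψ

/-- The space `Φ_γ ⊆ 𝒞^∞(Σ)*`: the image of the dual map `ψ* : 𝔅(ℋ) = Σ* → 𝒞^∞(Σ)*` for an
approximating map `ψ` of minimal rank (the image does not depend on which). -/
def FieldsOfOrder (γ : ℝ) : Set N.SmoothDual :=
  {φ | ∃ ψ : N.Smooth →L[ℂ] NormalFunctional H, N.Approximates γ ψ ∧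
    (∀ ψ' : N.Smooth →L[ℂ] NormalFunctional H, N.Approximates γ ψ' →
      Module.finrank ℂ (LinearMap.range (ψ : N.Smooth →ₗ[ℂ] NormalFunctional H)) ≤
        Module.finrank ℂ (LinearMap.range (ψ' : N.Smooth →ₗ[ℂ] NormalFunctional H))) ∧
    ∃ A : H →L[ℂ] H, ∀ σ : N.Smooth, φ σ = (ψ σ).1 A}

/-- The field content `Φ_FH = ⋃_γ Φ_γ`. -/
def Fields : Set N.SmoothDual := ⋃ γ ∈ Set.Ici (0 : ℝ), N.FieldsOfOrder γ

/-- The smeared field `φ(f) = ∫ dt f(t) U(t) φ U(t)*`, a weak integral, evaluated in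
functionals `σ ∈ 𝒞^∞(Σ)`. -/
def smear (φ : N.SmoothDual) (f : Test) (σ : N.Smooth) : ℂ := ∫ t : ℝ, f t * φ (N.translate t σ)

/-- The vacuum is separating for the smeared fields: `φ(f) Ω = 0` implies `φ(f) = 0`.  Here
`φ(f) Ω = 0` means that the matrix elements `⟨χ, φ(f) Ω⟩` vanish for all `χ` for which
`⟨χ, · Ω⟩` is in `𝒞^∞(Σ)`, that is, for all `χ ∈ 𝒞^∞(ℋ) = ⋂_ℓ R^ℓ ℋ`. -/
def VacuumSeparating : Prop :=
  ∀ φ ∈ N.Fields, ∀ f : Test,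
    (∀ (χ : H) (σ : N.Smooth), (∀ A : H →L[ℂ] H, σ A = ⟪χ, A N.Ω⟫_ℂ) → N.smear φ f σ = 0) →
      ∀ σ : N.Smooth, N.smear φ f σ = 0

/-! ### Products and their distributions -/

/-- The space `𝒦 ⊗ 𝒞^∞(Σ)* ⊗ 𝒞^∞(Σ)*` (algebraic tensor products). -/
abbrev Products : Type _ := Kernel ⊗[ℂ] (N.SmoothDual ⊗[ℂ] N.SmoothDual)

/-- The set of classically positive products `∑ⱼ Kⱼ ⊗ φⱼ* ⊗ φⱼ` with `Kⱼ ∈ 𝒦₊`,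
`φⱼ ∈ Φ_FH`. -/
def PositiveProducts : Set N.Products :=
  {Q | ∃ (n : ℕ) (K : Fin n → Kernel) (φ : Fin n → N.SmoothDual),
    (∀ j, IsPositiveType (K j)) ∧ (∀ j, φ j ∈ N.Fields) ∧
    Q = ∑ j, K j ⊗ₜ[ℂ] (N.starDual (φ j) ⊗ₜ[ℂ] φ j)}

/-- `B` is the bounded operator `e^{-εH} φ e^{-εH}`, determined by its matrix elements
`⟨χ, B ξ⟩ = φ(⟨e^{-εH} χ, · e^{-εH} ξ⟩)`. -/
def IsDamped (ε : ℝ) (φ : N.SmoothDual) (B : H →L[ℂ] H) : Prop :=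
  ∀ (χ ξ : H) (σ : N.Smooth),
    (∀ A : H →L[ℂ] H, σ A =
      ⟪N.energyFunction (fun e => Complex.exp (-((ε * e : ℝ) : ℂ))) χ,
        A (N.energyFunction (fun e => Complex.exp (-((ε * e : ℝ) : ℂ))) ξ)⟫_ℂ) →
    ⟪χ, B ξ⟫_ℂ = φ σ

open Classical in
/-- The bounded operator `e^{-εH} φ e^{-εH}`, for `φ ∈ 𝒞^∞(Σ)*` and `ε > 0`. -/
def damped (ε : ℝ) (φ : N.SmoothDual) : H →L[ℂ] H :=
  if h : ∃ B, N.IsDamped ε φ B then h.choose else 0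

/-- For `σ ∈ Σ(E)` and `Im z < 0`, the function
`σ(φ(z/2) φ'(-z/2)) = σ(e^{izH/2} φ e^{-izH} φ' e^{izH/2})`.  In order to write it with bounded
operators only, `P(E)` is inserted on both sides (this does not change `σ`) and factors
`e^{εH} e^{-εH}`, with `ε = -Im z / 4`, are inserted on both sides of each of `φ`, `φ'`. -/
def twoPoint (E : ℝ) (σ : StrongDual ℂ (H →L[ℂ] H)) (φ φ' : N.SmoothDual) (z : ℂ) : ℂ :=
  let ε : ℝ := -z.im / 4
  let W := N.energyFunction
    ((Set.Icc 0 E).indicator fun e => Complex.exp ((Complex.I * z / 2 + ε) * e))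
  let M := N.energyFunction fun e => Complex.exp ((-(Complex.I * z) + 2 * ε) * e)
  σ (W * N.damped ε φ * M * N.damped ε φ' * W)

/-- `C` is a bound for the norm `‖Φ‖_{-ℓ}` dual to `‖·‖_ℓ`. -/
def DualBound (ℓ : ℝ) (Φ : N.Smooth → ℂ) (C : ℝ) : Prop :=
  ∀ σ : N.Smooth, ‖Φ σ‖ ≤ C * N.energyNorm ℓ σ

/-- `T` is a `𝒞^∞(Σ)*`-valued distribution. -/
def IsDualValuedDistribution (T : Test →ₗ[ℂ] N.SmoothDual) : Prop :=
  ∃ ℓ : ℝ, 0 < ℓ ∧ ∃ m : ℕ, ∀ d : ℝ, 0 < d → ∃ c : ℝ,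
    ∀ f : Test, SupportedIn d f → N.DualBound ℓ (T f) (c * sobNorm d m f)

/-- `T` is the `𝒞^∞(Σ)*`-valued distribution associated with the product `Q = ∑ⱼ Kⱼ ⊗ φⱼ ⊗ φⱼ'`:
for every energy-bounded `σ`,
`σ(T(f)) = ∑ⱼ ∫ ds' f(s') Kⱼ(s' - i0) σ(φⱼ(s'/2 - i0) φⱼ'(-s'/2 + i0))`. -/
def IsProductDistribution (Q : N.Products) (T : Test →ₗ[ℂ] N.SmoothDual) : Prop :=
  N.IsDualValuedDistribution T ∧
  ∀ (n : ℕ) (K : Fin n → Kernel) (φ φ' : Fin n → N.SmoothDual),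
    Q = ∑ j, K j ⊗ₜ[ℂ] (φ j ⊗ₜ[ℂ] φ' j) →
    ∀ (E : ℝ) (σ : N.Smooth), 0 < E → N.IsEnergyBounded E σ.1 → ∀ f : Test,
      HasBoundaryValue (fun z => ∑ j, (K j).1 z * N.twoPoint E σ.1 (φ j) (φ' j) z) f (T f σ)

/-- `∫ ds U(s) (T ∗ (g₁, g₂))(s) U(s)*` with `(T ∗ (g₁, g₂))(s) = ∫ ds' (g₁ ⋄ g₂)(s, s') T(s')`:
a weak integral, evaluated in functionals `σ ∈ 𝒞^∞(Σ)`. -/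
def convolutionIntegral (T : Test → N.SmoothDual) (g₁ g₂ : Test) (σ : N.Smooth) : ℂ :=
  ∫ t : ℝ, T (diamond g₁ g₂ t) (N.translate t σ)

/-- A continuous hermitean projector in `𝒞^∞(Σ)*` with finite-dimensional image in `Φ_FH`. -/
structure IsFieldProjector (p : N.SmoothDual →L[ℂ] N.SmoothDual) : Prop where
  idempotent : ∀ φ, p (p φ) = p φ
  hermitean : ∀ φ, p (N.starDual φ) = N.starDual (p φ)
  finite : Module.Finite ℂ (LinearMap.range (p : N.SmoothDual →ₗ[ℂ] N.SmoothDual))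
  range_subset : ∀ φ, p φ ∈ N.Fields

/-- `p` is `α`-approximating for the product `Q`: with `T` the distribution of `Q`, the bilinear
map `(g₁, g₂) ↦ convolutionIntegral (T - p T) g₁ g₂` on `𝒟(-d, d)`, measured in `‖·‖_{-ℓ}`
relative to `‖g₁‖_{d,m} ‖g₂‖_{d,m}`, has norm `o(d^α)` as `d → 0`. -/
def IsApproximating (α : ℝ) (Q : N.Products) (p : N.SmoothDual →L[ℂ] N.SmoothDual) : Prop :=
  N.IsFieldProjector p ∧
  ∃ T : Test →ₗ[ℂ] N.SmoothDual, N.IsProductDistribution Q T ∧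
  ∃ ℓ : ℝ, 0 < ℓ ∧ ∃ m : ℕ, ∃ ε : ℝ → ℝ,
    ε =o[𝓝[>] 0] (fun d : ℝ => d ^ α) ∧
    ∀ d : ℝ, 0 < d → ∀ g₁ g₂ : Test, SupportedIn d g₁ → SupportedIn d g₂ →
      N.DualBound ℓ (N.convolutionIntegral (fun f => T f - p (T f)) g₁ g₂)
        (ε d * sobNorm d m g₁ * sobNorm d m g₂)

end LocalNet

end

end PointlikeQFT

namespace PointlikeQFT

noncomputable section

open MeasureTheory

/-!
Suppose that `0` is approximating for `∑ j, K j ⊗ φ j* ⊗ φ j`, and evaluate everything in the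
vacuum functional, which is translation invariant and of bounded energy. There the product
distribution is the boundary value of `h z = ∑ j, K j z * w j z` with
`w j z = ⟨φ j Ω, exp (-izH) φ j Ω⟩`.

For a function `F` on the lower half plane consider the kernel `(a, a') ↦ F (conj a - a')`, with
`a` and `a'` in the strip `0 < Im < 1 / 2`. It is positive semidefinite for `F = w j`, being the
Gram matrix of the vectors `exp (iaH) φ j Ω`, and for `F = K j`, as one sees by testing the
distribution `K j (x - i0)` of positive type with combinations of translated Gaussians whose width
tends to zero. By the Schur product theorem it is positive semidefinite for `F = h`, so that it is
itself a Gram matrix. The Cauchy-Schwarz inequality then bounds the square of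
`∫ t, g t * h (-t - i(η + y))` by `|h (-2iη)|` times a double integral of `g`, `g` and
`h (· - 2iy)`. As `y → 0` this double integral tends to the weak integral of the product
distribution against `g` and `g`, evaluated in the vacuum. By assumption it is small when `g` is a
normalized bump function concentrating at the origin, whereas `∫ t, g t * h (-t - iη)` then tends
to `h (-iη)`. Hence `h (-iη) = 0` for `0 < η < 1 / 2`.

At `z = -iη` every summand of `h` is nonnegative, so each of them vanishes. If `K j ≠ 0`, then
`K j (-iη) ≠ 0` for arbitrarily small `η`, and `exp (-εH) φ j Ω = 0` for all `ε > 0`. So the smeared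
fields `φ j (f)` annihilate the vacuum, which is separating, and `φ j = 0`.
-/

/-! ### Uniqueness of Fourier transforms of finite measures -/

/-- The character `e ↦ exp (i t e)` of the real line. -/
def wave (t : ℝ) (e : ℝ) : ℂ := Complex.exp (Complex.I * ((t * e : ℝ) : ℂ))

theorem measurable_wave (t : ℝ) : Measurable (wave t) := by
  unfold wave
  fun_prop

theorem norm_wave (t e : ℝ) : ‖wave t e‖ = 1 := by
  rw [wave, mul_comm, Complex.norm_exp_ofReal_mul_I]

theorem wave_mul (t t' e : ℝ) : wave t e * wave t' e = wave (t + t') e := by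
  simp only [wave, ← Complex.exp_add, ← mul_add, ← Complex.ofReal_add, ← add_mul]

theorem conj_wave (t e : ℝ) : conj (wave t e) = wave (-t) e := by
  simp only [wave, ← Complex.exp_conj, map_mul, Complex.conj_I, Complex.conj_ofReal, neg_mul,
    Complex.ofReal_neg, mul_neg]

theorem charFun_eq_integral_wave (μ : Measure ℝ) (t : ℝ) :
    charFun μ t = ∫ e, wave t e ∂μ := by
  rw [charFun_apply_real]
  refine integral_congr_ae (.of_forall fun e => ?_)
  simp only [wave, Complex.ofReal_mul, mul_comm Complex.I]

theorem integrable_wave_mul {ν : Measure ℝ} {F : ℝ → ℂ} (hF : Integrable F ν) (t : ℝ) :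
    Integrable (fun e => wave t e * F e) ν :=
  hF.bdd_mul (c := 1) (measurable_wave t).aestronglyMeasurable
    (.of_forall fun e => (norm_wave t e).le)

theorem charFun_withDensity_ofReal {ν : Measure ℝ} {G : ℝ → ℝ} (hG : AEMeasurable G ν) (t : ℝ) :
    charFun (ν.withDensity fun e => ENNReal.ofReal (G e)) t
      = ∫ e, wave t e * ((max (G e) 0 : ℝ) : ℂ) ∂ν := by
  rw [charFun_eq_integral_wave, integral_withDensity_eq_integral_toReal_smul₀ hG.ennreal_ofReal
    (.of_forall fun _ => ENNReal.ofReal_lt_top)]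
  simp only [ENNReal.toReal_ofReal', Complex.real_smul, mul_comm]

theorem ae_eq_zero_of_integral_wave_mul_ofReal_eq_zero {ν : Measure ℝ} {G : ℝ → ℝ}
    (hG : Integrable G ν) (h : ∀ t, ∫ e, wave t e * (G e : ℂ) ∂ν = 0) : G =ᵐ[ν] 0 := by
  have := isFiniteMeasure_withDensity_ofReal hG.2
  have := isFiniteMeasure_withDensity_ofReal hG.neg.2
  have hint {F : ℝ → ℝ} (hF : Integrable F ν) :
      Integrable (fun e => ((max (F e) 0 : ℝ) : ℂ)) ν := hF.pos_part.ofReal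
  have posPart_eq_negPart : (ν.withDensity fun e => ENNReal.ofReal (G e))
      = ν.withDensity fun e => ENNReal.ofReal ((-G) e) := by
    refine Measure.ext_of_charFun (funext fun t => ?_)
    rw [charFun_withDensity_ofReal hG.aemeasurable, charFun_withDensity_ofReal hG.neg.aemeasurable,
      ← sub_eq_zero, ← integral_sub (integrable_wave_mul (hint hG) t)
        (integrable_wave_mul (hint hG.neg) t), ← h t]
    refine integral_congr_ae (.of_forall fun e => ?_)
    simp only [Pi.neg_apply]
    rw [← mul_sub, ← Complex.ofReal_sub, max_zero_sub_max_neg_zero_eq_self]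
  filter_upwards [(withDensity_eq_iff hG.aemeasurable.ennreal_ofReal
    hG.neg.aemeasurable.ennreal_ofReal hG.lintegral_lt_top.ne).mp posPart_eq_negPart] with e he
  have hmax : max (G e) 0 = max (-G e) 0 := by
    simpa only [ENNReal.toReal_ofReal', Pi.neg_apply] using congrArg ENNReal.toReal he
  simpa only [hmax, sub_self, eq_comm, Pi.zero_apply] using max_zero_sub_max_neg_zero_eq_self (G e)

theorem integral_wave_mul_conj {ν : Measure ℝ} (F : ℝ → ℂ) (t : ℝ) :
    ∫ e, wave t e * conj (F e) ∂ν = conj (∫ e, wave (-t) e * F e ∂ν) := by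
  rw [← integral_conj]
  simp only [map_mul, conj_wave, neg_neg]

theorem ae_eq_zero_of_integral_wave_mul_eq_zero {ν : Measure ℝ} {F : ℝ → ℂ}
    (hF : Integrable F ν) (h : ∀ t, ∫ e, wave t e * F e ∂ν = 0) : F =ᵐ[ν] 0 := by
  have hconj : Integrable (fun e => conj (F e)) ν :=
    Complex.conjLIE.toContinuousLinearEquiv.toContinuousLinearMap.integrable_comp hF
  have h' (t : ℝ) : ∫ e, wave t e * conj (F e) ∂ν = 0 := by
    rw [integral_wave_mul_conj, h, map_zero]
  have hre : (fun e => (F e).re) =ᵐ[ν] 0 := by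
    refine ae_eq_zero_of_integral_wave_mul_ofReal_eq_zero hF.re fun t => ?_
    simp only [Complex.re_eq_add_conj, mul_div_assoc', mul_add]
    rw [integral_div, integral_add (integrable_wave_mul hF t) (integrable_wave_mul hconj t), h, h',
      add_zero, zero_div]
  have him : (fun e => (F e).im) =ᵐ[ν] 0 := by
    refine ae_eq_zero_of_integral_wave_mul_ofReal_eq_zero hF.im fun t => ?_
    simp only [Complex.im_eq_sub_conj, mul_div_assoc', mul_sub]
    rw [integral_div, integral_sub (integrable_wave_mul hF t) (integrable_wave_mul hconj t), h, h',
      sub_zero, zero_div]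
  filter_upwards [hre, him] with e h1 h2 using Complex.ext h1 h2

section SumOfMeasures

variable {ι : Type*} (S : Finset ι) (μ : ι → Measure ℝ) (F : ι → ℝ → ℂ)

/-- The density of the complex measure `∑ i ∈ S, F i • μ i` with respect to `∑ i ∈ S, μ i`. -/
def sumDensity (e : ℝ) : ℂ := ∑ i ∈ S, ((μ i).rnDeriv (∑ j ∈ S, μ j) e).toReal • F i e

variable {S μ F}

theorem absolutelyContinuous_finsetSum {i : ι} (hi : i ∈ S) : μ i ≪ ∑ j ∈ S, μ j :=
  Measure.absolutelyContinuous_of_le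
    (Finset.single_le_sum (f := μ) (fun _ _ => Measure.zero_le _) hi)

variable [∀ i, IsFiniteMeasure (μ i)]

theorem integrable_sumDensity (hF : ∀ i ∈ S, Integrable (F i) (μ i)) :
    Integrable (sumDensity S μ F) (∑ i ∈ S, μ i) :=
  integrable_finsetSum S fun i hi =>
    (integrable_rnDeriv_smul_iff (absolutelyContinuous_finsetSum hi)).mpr (hF i hi)

theorem integral_mul_sumDensity {b : ℝ → ℂ}
    (hb : ∀ i ∈ S, Integrable (fun e => b e * F i e) (μ i)) :
    ∫ e, b e * sumDensity S μ F e ∂(∑ i ∈ S, μ i) = ∑ i ∈ S, ∫ e, b e * F i e ∂μ i := by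
  simp only [sumDensity, Finset.mul_sum, mul_smul_comm]
  rw [integral_finsetSum _ fun i hi =>
    (integrable_rnDeriv_smul_iff (absolutelyContinuous_finsetSum hi)).mpr (hb i hi)]
  exact Finset.sum_congr rfl fun i hi => integral_rnDeriv_smul (absolutelyContinuous_finsetSum hi)

theorem sum_integral_mul_eq_zero_of_wave (hF : ∀ i ∈ S, Integrable (F i) (μ i))
    (h : ∀ t, ∑ i ∈ S, ∫ e, wave t e * F i e ∂μ i = 0) {b : ℝ → ℂ}
    (hb : ∀ i ∈ S, Integrable (fun e => b e * F i e) (μ i)) :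
    ∑ i ∈ S, ∫ e, b e * F i e ∂μ i = 0 := by
  have hzero := ae_eq_zero_of_integral_wave_mul_eq_zero (integrable_sumDensity hF) fun t => by
    rw [integral_mul_sumDensity fun i hi => integrable_wave_mul (hF i hi) t, h t]
  rw [← integral_mul_sumDensity hb]
  refine integral_eq_zero_of_ae ?_
  filter_upwards [hzero] with e he
  simp only [he, Pi.zero_apply, mul_zero]

end SumOfMeasures

/-! ### Bounded sesquilinear forms -/

section Sesquilinear

variable {E : Type*} [NormedAddCommGroup E] [InnerProductSpace ℂ E]

theorem norm_sesquilinear_le_of_sq (q : E →ₗ⋆[ℂ] E →ₗ[ℂ] ℂ) {C : ℝ}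
    (h : ∀ x y, ‖q x y‖ ≤ C * (‖x‖ ^ 2 + ‖y‖ ^ 2)) (x y : E) :
    ‖q x y‖ ≤ 2 * C * ‖x‖ * ‖y‖ := by
  rcases eq_or_ne x 0 with rfl | hx
  · simp
  rcases eq_or_ne y 0 with rfl | hy
  · simp
  have hx' : 0 < ‖x‖ := norm_pos_iff.mpr hx
  have hy' : 0 < ‖y‖ := norm_pos_iff.mpr hy
  have hunit := h (((‖x‖⁻¹ : ℝ) : ℂ) • x) (((‖y‖⁻¹ : ℝ) : ℂ) • y)
  simp only [map_smulₛₗ, LinearMap.smul_apply, norm_smul, Complex.norm_real, norm_inv, norm_norm,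
    Complex.conj_ofReal, RingHom.id_apply, inv_mul_cancel₀ hx'.ne', inv_mul_cancel₀ hy'.ne']
    at hunit
  calc ‖q x y‖ = ‖x‖ * ‖y‖ * (‖x‖⁻¹ * (‖y‖⁻¹ * ‖q x y‖)) := by field_simp
    _ = ‖x‖ * ‖y‖ * (‖y‖⁻¹ * (‖x‖⁻¹ * ‖q x y‖)) := by ring
    _ ≤ ‖x‖ * ‖y‖ * (C * (1 ^ 2 + 1 ^ 2)) := mul_le_mul_of_nonneg_left hunit (by positivity)
    _ = 2 * C * ‖x‖ * ‖y‖ := by ring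

theorem exists_operator_of_sesquilinear [CompleteSpace E] (q : E →ₗ⋆[ℂ] E →ₗ[ℂ] ℂ) {C : ℝ}
    (h : ∀ x y, ‖q x y‖ ≤ C * ‖x‖ * ‖y‖) : ∃ B : E →L[ℂ] E, ∀ x y, ⟪x, B y⟫_ℂ = q x y := by
  refine ⟨ContinuousLinearMap.adjoint
    (InnerProductSpace.continuousLinearMapOfBilin (q.mkContinuous₂ C h)), fun x y => ?_⟩
  rw [ContinuousLinearMap.adjoint_inner_right, InnerProductSpace.continuousLinearMapOfBilin_apply]
  rfl

end Sesquilinear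

/-! ### Functions of polynomial growth at the boundary of the lower half plane -/

theorem isOpen_im_neg : IsOpen {z : ℂ | z.im < 0} :=
  isOpen_lt Complex.continuous_im continuous_const

/-- Analytic functions on the lower half plane satisfying the estimate which defines `𝒦`. Unlike
elements of `𝒦` they need not vanish on the closed upper half plane, so that the two-point
functions `z ↦ ⟨ξ, exp (-i z H) ξ⟩` are included. -/
structure PolynomialGrowth (h : ℂ → ℂ) : Prop where
  differentiableOn : DifferentiableOn ℂ h {z | z.im < 0}
  bound : ∃ (L : ℕ) (C : ℝ), 0 ≤ C ∧ ∀ z : ℂ, -1 ≤ z.im → z.im < 0 → ‖h z‖ ≤ C / |z.im| ^ L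

namespace PolynomialGrowth

variable {h k : ℂ → ℂ}

theorem zero : PolynomialGrowth 0 :=
  ⟨differentiableOn_const 0, 0, 0, le_rfl, by simp⟩

theorem mul (hh : PolynomialGrowth h) (hk : PolynomialGrowth k) : PolynomialGrowth (h * k) := by
  obtain ⟨L, C, hC0, hC⟩ := hh.bound
  obtain ⟨M, D, hD0, hD⟩ := hk.bound
  refine ⟨hh.differentiableOn.mul hk.differentiableOn, L + M, C * D, by positivity,
    fun z h1 h2 => ?_⟩
  rw [Pi.mul_apply, norm_mul, pow_add, mul_div_mul_comm]
  exact mul_le_mul (hC z h1 h2) (hD z h1 h2) (norm_nonneg _) (by positivity)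

theorem add (hh : PolynomialGrowth h) (hk : PolynomialGrowth k) : PolynomialGrowth (h + k) := by
  obtain ⟨L, C, hC0, hC⟩ := hh.bound
  obtain ⟨M, D, hD0, hD⟩ := hk.bound
  refine ⟨hh.differentiableOn.add hk.differentiableOn, L + M, C + D, by positivity,
    fun z hz1 hz2 => (norm_add_le _ _).trans ?_⟩
  have hpos : 0 < |z.im| := abs_pos.mpr hz2.ne
  have hle : |z.im| ≤ 1 := by rw [abs_of_neg hz2]; linarith
  have hpow {n : ℕ} (hn : n ≤ L + M) := pow_le_pow_of_le_one hpos.le hle hn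
  rw [add_div]
  gcongr
  · exact (hC z hz1 hz2).trans
      (div_le_div_of_nonneg_left hC0 (by positivity) (hpow (Nat.le_add_right L M)))
  · exact (hD z hz1 hz2).trans
      (div_le_div_of_nonneg_left hD0 (by positivity) (hpow (Nat.le_add_left M L)))

theorem sum {ι : Type*} (S : Finset ι) {h : ι → ℂ → ℂ}
    (hh : ∀ i ∈ S, PolynomialGrowth (h i)) : PolynomialGrowth (∑ i ∈ S, h i) :=
  Finset.sum_induction h PolynomialGrowth (fun _ _ => add) zero hh

theorem continuousAt (hh : PolynomialGrowth h) {z : ℂ} (hz : z.im < 0) : ContinuousAt h z :=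
  hh.differentiableOn.continuousOn.continuousAt (isOpen_im_neg.mem_nhds hz)

theorem exists_bound (hh : PolynomialGrowth h) {y : ℝ} (hy : 0 < y) :
    ∃ B : ℝ, ∀ z : ℂ, -1 ≤ z.im → z.im ≤ -y → ‖h z‖ ≤ B := by
  obtain ⟨L, C, hC0, hC⟩ := hh.bound
  refine ⟨C / y ^ L, fun z h1 h2 => (hC z h1 (by linarith)).trans ?_⟩
  gcongr
  rw [abs_of_nonpos (by linarith)]
  linarith

end PolynomialGrowth

theorem RegularAtBoundary.polynomialGrowth {F : ℂ → ℂ} (hF : RegularAtBoundary F) :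
    PolynomialGrowth F := by
  obtain ⟨hd, -, ℓ, -, C, hC⟩ := hF
  obtain ⟨L, hL⟩ := exists_nat_ge ℓ
  refine ⟨hd, L, max C 0, le_max_right _ _, fun z h1 h2 => ?_⟩
  have hpos : 0 < |z.im| := abs_pos.mpr h2.ne
  have hle : |z.im| ≤ 1 := by rw [abs_of_neg h2]; linarith
  rw [le_div_iff₀ (by positivity)]
  refine le_trans ?_ ((hC z h1 h2).trans (le_max_left _ _))
  gcongr
  rw [← Real.rpow_natCast]
  exact Real.rpow_le_rpow_of_exponent_ge hpos hle hL

/-! ### Gaussian test functions -/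

/-- The entire function `z ↦ exp (-b (z - a)²)`, whose restriction to the real line is a Gaussian
with complex centre `a`. -/
def gaussian (b : ℝ) (a z : ℂ) : ℂ := Complex.exp (-(b : ℂ) * (z - a) ^ 2)

theorem norm_gaussian (b : ℝ) (a z : ℂ) :
    ‖gaussian b a z‖ = Real.exp (b * (z - a).im ^ 2) * Real.exp (-b * (z - a).re ^ 2) := by
  rw [gaussian, Complex.norm_exp, ← Real.exp_add, sq, ← Complex.ofReal_neg, Complex.re_ofReal_mul,
    Complex.mul_re]
  ring_nf

theorem gaussian_sub_sub (b : ℝ) (a z w : ℂ) : gaussian b (a - w) (z - w) = gaussian b a z := by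
  simp only [gaussian, sub_sub_sub_cancel_right]

theorem differentiable_gaussian (b : ℝ) (a : ℂ) : Differentiable ℂ (gaussian b a) := by
  unfold gaussian
  fun_prop

theorem hasDerivAt_gaussian (b : ℝ) (a z : ℂ) :
    HasDerivAt (gaussian b a) (-2 * b * (z - a) * gaussian b a z) z := by
  have h : HasDerivAt (gaussian b a) _ z :=
    ((((hasDerivAt_id z).sub_const a).pow 2).const_mul (-(b : ℂ))).cexp
  refine h.congr_deriv ?_
  simp only [gaussian, id_eq, Pi.pow_apply, Nat.cast_ofNat]
  ring

theorem contDiff_gaussian_ofReal (b : ℝ) (a : ℂ) {n : WithTop ℕ∞} :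
    ContDiff ℝ n fun x : ℝ => gaussian b a x := by
  have : ContDiff ℝ n fun x : ℝ => (x : ℂ) := Complex.ofRealCLM.contDiff
  unfold gaussian
  fun_prop

theorem exists_iteratedDeriv_gaussian_eq (b : ℝ) (a : ℂ) (n : ℕ) : ∃ p : Polynomial ℂ,
    iteratedDeriv n (fun x : ℝ => gaussian b a x)
      = fun x : ℝ => p.eval (x : ℂ) * gaussian b a x := by
  induction n with
  | zero => exact ⟨1, by simp only [iteratedDeriv_zero, Polynomial.eval_one, one_mul]⟩
  | succ n ih =>
    obtain ⟨p, hp⟩ := ih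
    refine ⟨p.derivative + p * (Polynomial.C (-2 * (b : ℂ)) * (Polynomial.X - Polynomial.C a)), ?_⟩
    rw [iteratedDeriv_succ, hp]
    funext x
    rw [((p.hasDerivAt (x : ℂ)).fun_mul (hasDerivAt_gaussian b a x)).comp_ofReal.deriv]
    simp only [Polynomial.eval_add, Polynomial.eval_mul, Polynomial.eval_sub, Polynomial.eval_C,
      Polynomial.eval_X]
    ring

theorem exists_pow_mul_norm_gaussian_le {b : ℝ} (hb : 0 < b) (a : ℂ) (k : ℕ) :
    ∃ C : ℝ, ∀ x : ℝ, |x| ^ k * ‖gaussian b a x‖ ≤ C := by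
  refine ⟨Real.exp (b * a.im ^ 2) * (k.factorial * Real.exp (|a.re| + 1 / (4 * b))), fun x => ?_⟩
  have hpow : |x| ^ k ≤ Real.exp |x| * k.factorial :=
    (div_le_iff₀ (by positivity)).mp (Real.pow_div_factorial_le_exp |x| (abs_nonneg x) k)
  have hexponent : |x| + -b * (x - a.re) ^ 2 ≤ |a.re| + 1 / (4 * b) := by
    have habs : |x| ≤ |x - a.re| + |a.re| := by simpa using abs_add_le (x - a.re) a.re
    have hsq : |x - a.re| - b * |x - a.re| ^ 2 ≤ 1 / (4 * b) := by
      rw [le_div_iff₀ (by positivity)]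
      nlinarith [sq_nonneg (2 * b * |x - a.re| - 1)]
    rw [sq_abs] at hsq
    linarith
  rw [norm_gaussian, Complex.sub_im, Complex.sub_re, Complex.ofReal_im, Complex.ofReal_re, zero_sub,
    neg_sq]
  calc |x| ^ k * (Real.exp (b * a.im ^ 2) * Real.exp (-b * (x - a.re) ^ 2))
      = Real.exp (b * a.im ^ 2) * (|x| ^ k * Real.exp (-b * (x - a.re) ^ 2)) := by ring
    _ ≤ Real.exp (b * a.im ^ 2) *
        ((Real.exp |x| * k.factorial) * Real.exp (-b * (x - a.re) ^ 2)) := by gcongr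
    _ = Real.exp (b * a.im ^ 2) * (k.factorial * Real.exp (|x| + -b * (x - a.re) ^ 2)) := by
        rw [Real.exp_add]; ring
    _ ≤ _ := by gcongr

/-- The restriction of `gaussian b a` to the real line as a Schwartz function. -/
def gaussianSchwartz (b : ℝ) (hb : 0 < b) (a : ℂ) : 𝓢(ℝ, ℂ) where
  toFun x := gaussian b a x
  smooth' := contDiff_gaussian_ofReal b a
  decay' := by
    intro k n
    obtain ⟨p, hp⟩ := exists_iteratedDeriv_gaussian_eq b a n
    choose C hC using fun k => exists_pow_mul_norm_gaussian_le hb a k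
    refine ⟨∑ i ∈ Finset.range (p.natDegree + 1), ‖p.coeff i‖ * C (k + i), fun x => ?_⟩
    rw [norm_iteratedFDeriv_eq_norm_iteratedDeriv, hp, norm_mul, Polynomial.eval_eq_sum_range,
      Real.norm_eq_abs]
    calc |x| ^ k * (‖∑ i ∈ Finset.range (p.natDegree + 1), p.coeff i * (x : ℂ) ^ i‖ *
          ‖gaussian b a x‖)
        ≤ |x| ^ k * ((∑ i ∈ Finset.range (p.natDegree + 1), ‖p.coeff i‖ * |x| ^ i) *
          ‖gaussian b a x‖) := by
          gcongr
          refine (norm_sum_le _ _).trans_eq (Finset.sum_congr rfl fun i _ => ?_)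
          rw [norm_mul, norm_pow, Complex.norm_real, Real.norm_eq_abs]
      _ = ∑ i ∈ Finset.range (p.natDegree + 1),
          ‖p.coeff i‖ * (|x| ^ (k + i) * ‖gaussian b a x‖) := by
          rw [Finset.sum_mul, Finset.mul_sum]
          refine Finset.sum_congr rfl fun i _ => ?_
          rw [pow_add]
          ring
      _ ≤ _ := by
          gcongr with i _
          exact hC _ x

theorem gaussianSchwartz_apply (b : ℝ) (hb : 0 < b) (a : ℂ) (x : ℝ) :
    gaussianSchwartz b hb a x = gaussian b a x := rfl

theorem integrable_gaussian_ofReal {b : ℝ} (hb : 0 < b) (a : ℂ) :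
    Integrable fun x : ℝ => gaussian b a x :=
  (gaussianSchwartz b hb a).integrable

theorem integral_gaussian_ofReal {b : ℝ} (hb : 0 < b) (a : ℂ) :
    ∫ x : ℝ, gaussian b a x = ((Real.sqrt (Real.pi / b) : ℝ) : ℂ) := by
  have hexpand (x : ℝ) : gaussian b a x
      = Complex.exp (-(b : ℂ) * (x : ℂ) ^ 2 + 2 * b * a * x + -b * a ^ 2) := by
    rw [gaussian]
    ring_nf
  have hexponent : -(b : ℂ) * a ^ 2 - (2 * b * a) ^ 2 / (4 * -(b : ℂ)) = 0 := by
    field_simp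
    ring
  simp only [hexpand]
  rw [integral_cexp_quadratic (by simpa using hb), hexponent, Complex.exp_zero, mul_one, neg_neg,
    ← Complex.ofReal_div, Real.sqrt_eq_rpow, Complex.ofReal_cpow (by positivity)]
  push_cast
  rfl

theorem conj_gaussian_mul_gaussian (b : ℝ) (a a' : ℂ) (x t : ℝ) :
    conj (gaussian b a (t + x / 2)) * gaussian b a' (t - x / 2)
      = gaussian (b / 2) (conj a - a') x * gaussian (2 * b) ((conj a + a') / 2) t := by
  simp only [gaussian, ← Complex.exp_conj, ← Complex.exp_add, map_mul, map_neg, map_pow, map_sub,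
    map_add, map_div₀, Complex.conj_ofReal, map_ofNat]
  push_cast
  ring_nf

theorem integrable_conj_gaussian_mul_gaussian {b : ℝ} (hb : 0 < b) (a a' : ℂ) (x : ℝ) :
    Integrable fun t : ℝ => conj (gaussian b a (t + x / 2)) * gaussian b a' (t - x / 2) := by
  simp only [conj_gaussian_mul_gaussian]
  exact (integrable_gaussian_ofReal (by positivity) _).const_mul _

theorem integral_conj_gaussian_mul_gaussian {b : ℝ} (hb : 0 < b) (a a' : ℂ) (x : ℝ) :
    ∫ t : ℝ, conj (gaussian b a (t + x / 2)) * gaussian b a' (t - x / 2)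
      = ((Real.sqrt (Real.pi / (2 * b)) : ℝ) : ℂ) * gaussian (b / 2) (conj a - a') x := by
  simp only [conj_gaussian_mul_gaussian]
  rw [integral_const_mul, integral_gaussian_ofReal (by positivity), mul_comm]

/-! ### Contour shifts in the lower half plane -/

theorem tendsto_exp_neg_mul_sq_sub_cocompact {b : ℝ} (hb : 0 < b) (r : ℝ) :
    Filter.Tendsto (fun x : ℝ => Real.exp (-b * (x - r) ^ 2)) (Filter.cocompact ℝ) (𝓝 0) := by
  have h := tendsto_rpow_abs_mul_exp_neg_mul_sq_cocompact hb 0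
  simp only [Real.rpow_zero, one_mul] at h
  exact h.comp (Homeomorph.subRight r).isClosedEmbedding.tendsto_cocompact

section ContourShift

variable {F : ℂ → ℂ} {y η M b r : ℝ}

theorem continuous_horizontal (hF : ContinuousOn F {z | z.im < 0}) (hy : 0 < y) :
    Continuous fun x : ℝ => F (x - y * Complex.I) :=
  hF.comp_continuous (by fun_prop) fun x => by simpa using hy

theorem integrable_horizontal (hF : ContinuousOn F {z | z.im < 0}) (hy : 0 < y) (hb : 0 < b)
    (hbound : ∀ x : ℝ, ‖F (x - y * Complex.I)‖ ≤ M * Real.exp (-b * (x - r) ^ 2)) :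
    Integrable fun x : ℝ => F (x - y * Complex.I) :=
  (((integrable_exp_neg_mul_sq hb).comp_sub_right r).const_mul M).mono'
    (continuous_horizontal hF hy).aestronglyMeasurable (.of_forall hbound)

theorem tendsto_integral_vertical {l : Filter ℝ} {u : ℝ → ℝ}
    (hu : Filter.Tendsto u l (Filter.cocompact ℝ)) (hb : 0 < b) (hη : y ≤ η)
    (hbound : ∀ x t : ℝ, t ∈ Set.Icc y η →
      ‖F (x - t * Complex.I)‖ ≤ M * Real.exp (-b * (x - r) ^ 2)) :
    Filter.Tendsto (fun T => ∫ t in (-η)..(-y), F (u T + t * Complex.I)) l (𝓝 0) := by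
  have hle (T : ℝ) : ‖∫ t in (-η)..(-y), F (u T + t * Complex.I)‖
      ≤ M * Real.exp (-b * (u T - r) ^ 2) * |-y - -η| := by
    refine intervalIntegral.norm_integral_le_of_norm_le_const fun t ht => ?_
    rw [Set.uIoc_of_le (by linarith)] at ht
    simpa using hbound (u T) (-t) ⟨by linarith [ht.2], by linarith [ht.1]⟩
  refine squeeze_zero_norm hle ?_
  simpa using (((tendsto_exp_neg_mul_sq_sub_cocompact hb r).comp hu).const_mul M).mul_const
    |-y - -η|

theorem integral_horizontal_eq (hF : DifferentiableOn ℂ F {z | z.im < 0}) (hy : 0 < y)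
    (hη : y ≤ η) (hb : 0 < b) (hbound : ∀ x t : ℝ, t ∈ Set.Icc y η →
      ‖F (x - t * Complex.I)‖ ≤ M * Real.exp (-b * (x - r) ^ 2)) :
    ∫ x : ℝ, F (x - y * Complex.I) = ∫ x : ℝ, F (x - η * Complex.I) := by
  have rectangle (T : ℝ) : (∫ x in (-T)..T, F (x - η * Complex.I))
      - (∫ x in (-T)..T, F (x - y * Complex.I))
      + Complex.I • (∫ t in (-η)..(-y), F (T + t * Complex.I))
      - Complex.I • (∫ t in (-η)..(-y), F ((-T : ℝ) + t * Complex.I)) = 0 := by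
    have h := Complex.integral_boundary_rect_eq_zero_of_differentiableOn F
      (⟨-T, -η⟩ : ℂ) (⟨T, -y⟩ : ℂ) (hF.mono fun w hw => by
        have hw2 : w.im ∈ Set.uIcc (-η) (-y) := hw.2
        rw [Set.uIcc_of_le (by linarith)] at hw2
        exact hw2.2.trans_lt (by linarith))
    simpa only [Complex.ofReal_neg, neg_mul, ← sub_eq_add_neg] using h
  have horizontal {t : ℝ} (ht : t ∈ Set.Icc y η) : Filter.Tendsto
      (fun T : ℝ => ∫ x in (-T)..T, F (x - t * Complex.I)) Filter.atTop
      (𝓝 (∫ x : ℝ, F (x - t * Complex.I))) :=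
    intervalIntegral_tendsto_integral
      (integrable_horizontal hF.continuousOn (hy.trans_le ht.1) hb fun x => hbound x t ht)
      Filter.tendsto_neg_atTop_atBot Filter.tendsto_id
  have right := tendsto_integral_vertical
    (Filter.tendsto_id.mono_right atTop_le_cocompact) hb hη hbound
  have left := tendsto_integral_vertical
    (Filter.tendsto_neg_atTop_atBot.mono_right atBot_le_cocompact) hb hη hbound
  have total := (((horizontal ⟨hη, le_rfl⟩).sub (horizontal ⟨le_rfl, hη⟩)).add
    (right.const_smul Complex.I)).sub (left.const_smul Complex.I)
  simp only [id_eq, rectangle, smul_zero, add_zero, sub_zero] at total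
  exact (sub_eq_zero.mp (tendsto_nhds_unique total tendsto_const_nhds)).symm

end ContourShift

section GaussianBoundaryValue

variable {F : ℂ → ℂ} {b η : ℝ}

theorem norm_gaussian_le_of_abs_im_le_one (hb : 0 < b) {a z : ℂ} (h : |(z - a).im| ≤ 1) :
    ‖gaussian b a z‖ ≤ Real.exp b * Real.exp (-b * (z.re - a.re) ^ 2) := by
  rw [norm_gaussian, Complex.sub_re]
  gcongr
  exact mul_le_of_le_one_right hb.le ((sq_le_one_iff_abs_le_one _).mpr h)

theorem integral_gaussian_mul_horizontal_eq (hF : PolynomialGrowth F) (hb : 0 < b) (hη : η < 1)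
    (r : ℝ) {y : ℝ} (hy : 0 < y) (hyη : y ≤ η) :
    ∫ x : ℝ, gaussian b (r - η * Complex.I) x * F (x - y * Complex.I)
      = ∫ x : ℝ, gaussian b (r - y * Complex.I) x * F (x - η * Complex.I) := by
  obtain ⟨B, hB⟩ := hF.exists_bound hy
  have h := integral_horizontal_eq
    (F := fun z => gaussian b (r - η * Complex.I - y * Complex.I) z * F z)
    ((differentiable_gaussian b _).differentiableOn.mul hF.differentiableOn) hy hyη hb
    (M := Real.exp b * B) (r := r) fun x t ht => by
      rw [norm_mul, mul_right_comm]
      gcongr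
      · refine (norm_gaussian_le_of_abs_im_le_one hb ?_).trans_eq (by simp)
        simp only [Complex.sub_im, Complex.ofReal_im, Complex.mul_im, Complex.ofReal_re,
          Complex.I_im, Complex.I_re, mul_one, mul_zero, add_zero, zero_sub]
        rw [abs_le]
        constructor <;> linarith [ht.1, ht.2]
      · exact hB _ (by simp; linarith [ht.2]) (by simpa using ht.1)
  have hright (x : ℝ) :
      gaussian b (r - η * Complex.I - y * Complex.I) (x - η * Complex.I)
        = gaussian b (r - y * Complex.I) x := by
    rw [sub_right_comm, gaussian_sub_sub]
  simpa only [gaussian_sub_sub, hright] using h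

theorem tendsto_integral_gaussian_mul_horizontal (hF : PolynomialGrowth F) (hb : 0 < b)
    (hη0 : 0 < η) (hη : η < 1) (r : ℝ) :
    Filter.Tendsto (fun y : ℝ => ∫ x : ℝ, gaussian b (r - y * Complex.I) x * F (x - η * Complex.I))
      (𝓝[>] 0) (𝓝 (∫ x : ℝ, gaussian b r x * F (x - η * Complex.I))) := by
  obtain ⟨B, hB⟩ := hF.exists_bound hη0
  have hFcont := continuous_horizontal hF.differentiableOn.continuousOn hη0
  refine tendsto_integral_filter_of_dominated_convergence
    (fun x => Real.exp b * Real.exp (-b * (x - r) ^ 2) * B) ?_ ?_ ?_ ?_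
  · refine .of_forall fun y => (Continuous.mul ?_ hFcont).aestronglyMeasurable
    exact (contDiff_gaussian_ofReal b _ (n := 0)).continuous
  · filter_upwards [Ioo_mem_nhdsGT (zero_lt_one (α := ℝ))] with y hy
    refine .of_forall fun x => ?_
    rw [norm_mul]
    gcongr
    · refine (norm_gaussian_le_of_abs_im_le_one hb ?_).trans_eq (by simp)
      simpa [abs_of_pos hy.1] using hy.2.le
    · exact hB _ (by simp; linarith) (by simp)
  · exact (((integrable_exp_neg_mul_sq hb).comp_sub_right r).const_mul _).mul_const _
  · refine .of_forall fun x => ?_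
    have hcont : Continuous fun y : ℝ =>
        gaussian b (r - y * Complex.I) x * F (x - η * Complex.I) := by
      unfold gaussian
      fun_prop
    simpa using (hcont.tendsto 0).mono_left (nhdsWithin_le_nhds (s := Set.Ioi 0))

theorem hasBoundaryValue_gaussian (hF : PolynomialGrowth F) (hb : 0 < b) {a : ℂ}
    (ha : -1 < a.im) (ha0 : a.im < 0) :
    HasBoundaryValue F (fun x => gaussian b a x) (∫ x : ℝ, gaussian b 0 x * F (x + a)) := by
  have hcentre : (a.re : ℂ) - (-a.im : ℝ) * Complex.I = a := by
    rw [Complex.ofReal_neg, neg_mul, sub_neg_eq_add, Complex.re_add_im]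
  have hshift : ∫ x : ℝ, gaussian b a.re x * F (x - (-a.im : ℝ) * Complex.I)
      = ∫ x : ℝ, gaussian b 0 x * F (x + a) := by
    rw [← integral_add_right_eq_self _ a.re]
    refine integral_congr_ae (.of_forall fun x => ?_)
    dsimp only
    rw [← gaussian_sub_sub b a.re _ a.re, Complex.ofReal_add, add_sub_cancel_right, sub_self,
      add_sub_assoc, hcentre]
  rw [← hshift]
  refine (tendsto_integral_gaussian_mul_horizontal hF hb (neg_pos.mpr ha0)
    (neg_lt.mpr ha) a.re).congr' ?_
  filter_upwards [Ioo_mem_nhdsGT (neg_pos.mpr ha0)] with y hy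
  rw [← integral_gaussian_mul_horizontal_eq hF hb (neg_lt.mpr ha) a.re hy.1 hy.2.le, hcentre]

end GaussianBoundaryValue

/-! ### Positive type and positive semidefinite kernels -/

/-- The strip `0 < Im a < 1/2`. If `a` and `a'` lie in it then `conj a - a'` lies in the strip
`-1 < Im z < 0`, where elements of `𝒦` are controlled. -/
abbrev Strip : Type := {a : ℂ // 0 < a.im ∧ a.im < 1 / 2}

theorem Strip.im_conj_sub (a a' : Strip) : (conj a.1 - a'.1).im = -(a.1.im + a'.1.im) := by
  rw [Complex.sub_im, Complex.conj_im]
  ring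

theorem Strip.im_conj_sub_neg (a a' : Strip) : (conj a.1 - a'.1).im < 0 := by
  rw [im_conj_sub]
  linarith [a.2.1, a'.2.1]

theorem Strip.neg_one_lt_im_conj_sub (a a' : Strip) : -1 < (conj a.1 - a'.1).im := by
  rw [im_conj_sub]
  linarith [a.2.2, a'.2.2]

/-- The kernel `(a, a') ↦ F (conj a - a')` on the strip. -/
def stripKernel (F : ℂ → ℂ) : Matrix Strip Strip ℂ := Matrix.of fun a a' => F (conj a.1 - a'.1)

open scoped ComplexOrder

theorem nonneg_of_ofReal_mul_nonneg {r : ℝ} {z : ℂ} (hr : 0 < r) (h : 0 ≤ (r : ℂ) * z) :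
    0 ≤ z := by
  rw [Complex.nonneg_iff, Complex.re_ofReal_mul, Complex.im_ofReal_mul] at h
  exact Complex.nonneg_iff.mpr ⟨nonneg_of_mul_nonneg_right h.1 hr,
    ((mul_eq_zero.mp h.2.symm).resolve_left hr.ne').symm⟩

theorem isHermitian_of_sum_nonneg {X : Type*} (k : Matrix X X ℂ)
    (h : ∀ (S : Finset X) (c : X → ℂ), 0 ≤ ∑ a ∈ S, ∑ b ∈ S, conj (c a) * c b * k a b) :
    k.IsHermitian := by
  classical
  refine Matrix.IsHermitian.ext fun a b => ?_
  have hdiag (a : X) : (k a a).im = 0 := by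
    simpa using (Complex.nonneg_iff.mp (h {a} fun _ => 1)).2.symm
  rcases eq_or_ne a b with rfl | hab
  · exact Complex.conj_eq_iff_im.mpr (hdiag a)
  have hone := (Complex.nonneg_iff.mp (h {a, b} fun _ => 1)).2
  have hI := (Complex.nonneg_iff.mp (h {a, b} fun x => if x = a then 1 else Complex.I)).2
  simp only [Finset.sum_pair hab, map_one, one_mul, Complex.add_im, hdiag] at hone
  simp only [Finset.sum_pair hab, if_true, if_neg hab.symm, map_one, one_mul,
    Complex.conj_I, Complex.add_im, hdiag, Complex.mul_im, Complex.mul_re, Complex.neg_re,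
    Complex.neg_im, Complex.I_re, Complex.I_im, Complex.one_re, Complex.one_im] at hI
  refine Complex.ext ?_ ?_
  · rw [RCLike.star_def, Complex.conj_re]
    linarith
  · rw [RCLike.star_def, Complex.conj_im]
    linarith

theorem posSemidef_of_sum_nonneg {X : Type*} (k : Matrix X X ℂ)
    (h : ∀ (S : Finset X) (c : X → ℂ), 0 ≤ ∑ a ∈ S, ∑ b ∈ S, conj (c a) * c b * k a b) :
    k.PosSemidef := by
  refine ⟨isHermitian_of_sum_nonneg k h, fun x => (h x.support x).trans_eq ?_⟩
  simp only [Finsupp.sum, RCLike.star_def, mul_right_comm]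

theorem tendsto_integral_gaussian_mul {f : ℝ → ℂ} (hf : Continuous f) {B : ℝ}
    (hB : ∀ x, ‖f x‖ ≤ B) : Filter.Tendsto
      (fun n : ℕ => ((n + 1 : ℝ) : ℂ) * ∫ x : ℝ, gaussian ((n + 1) ^ 2) 0 x * f x) Filter.atTop
      (𝓝 (((Real.sqrt Real.pi : ℝ) : ℂ) * f 0)) := by
  have substitution (n : ℕ) : ((n + 1 : ℝ) : ℂ) * ∫ x : ℝ, gaussian ((n + 1) ^ 2) 0 x * f x
      = ∫ u : ℝ, gaussian 1 0 u * f (u / (n + 1)) := by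
    have hn : (0 : ℝ) < n + 1 := by positivity
    have h := Measure.integral_comp_div (fun u : ℝ => gaussian ((n + 1) ^ 2) 0 u * f u)
      (n + 1 : ℝ)
    rw [abs_of_pos hn, Complex.real_smul] at h
    rw [← h]
    refine integral_congr_ae (.of_forall fun u => congrArg (· * f (u / (n + 1))) ?_)
    have hn' : ((n : ℂ) + 1) ≠ 0 := by exact_mod_cast hn.ne'
    simp only [gaussian, sub_zero]
    push_cast
    field_simp
  have hmass := integral_gaussian_ofReal (zero_lt_one (α := ℝ)) 0
  rw [div_one] at hmass
  simp only [substitution]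
  rw [← hmass, ← integral_mul_const]
  refine tendsto_integral_of_dominated_convergence (fun u => ‖gaussian 1 0 u‖ * B)
    (fun n => ?_) ((integrable_gaussian_ofReal one_pos 0).norm.mul_const B)
    (fun n => .of_forall fun u => ?_) (.of_forall fun u => ?_)
  · exact ((contDiff_gaussian_ofReal 1 0 (n := 0)).continuous.mul
      (hf.comp (by fun_prop))).aestronglyMeasurable
  · rw [norm_mul]
    gcongr
    exact hB _
  · refine ((hf.tendsto 0).comp ?_).const_mul _
    exact tendsto_const_nhds.div_atTop
      (Filter.tendsto_atTop_add_const_right _ _ tendsto_natCast_atTop_atTop)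

section HasBoundaryValue

variable {F : ℂ → ℂ} {f : ℝ → ℂ} {c : ℂ}

theorem HasBoundaryValue.const_mul (a : ℂ) (h : HasBoundaryValue F f c) :
    HasBoundaryValue F (fun x => a * f x) (a * c) := by
  simpa only [HasBoundaryValue, mul_assoc, integral_const_mul] using Filter.Tendsto.const_mul a h

theorem HasBoundaryValue.finsetSum {ι : Type*} {S : Finset ι} {f : ι → ℝ → ℂ} {c : ι → ℂ}
    (hF : PolynomialGrowth F) (hf : ∀ i ∈ S, Integrable (f i))
    (h : ∀ i ∈ S, HasBoundaryValue F (f i) (c i)) :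
    HasBoundaryValue F (fun x => ∑ i ∈ S, f i x) (∑ i ∈ S, c i) := by
  refine (tendsto_finsetSum S h).congr' ?_
  filter_upwards [Ioo_mem_nhdsGT (zero_lt_one (α := ℝ))] with y hy
  obtain ⟨B, hB⟩ := hF.exists_bound hy.1
  simp only [Finset.sum_mul]
  refine (integral_finsetSum S fun i hi => ?_).symm
  refine (hf i hi).mul_bdd (c := B)
    (continuous_horizontal hF.differentiableOn.continuousOn hy.1).aestronglyMeasurable
    (.of_forall fun x => ?_)
  exact hB _ (by simpa using hy.2.le) (by simp)

end HasBoundaryValue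

theorem integral_conj_sum_gaussian_mul_sum_gaussian {ι : Type*} (S : Finset ι) (c a : ι → ℂ)
    {b : ℝ} (hb : 0 < b) (x : ℝ) :
    ∫ t : ℝ, conj (∑ i ∈ S, c i * gaussian b (a i) (t + x / 2))
        * ∑ j ∈ S, c j * gaussian b (a j) (t - x / 2)
      = ((Real.sqrt (Real.pi / (2 * b)) : ℝ) : ℂ) * ∑ i ∈ S, ∑ j ∈ S,
        conj (c i) * c j * gaussian (b / 2) (conj (a i) - a j) x := by
  simp only [map_sum, map_mul, Finset.sum_mul_sum, mul_mul_mul_comm]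
  have hint (i j : ι) := (integrable_conj_gaussian_mul_gaussian hb (a i) (a j) x).const_mul
    (conj (c i) * c j)
  rw [integral_finsetSum S fun i _ => integrable_finsetSum S fun j _ => hint i j, Finset.mul_sum]
  refine Finset.sum_congr rfl fun i _ => ?_
  rw [integral_finsetSum S fun j _ => hint i j, Finset.mul_sum]
  refine Finset.sum_congr rfl fun j _ => ?_
  rw [integral_const_mul, integral_conj_gaussian_mul_gaussian hb, mul_left_comm]

theorem IsPositiveType.sum_integral_gaussian_nonneg {K : Kernel} (hK : IsPositiveType K)
    (S : Finset Strip) (c : Strip → ℂ) {b : ℝ} (hb : 0 < b) :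
    0 ≤ ∑ a ∈ S, ∑ a' ∈ S, conj (c a) * c a' *
      ∫ x : ℝ, gaussian (b / 2) 0 x * K.1 (x + (conj a.1 - a'.1)) := by
  set κ : ℝ := Real.sqrt (Real.pi / (2 * b))
  have hκ : 0 < κ := Real.sqrt_pos.mpr (by positivity)
  obtain ⟨value, hvalue, hpositive⟩ := hK (∑ a ∈ S, c a • gaussianSchwartz b hb a.1)
  simp only [sum_apply, smul_apply, gaussianSchwartz_apply, smul_eq_mul, Complex.ofReal_add,
    Complex.ofReal_sub, Complex.ofReal_div, Complex.ofReal_ofNat,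
    integral_conj_sum_gaussian_mul_sum_gaussian S c (fun a => a.1) hb] at hpositive
  have hsum := HasBoundaryValue.const_mul (κ : ℂ) <|
    HasBoundaryValue.finsetSum (S := S) K.2.polynomialGrowth
      (fun a _ => integrable_finsetSum S fun a' _ =>
        (integrable_gaussian_ofReal (half_pos hb) (conj a.1 - a'.1)).const_mul
          (conj (c a) * c a'))
      fun a _ => HasBoundaryValue.finsetSum K.2.polynomialGrowth
        (fun a' _ => (integrable_gaussian_ofReal (half_pos hb) _).const_mul _)
        fun a' _ => (hasBoundaryValue_gaussian K.2.polynomialGrowth (half_pos hb)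
          (Strip.neg_one_lt_im_conj_sub a a') (Strip.im_conj_sub_neg a a')).const_mul _
  have heq := tendsto_nhds_unique hsum hpositive
  refine nonneg_of_ofReal_mul_nonneg hκ ?_
  rw [heq]
  exact Complex.zero_le_real.mpr hvalue

/-- Pairing with narrow Gaussians centred in the strip evaluates `K` at their centres. -/
theorem IsPositiveType.posSemidef {K : Kernel} (hK : IsPositiveType K) :
    (stripKernel K.1).PosSemidef := by
  refine posSemidef_of_sum_nonneg _ fun S c => ?_
  have hlim : Filter.Tendsto (fun n : ℕ => ((n + 1 : ℝ) : ℂ) * ∑ a ∈ S, ∑ a' ∈ S,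
      conj (c a) * c a' * ∫ x : ℝ, gaussian ((2 * (n + 1 : ℝ) ^ 2) / 2) 0 x *
        K.1 (x + (conj a.1 - a'.1))) Filter.atTop
      (𝓝 (((Real.sqrt Real.pi : ℝ) : ℂ) * ∑ a ∈ S, ∑ a' ∈ S, conj (c a) * c a' *
        stripKernel K.1 a a')) := by
    simp only [Finset.mul_sum, mul_left_comm _ (conj _ * _),
      mul_div_cancel_left₀ _ (two_ne_zero' ℝ)]
    refine tendsto_finsetSum _ fun a _ => tendsto_finsetSum _ fun a' _ => ?_
    have hneg := Strip.im_conj_sub_neg a a'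
    obtain ⟨B, hB⟩ := K.2.polynomialGrowth.exists_bound (neg_pos.mpr hneg)
    have hcont : Continuous fun x : ℝ => K.1 (x + (conj a.1 - a'.1)) :=
      K.2.1.continuousOn.comp_continuous (by fun_prop) fun x => by
        simpa using hneg
    have h := tendsto_integral_gaussian_mul hcont fun x => hB _
      (by simpa using (Strip.neg_one_lt_im_conj_sub a a').le) (by simp)
    rw [Complex.ofReal_zero, zero_add] at h
    exact h.const_mul _
  refine nonneg_of_ofReal_mul_nonneg (Real.sqrt_pos.mpr Real.pi_pos)
    (ge_of_tendsto' hlim fun n => mul_nonneg ?_ ?_)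
  · exact Complex.zero_le_real.mpr (by positivity)
  · exact hK.sum_integral_gaussian_nonneg S c (by positivity)

/-! ### Boundary values of functions of polynomial growth -/

section LineDerivatives

variable {h : ℂ → ℂ}

theorem hasDerivAt_horizontal (hh : DifferentiableOn ℂ h {z | z.im < 0}) (x : ℝ) {y : ℝ}
    (hy : 0 < y) :
    HasDerivAt (fun x : ℝ => h (x - y * Complex.I)) (deriv h (x - y * Complex.I)) x := by
  have hline : HasDerivAt (fun x : ℝ => (x : ℂ) - y * Complex.I) 1 x :=
    Complex.ofRealCLM.hasDerivAt.sub_const _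
  have houter := hh.hasDerivAt (x := x - y * Complex.I) (isOpen_im_neg.mem_nhds (by simpa using hy))
  exact (houter.scomp x hline).congr_deriv (one_smul _ _)

theorem hasDerivAt_vertical (hh : DifferentiableOn ℂ h {z | z.im < 0}) (x : ℝ) {y : ℝ}
    (hy : 0 < y) :
    HasDerivAt (fun y : ℝ => h (x - y * Complex.I))
      (-Complex.I * deriv h (x - y * Complex.I)) y := by
  have hline : HasDerivAt (fun y : ℝ => (x : ℂ) - y * Complex.I) (-Complex.I) y := by
    simpa using ((Complex.ofRealCLM.hasDerivAt (x := y)).mul_const Complex.I).const_sub (x : ℂ)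
  have houter := hh.hasDerivAt (x := x - y * Complex.I) (isOpen_im_neg.mem_nhds (by simpa using hy))
  exact houter.scomp y hline

theorem continuous_deriv_horizontal (hh : DifferentiableOn ℂ h {z | z.im < 0}) {y : ℝ}
    (hy : 0 < y) :
    Continuous fun x : ℝ => deriv h (x - y * Complex.I) :=
  continuous_horizontal (hh.deriv isOpen_im_neg).continuousOn hy

theorem exists_norm_deriv_le (hh : DifferentiableOn ℂ h {z | z.im < 0}) {S I : Set ℝ}
    (hS : IsCompact S) (hI : IsCompact I) (hpos : ∀ t ∈ I, 0 < t) :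
    ∃ B, ∀ x ∈ S, ∀ t ∈ I, ‖deriv h (x - t * Complex.I)‖ ≤ B := by
  obtain ⟨B, hB⟩ := (hS.prod hI).exists_bound_of_continuousOn
    (f := fun p : ℝ × ℝ => deriv h (p.1 - p.2 * Complex.I))
    ((hh.deriv isOpen_im_neg).continuousOn.comp (by fun_prop) fun p hp => by
      simpa using hpos p.2 hp.2)
  exact ⟨B, fun x hx t ht => hB (x, t) ⟨hx, ht⟩⟩

variable {f : ℝ → ℂ}

theorem integrable_mul_horizontal (hh : DifferentiableOn ℂ h {z | z.im < 0}) (hf : Continuous f)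
    (hfc : HasCompactSupport f) {y : ℝ} (hy : 0 < y) :
    Integrable fun x : ℝ => f x * h (x - y * Complex.I) :=
  (hf.mul (continuous_horizontal hh.continuousOn hy)).integrable_of_hasCompactSupport hfc.mul_right

theorem hasDerivAt_integral_mul_horizontal (hh : DifferentiableOn ℂ h {z | z.im < 0})
    (hf : Continuous f) (hfc : HasCompactSupport f) {y : ℝ} (hy : 0 < y) :
    HasDerivAt (fun t : ℝ => ∫ x : ℝ, f x * h (x - t * Complex.I))
      (∫ x : ℝ, f x * (-Complex.I * deriv h (x - y * Complex.I))) y := by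
  have hpos (t : ℝ) (ht : t ∈ Metric.closedBall y (y / 2)) : 0 < t := by
    rw [Metric.mem_closedBall, Real.dist_eq, abs_le] at ht
    linarith [ht.1]
  obtain ⟨B, hB⟩ := exists_norm_deriv_le hh hfc.isCompact (isCompact_closedBall y (y / 2)) hpos
  refine (hasDerivAt_integral_of_dominated_loc_of_deriv_le (bound := fun x => ‖f x‖ * B)
    (F' := fun t x => f x * (-Complex.I * deriv h (x - t * Complex.I)))
    (Metric.ball_mem_nhds y (half_pos hy)) ?_ (integrable_mul_horizontal hh hf hfc hy) ?_
    (.of_forall fun x t ht => ?_) ?_ (.of_forall fun x t ht => ?_)).2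
  · filter_upwards [lt_mem_nhds hy] with t ht
    exact (integrable_mul_horizontal hh hf hfc ht).aestronglyMeasurable
  · exact (hf.mul
      (continuous_const.mul (continuous_deriv_horizontal hh hy))).aestronglyMeasurable
  · rw [norm_mul, norm_mul, norm_neg, Complex.norm_I, one_mul]
    by_cases hx : x ∈ tsupport f
    · gcongr
      exact hB x hx t (Metric.ball_subset_closedBall ht)
    · simp [image_eq_zero_of_notMem_tsupport hx]
  · exact (hf.norm.mul continuous_const).integrable_of_hasCompactSupport hfc.norm.mul_right
  · exact (hasDerivAt_vertical hh x (hpos t (Metric.ball_subset_closedBall ht))).const_mul _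

/-- By the Cauchy-Riemann equations a derivative towards the boundary is one along the boundary,
which is moved onto the test function. -/
theorem hasDerivAt_integral_mul_horizontal_deriv (hh : DifferentiableOn ℂ h {z | z.im < 0})
    (hf : ContDiff ℝ 1 f) (hfc : HasCompactSupport f) {y : ℝ} (hy : 0 < y) :
    HasDerivAt (fun t : ℝ => ∫ x : ℝ, f x * h (x - t * Complex.I))
      (Complex.I * ∫ x : ℝ, deriv f x * h (x - y * Complex.I)) y := by
  refine (hasDerivAt_integral_mul_horizontal hh hf.continuous hfc hy).congr_deriv ?_
  have hparts := integral_mul_deriv_eq_deriv_mul_of_integrable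
    (fun x _ => (hf.differentiable one_ne_zero x).hasDerivAt)
    (fun x _ => hasDerivAt_horizontal hh x hy)
    ((hf.continuous.mul (continuous_deriv_horizontal hh hy)).integrable_of_hasCompactSupport
      hfc.mul_right)
    (integrable_mul_horizontal hh (hf.continuous_deriv le_rfl) hfc.deriv hy)
    (integrable_mul_horizontal hh hf.continuous hfc hy)
  simp only [mul_left_comm (f _), integral_const_mul, hparts, neg_mul_neg]

end LineDerivatives

section Taylor

variable {E : Type*} [NormedAddCommGroup E] [NormedSpace ℝ E]

theorem hasDerivAt_const_sub_pow_div_factorial (y t : ℝ) (n : ℕ) :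
    HasDerivAt (fun t => (y - t) ^ (n + 1) / ((n + 1).factorial : ℝ))
      (-((y - t) ^ n / n.factorial)) t := by
  refine ((((hasDerivAt_id t).const_sub y).fun_pow (n + 1)).div_const _).congr_deriv ?_
  rw [Nat.factorial_succ, Nat.add_sub_cancel, id_eq]
  push_cast
  field_simp

theorem hasDerivAt_sum_pow_div_factorial_smul {J : ℕ → ℝ → E} {t : ℝ}
    (hJ : ∀ k, HasDerivAt (J k) (J (k + 1) t) t) (y : ℝ) (n : ℕ) :
    HasDerivAt (fun t => ∑ k ∈ Finset.range (n + 1), ((y - t) ^ k / k.factorial) • J k t)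
      (((y - t) ^ n / n.factorial) • J (n + 1) t) t := by
  induction n with
  | zero => simpa using hJ 0
  | succ n ih =>
    simp only [Finset.sum_range_succ _ (n + 1)]
    refine (ih.fun_add
      ((hasDerivAt_const_sub_pow_div_factorial y t n).fun_smul (hJ (n + 1)))).congr_deriv ?_
    module

theorem norm_const_sub_pow_div_factorial_le {y t : ℝ} (hy : 0 ≤ y) (hyt : y ≤ t) (k : ℕ) :
    ‖(y - t) ^ k / (k.factorial : ℝ)‖ ≤ t ^ k := by
  rw [norm_div, norm_pow, Real.norm_natCast]
  have hfac : (1 : ℝ) ≤ k.factorial := by exact_mod_cast k.factorial_pos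
  refine (div_le_self (by positivity) hfac).trans (pow_le_pow_left₀ (norm_nonneg _) ?_ k)
  rw [Real.norm_eq_abs, abs_le]
  constructor <;> linarith

/-- Apply the mean value inequality on `[y, 1]` to the Taylor polynomial at `t`, evaluated at `y`:
its `t`-derivative `(y - t) ^ L / L! • J (L + 1) t` is bounded since `|y - t| ≤ t`. -/
theorem norm_le_of_hasDerivAt_succ {J : ℕ → ℝ → E} {A : ℝ} {L : ℕ}
    (hJ : ∀ k t, 0 < t → HasDerivAt (J k) (J (k + 1) t) t)
    (hA : ∀ k ≤ L + 1, ∀ t, 0 < t → t ≤ 1 → ‖J k t‖ ≤ A / t ^ L) {y : ℝ} (hy : 0 < y)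
    (hy1 : y ≤ 1) : ‖J 0 y‖ ≤ (L + 2) * A := by
  set Φ : ℝ → E := fun t => ∑ k ∈ Finset.range (L + 1), ((y - t) ^ k / k.factorial) • J k t
  have hA0 : 0 ≤ A := by simpa using (norm_nonneg _).trans (hA 0 (Nat.zero_le _) 1 one_pos le_rfl)
  have value_at_y : Φ y = J 0 y := by
    simp [Φ, Finset.sum_range_succ']
  have bound_at_one : ‖Φ 1‖ ≤ (L + 1) * A := by
    calc ‖Φ 1‖ ≤ ∑ _k ∈ Finset.range (L + 1), A := norm_sum_le_of_le _ fun k hk => by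
          have hJk := hA k (Finset.mem_range.mp hk).le 1 one_pos le_rfl
          have hpow := norm_const_sub_pow_div_factorial_le hy.le hy1 k
          rw [one_pow] at hJk hpow
          rw [div_one] at hJk
          rw [norm_smul]
          exact (mul_le_mul hpow hJk (norm_nonneg _) zero_le_one).trans_eq (one_mul A)
      _ = (L + 1) * A := by simp
  have bound_deriv (t : ℝ) (ht : t ∈ Set.Icc y 1) :
      ‖((y - t) ^ L / L.factorial) • J (L + 1) t‖ ≤ A := by
    have ht0 : 0 < t := hy.trans_le ht.1
    rw [norm_smul, mul_comm]
    refine (mul_le_mul (hA (L + 1) le_rfl t ht0 ht.2)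
      (norm_const_sub_pow_div_factorial_le hy.le ht.1 L) (norm_nonneg _)
      (by positivity)).trans_eq (div_mul_cancel₀ _ (by positivity))
  have increment := (convex_Icc y 1).norm_image_sub_le_of_norm_hasDerivWithin_le
    (fun t ht => (hasDerivAt_sum_pow_div_factorial_smul (fun k => hJ k t (hy.trans_le ht.1))
      y L).hasDerivWithinAt) bound_deriv (Set.right_mem_Icc.mpr hy1) (Set.left_mem_Icc.mpr hy1)
  have hdist : ‖y - 1‖ ≤ 1 := by
    rw [Real.norm_eq_abs, abs_le]
    constructor <;> linarith
  calc ‖J 0 y‖ = ‖(Φ y - Φ 1) + Φ 1‖ := by rw [sub_add_cancel, value_at_y]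
    _ ≤ A * 1 + (L + 1) * A := norm_add_le_of_le (increment.trans (by gcongr)) bound_at_one
    _ = (L + 2) * A := by ring

end Taylor

section SobolevBounds

theorem hasCompactSupport_iteratedDeriv {f : ℝ → ℂ} (hf : HasCompactSupport f) (n : ℕ) :
    HasCompactSupport (iteratedDeriv n f) := by
  induction n with
  | zero => rwa [iteratedDeriv_zero]
  | succ n ih =>
    rw [iteratedDeriv_succ]
    exact ih.deriv

theorem contDiff_iteratedDeriv {f : ℝ → ℂ} (hf : ContDiff ℝ (⊤ : ℕ∞) f) (n : ℕ) :
    ContDiff ℝ (⊤ : ℕ∞) (iteratedDeriv n f) := by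
  rw [iteratedDeriv_eq_iterate]
  exact hf.iterate_deriv n

theorem integrable_iteratedDeriv (f : Test) (n : ℕ) : Integrable (iteratedDeriv n f) :=
  (contDiff_iteratedDeriv f.contDiff n).continuous.integrable_of_hasCompactSupport
    (hasCompactSupport_iteratedDeriv f.hasCompactSupport n)

theorem integral_norm_iteratedDeriv_le_sobNorm (f : Test) {n m : ℕ} (hn : n ≤ m) :
    ∫ x, ‖iteratedDeriv n f x‖ ≤ sobNorm 1 m f := by
  have h := Finset.le_sup' (fun n => (1 : ℝ) ^ n * ∫ x, ‖iteratedDeriv n (f : ℝ → ℂ) x‖)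
    (Finset.mem_range.mpr (Nat.lt_succ_of_le hn))
  rwa [one_pow, one_mul] at h

theorem PolynomialGrowth.exists_norm_integral_le_sobNorm {h : ℂ → ℂ} (hh : PolynomialGrowth h) :
    ∃ (m : ℕ) (A : ℝ), 0 ≤ A ∧ ∀ (f : Test) (y : ℝ), 0 < y → y ≤ 1 →
      ‖∫ x : ℝ, f x * h (x - y * Complex.I)‖ ≤ A * sobNorm 1 m f := by
  obtain ⟨L, C, hC0, hC⟩ := hh.bound
  refine ⟨L + 1, (L + 2) * C, by positivity, fun f y hy hy1 => ?_⟩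
  set J : ℕ → ℝ → ℂ := fun k s =>
    Complex.I ^ k * ∫ x : ℝ, iteratedDeriv k f x * h (x - s * Complex.I)
  have hJ (k : ℕ) (s : ℝ) (hs : 0 < s) : HasDerivAt (J k) (J (k + 1) s) s := by
    have hderiv := hasDerivAt_integral_mul_horizontal_deriv hh.differentiableOn
      ((contDiff_iteratedDeriv f.contDiff k).of_le (by exact_mod_cast le_top))
      (hasCompactSupport_iteratedDeriv f.hasCompactSupport k) hs
    refine (hderiv.const_mul (Complex.I ^ k)).congr_deriv ?_
    rw [← iteratedDeriv_succ, ← mul_assoc, ← pow_succ]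
  have hA (k : ℕ) (hk : k ≤ L + 1) (s : ℝ) (hs : 0 < s) (hs1 : s ≤ 1) :
      ‖J k s‖ ≤ C * sobNorm 1 (L + 1) f / s ^ L := by
    rw [norm_mul, norm_pow, Complex.norm_I, one_pow, one_mul]
    calc ‖∫ x : ℝ, iteratedDeriv k f x * h (x - s * Complex.I)‖
        ≤ ∫ x, ‖iteratedDeriv k f x‖ * (C / s ^ L) := by
          refine norm_integral_le_of_norm_le ((integrable_iteratedDeriv f k).norm.mul_const _)
            (.of_forall fun x => ?_)
          rw [norm_mul]
          gcongr
          simpa [abs_of_pos hs] using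
            hC (x - s * Complex.I) (by simpa using hs1) (by simpa using hs)
      _ ≤ sobNorm 1 (L + 1) f * (C / s ^ L) := by
          rw [integral_mul_const]
          gcongr
          exact integral_norm_iteratedDeriv_le_sobNorm f hk
      _ = C * sobNorm 1 (L + 1) f / s ^ L := by ring
  simpa [J, mul_assoc] using norm_le_of_hasDerivAt_succ hJ hA hy hy1

theorem iteratedDeriv_comp_const_add_mul {f : ℝ → ℂ} {n : ℕ} (hf : ContDiff ℝ n f) (t c x : ℝ) :
    iteratedDeriv n (fun x => f (t + c * x)) x = c ^ n • iteratedDeriv n f (t + c * x) := by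
  have h := congrFun (iteratedDeriv_comp_const_smul
    (hf.comp (by fun_prop : ContDiff ℝ n fun x => t + x)) c) x
  simpa only [Function.comp_def, iteratedDeriv_comp_const_add] using h

theorem norm_iteratedDeriv_comp_const_add_mul_le {f : ℝ → ℂ} {n : ℕ} (hf : ContDiff ℝ n f) {c : ℝ}
    (hc : |c| ≤ 1) (t x : ℝ) :
    ‖iteratedDeriv n (fun x => f (t + c * x)) x‖ ≤ ‖iteratedDeriv n f (t + c * x)‖ := by
  rw [iteratedDeriv_comp_const_add_mul hf, norm_smul, norm_pow]
  exact mul_le_of_le_one_left (norm_nonneg _) (pow_le_one₀ (norm_nonneg _) hc)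

theorem norm_iteratedDeriv_diamond_le (g₁ g₂ : Test) (t : ℝ) (n : ℕ) (x : ℝ) :
    ‖iteratedDeriv n (diamond g₁ g₂ t) x‖ ≤ ∑ k ∈ Finset.range (n + 1),
      n.choose k * ‖iteratedDeriv k g₁ (t + x / 2)‖ * ‖iteratedDeriv (n - k) g₂ (t - x / 2)‖ := by
  have hsmooth (g : Test) (k : ℕ) : ContDiff ℝ k g := g.contDiff.of_le (by exact_mod_cast le_top)
  have hdiamond : (diamond g₁ g₂ t : ℝ → ℂ)
      = fun x => g₁ (t + 2⁻¹ * x) * g₂ (t + -2⁻¹ * x) := by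
    funext x
    change g₁ (t + x / 2) * g₂ (t - x / 2) = _
    ring_nf
  have hplus : t + x / 2 = t + 2⁻¹ * x := by ring
  have hminus : t - x / 2 = t + -2⁻¹ * x := by ring
  have hplus_smooth : ContDiff ℝ n fun x => g₁ (t + 2⁻¹ * x) := (hsmooth g₁ n).comp (by fun_prop)
  have hminus_smooth : ContDiff ℝ n fun x => g₂ (t + -2⁻¹ * x) := (hsmooth g₂ n).comp (by fun_prop)
  rw [hdiamond, hplus, hminus,
    iteratedDeriv_fun_mul hplus_smooth.contDiffAt hminus_smooth.contDiffAt]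
  refine norm_sum_le_of_le _ fun k _ => ?_
  rw [norm_mul, norm_mul, RCLike.norm_natCast]
  gcongr
  · exact norm_iteratedDeriv_comp_const_add_mul_le (hsmooth g₁ k) (by norm_num [abs_of_pos]) t x
  · exact norm_iteratedDeriv_comp_const_add_mul_le (hsmooth g₂ (n - k))
      (by norm_num [abs_of_pos]) t x

theorem exists_sobNorm_diamond_le (g₁ g₂ : Test) (m : ℕ) :
    ∃ B : ℝ, ∀ t, sobNorm 1 m (diamond g₁ g₂ t) ≤ B := by
  choose A hA using fun k => (hasCompactSupport_iteratedDeriv g₁.hasCompactSupport k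
    ).exists_bound_of_continuous (contDiff_iteratedDeriv g₁.contDiff k).continuous
  set b : ℕ → ℝ := fun n => ∑ k ∈ Finset.range (n + 1),
    n.choose k * A k * (2 * ∫ x, ‖iteratedDeriv (n - k) g₂ x‖)
  have hint (t : ℝ) (k : ℕ) : Integrable fun x => ‖iteratedDeriv k g₂ (t - x / 2)‖ :=
    (((integrable_iteratedDeriv g₂ k).norm.comp_sub_left t).comp_div two_ne_zero)
  have hsubst (t : ℝ) (k : ℕ) : ∫ x, ‖iteratedDeriv k g₂ (t - x / 2)‖
      = 2 * ∫ x, ‖iteratedDeriv k g₂ x‖ := by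
    rw [Measure.integral_comp_div (fun u => ‖iteratedDeriv k g₂ (t - u)‖),
      integral_sub_left_eq_self fun u => ‖iteratedDeriv k g₂ u‖, smul_eq_mul, abs_two]
  have hb (t : ℝ) (n : ℕ) : ∫ x, ‖iteratedDeriv n (diamond g₁ g₂ t) x‖ ≤ b n := by
    calc ∫ x, ‖iteratedDeriv n (diamond g₁ g₂ t) x‖
        ≤ ∫ x, ∑ k ∈ Finset.range (n + 1),
            n.choose k * A k * ‖iteratedDeriv (n - k) g₂ (t - x / 2)‖ := by
          refine integral_mono (integrable_iteratedDeriv _ n).norm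
            (integrable_finsetSum _ fun k _ => (hint t _).const_mul _) fun x => ?_
          refine (norm_iteratedDeriv_diamond_le g₁ g₂ t n x).trans ?_
          gcongr with k
          exact hA k _
      _ = b n := by
          rw [integral_finsetSum _ fun k _ => (hint t _).const_mul _]
          simp only [integral_const_mul, hsubst, b]
  refine ⟨(Finset.range (m + 1)).sup' Finset.nonempty_range_add_one b, fun t =>
    Finset.sup'_mono_fun fun n _ => ?_⟩
  rw [one_pow, one_mul]
  exact hb t n

end SobolevBounds

section Diamond

variable (g₁ g₂ : Test)

theorem exists_forall_ne_zero_abs_le :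
    ∃ R : ℝ, (∀ x, g₁ x ≠ 0 → |x| ≤ R) ∧ ∀ x, g₂ x ≠ 0 → |x| ≤ R := by
  obtain ⟨R, hR⟩ := (g₁.hasCompactSupport.isCompact.union
    g₂.hasCompactSupport.isCompact).isBounded.exists_norm_le
  exact ⟨R, fun x hx => hR x (.inl (subset_tsupport _ hx)),
    fun x hx => hR x (.inr (subset_tsupport _ hx))⟩

theorem exists_forall_diamond_ne_zero_abs_le :
    ∃ R : ℝ, ∀ t x, diamond g₁ g₂ t x ≠ 0 → |t| ≤ R ∧ |x| ≤ 2 * R := by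
  obtain ⟨R, h₁, h₂⟩ := exists_forall_ne_zero_abs_le g₁ g₂
  refine ⟨R, fun t x hne => ?_⟩
  obtain ⟨hne₁, hne₂⟩ := mul_ne_zero_iff.mp hne
  have hplus := abs_le.mp (h₁ _ hne₁)
  have hminus := abs_le.mp (h₂ _ hne₂)
  constructor <;> rw [abs_le] <;> constructor <;> linarith

theorem continuous_uncurry_diamond : Continuous fun p : ℝ × ℝ => diamond g₁ g₂ p.1 p.2 := by
  have h₁ := g₁.continuous
  have h₂ := g₂.continuous
  change Continuous fun p : ℝ × ℝ => g₁ (p.1 + p.2 / 2) * g₂ (p.1 - p.2 / 2)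
  fun_prop

theorem hasCompactSupport_uncurry_diamond :
    HasCompactSupport fun p : ℝ × ℝ => diamond g₁ g₂ p.1 p.2 := by
  obtain ⟨R, hR⟩ := exists_forall_diamond_ne_zero_abs_le g₁ g₂
  refine HasCompactSupport.intro
    (isCompact_Icc (a := -R) (b := R) |>.prod (isCompact_Icc (a := -(2 * R)) (b := 2 * R)))
    fun p hp => by_contra fun hne => hp ?_
  exact ⟨abs_le.mp (hR _ _ hne).1, abs_le.mp (hR _ _ hne).2⟩

theorem hasCompactSupport_uncurry_add_mul :
    HasCompactSupport fun p : ℝ × ℝ => g₁ (p.2 + p.1) * g₂ p.2 := by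
  obtain ⟨R, h₁, h₂⟩ := exists_forall_ne_zero_abs_le g₁ g₂
  refine HasCompactSupport.intro
    (isCompact_Icc (a := -(2 * R)) (b := 2 * R) |>.prod (isCompact_Icc (a := -R) (b := R)))
    fun p hp => by_contra fun hne => hp ?_
  obtain ⟨hne₁, hne₂⟩ := mul_ne_zero_iff.mp hne
  have hsum := abs_le.mp (h₁ _ hne₁)
  have hsnd := abs_le.mp (h₂ _ hne₂)
  exact ⟨⟨by linarith, by linarith⟩, hsnd⟩

theorem integral_integral_diamond_mul {k : ℝ → ℂ} (hk : Continuous k) :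
    ∫ t, ∫ x, diamond g₁ g₂ t x * k x = ∫ v, ∫ u, g₁ u * g₂ v * k (u - v) := by
  have hg₁ := g₁.continuous
  have hg₂ := g₂.continuous
  calc ∫ t, ∫ x, diamond g₁ g₂ t x * k x
      = ∫ x, ∫ t, diamond g₁ g₂ t x * k x :=
        integral_integral_swap_of_hasCompactSupport
          ((continuous_uncurry_diamond g₁ g₂).mul (hk.comp continuous_snd))
          (hasCompactSupport_uncurry_diamond g₁ g₂).mul_right
    _ = ∫ x, ∫ v, g₁ (v + x) * g₂ v * k x := by
        refine integral_congr_ae (.of_forall fun x => ?_)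
        beta_reduce
        rw [← integral_add_right_eq_self (fun t => diamond g₁ g₂ t x * k x) (x / 2)]
        refine integral_congr_ae (.of_forall fun v => ?_)
        change g₁ (v + x / 2 + x / 2) * g₂ (v + x / 2 - x / 2) * k x = _
        ring_nf
    _ = ∫ v, ∫ x, g₁ (v + x) * g₂ v * k x :=
        integral_integral_swap_of_hasCompactSupport
          (f := fun x v => g₁ (v + x) * g₂ v * k x) (by fun_prop)
          (hasCompactSupport_uncurry_add_mul g₁ g₂).mul_right
    _ = ∫ v, ∫ u, g₁ u * g₂ v * k (u - v) := by
        refine integral_congr_ae (.of_forall fun v => ?_)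
        beta_reduce
        rw [← integral_add_right_eq_self (fun u => g₁ u * g₂ v * k (u - v)) v]
        simp only [add_sub_cancel_right, add_comm v]

variable {g₁ g₂}

theorem PolynomialGrowth.tendsto_integral_diamond {h : ℂ → ℂ} (hh : PolynomialGrowth h)
    {T : ℝ → ℂ} (hT : ∀ t, HasBoundaryValue h (diamond g₁ g₂ t) (T t)) :
    Filter.Tendsto (fun y : ℝ => ∫ t : ℝ, ∫ x : ℝ, diamond g₁ g₂ t x * h (x - y * Complex.I))
      (𝓝[>] 0) (𝓝 (∫ t, T t)) := by
  obtain ⟨m, A, hA0, hA⟩ := hh.exists_norm_integral_le_sobNorm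
  obtain ⟨B, hB⟩ := exists_sobNorm_diamond_le g₁ g₂ m
  obtain ⟨R, hR⟩ := exists_forall_diamond_ne_zero_abs_le g₁ g₂
  have hsmall : Set.Ioo (0 : ℝ) 1 ∈ 𝓝[>] 0 := Ioo_mem_nhdsGT one_pos
  have hdominant : Integrable (Set.indicator (Set.Icc (-R) R) fun _ => A * B) :=
    (integrable_indicator_iff measurableSet_Icc).mpr (integrableOn_const (by simp))
  refine tendsto_integral_filter_of_dominated_convergence _ ?_ ?_ hdominant (.of_forall hT)
  · filter_upwards [hsmall] with y hy
    have hcont : Continuous fun p : ℝ × ℝ => diamond g₁ g₂ p.1 p.2 * h (p.2 - y * Complex.I) :=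
      (continuous_uncurry_diamond g₁ g₂).mul
        ((continuous_horizontal hh.differentiableOn.continuousOn hy.1).comp continuous_snd)
    exact (hcont.stronglyMeasurable.integral_prod_right (ν := volume)).aestronglyMeasurable
  · filter_upwards [hsmall] with y hy
    refine .of_forall fun t => ?_
    by_cases ht : t ∈ Set.Icc (-R) R
    · rw [Set.indicator_of_mem ht]
      exact (hA _ y hy.1 hy.2.le).trans (mul_le_mul_of_nonneg_left (hB t) hA0)
    · have hzero (x : ℝ) : diamond g₁ g₂ t x = 0 :=
        by_contra fun hne => ht (abs_le.mp (hR t x hne).1)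
      simp [Set.indicator_of_notMem ht, hzero]

end Diamond

/-! ### Cauchy-Schwarz at the boundary -/

section Gram

universe u

variable {X : Type u}

theorem exists_eq_gram_of_posSemidef {k : Matrix X X ℂ} (hk : k.PosSemidef) :
    ∃ (V : Type u) (_ : NormedAddCommGroup V) (_ : InnerProductSpace ℂ V) (_ : CompleteSpace V)
      (v : X → V), k = Matrix.gram ℂ v := by
  let K : Matrix X X (ℂ →L[ℂ] ℂ) := Matrix.of fun a b => k a b • (1 : ℂ →L[ℂ] ℂ)
  have hK : K.PosSemidef := by
    suffices K.IsHermitian ∧ ∀ w : X →₀ ℂ,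
        0 ≤ RCLike.re (w.sum fun x a => w.sum fun x' a' => ⟪K x' x a, a'⟫_ℂ) from
      (RKHS.posSemidef_tfae.out 0 2).mpr this
    refine ⟨Matrix.IsHermitian.ext fun a b => ?_, fun w => ?_⟩
    · change star (k b a • (1 : ℂ →L[ℂ] ℂ)) = k a b • 1
      rw [star_smul, star_one, hk.isHermitian.apply]
    · refine (Complex.nonneg_iff.mp (hk.2 w)).1.trans_eq ?_
      rw [← Complex.conj_re]
      change _ = Complex.re _
      congr 1
      rw [Finsupp.sum_comm]
      simp only [Finsupp.sum, map_sum]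
      refine Finset.sum_congr rfl fun a _ => Finset.sum_congr rfl fun b _ => ?_
      change _ = ⟪k b a • w a, w b⟫_ℂ
      simp
      ring
  have : Fact K.PosSemidef := ⟨hK⟩
  refine ⟨RKHS.OfKernel K, inferInstance, inferInstance, inferInstance,
    fun a => RKHS.kerFun (RKHS.OfKernel K) a 1, Matrix.ext fun a b => ?_⟩
  rw [Matrix.gram_apply, ← RKHS.kernel_inner, RKHS.OfKernel.kernel_ofKernel]
  change k a b = ⟪k b a • (1 : ℂ), (1 : ℂ)⟫_ℂ
  rw [← hk.isHermitian.apply a b]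
  simp

variable {E : Type*} [NormedAddCommGroup E] [InnerProductSpace ℂ E]

theorem sum_sum_mul_inner (S : Finset X) (c : X → ℂ) (v : X → E) :
    ∑ a ∈ S, ∑ b ∈ S, conj (c a) * c b * ⟪v a, v b⟫_ℂ
      = ((‖∑ a ∈ S, c a • v a‖ ^ 2 : ℝ) : ℂ) := by
  rw [Complex.ofReal_pow]
  refine Eq.trans ?_ (inner_self_eq_norm_sq_to_K (𝕜 := ℂ) (∑ a ∈ S, c a • v a))
  rw [sum_inner]
  simp only [inner_sum, inner_smul_left, inner_smul_right, mul_assoc, mul_left_comm (c _)]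

theorem posSemidef_gram (v : X → E) : (Matrix.gram ℂ v).PosSemidef :=
  posSemidef_of_sum_nonneg _ fun S c => by
    simp only [Matrix.gram_apply, sum_sum_mul_inner]
    exact Complex.zero_le_real.mpr (sq_nonneg _)

theorem continuous_of_continuous_inner [TopologicalSpace X] {v : X → E}
    (hv : Continuous fun p : X × X => ⟪v p.1, v p.2⟫_ℂ) : Continuous v := by
  refine continuous_iff_continuousAt.mpr fun x => tendsto_iff_norm_sub_tendsto_zero.mpr ?_
  have hexpand (y : X) : ‖v y - v x‖
      = √(⟪v y, v y⟫_ℂ - ⟪v y, v x⟫_ℂ - ⟪v x, v y⟫_ℂ + ⟪v x, v x⟫_ℂ).re := by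
    rw [← Real.sqrt_sq (norm_nonneg (v y - v x)), ← inner_self_eq_norm_sq (𝕜 := ℂ),
      inner_sub_sub_self]
    rfl
  have hinner {f g : X → X} (hf : Continuous f) (hg : Continuous g) :
      Continuous fun y => ⟪v (f y), v (g y)⟫_ℂ := hv.comp (hf.prodMk hg)
  have hcont : Continuous fun y =>
      √(⟪v y, v y⟫_ℂ - ⟪v y, v x⟫_ℂ - ⟪v x, v y⟫_ℂ + ⟪v x, v x⟫_ℂ).re :=
    Real.continuous_sqrt.comp (Complex.continuous_re.comp
      (((hinner continuous_id continuous_id).sub (hinner continuous_id continuous_const)).sub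
        (hinner continuous_const continuous_id) |>.add continuous_const))
  simpa [hexpand] using hcont.tendsto x

theorem norm_integral_mul_inner_sq_le [CompleteSpace E] [MeasurableSpace X] {μ : Measure X}
    {g : X → ℂ} {v : X → E} (hint : Integrable (fun t => g t • v t) μ) (a : E) :
    ‖∫ t, g t * ⟪a, v t⟫_ℂ ∂μ‖ ^ 2
      ≤ ‖⟪a, a⟫_ℂ‖ * ‖∫ t, ∫ u, conj (g u) * g t * ⟪v u, v t⟫_ℂ ∂μ ∂μ‖ := by
  set w : E := ∫ t, g t • v t ∂μ
  have hinner (x : E) : ∫ t, g t * ⟪x, v t⟫_ℂ ∂μ = ⟪x, w⟫_ℂ := by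
    simp only [w, ← integral_inner hint, inner_smul_right]
  have hself : ∫ t, ∫ u, conj (g u) * g t * ⟪v u, v t⟫_ℂ ∂μ ∂μ = ⟪w, w⟫_ℂ := by
    rw [← hinner w]
    refine integral_congr_ae (.of_forall fun t => ?_)
    beta_reduce
    rw [← inner_conj_symm, ← hinner, ← integral_conj, ← integral_const_mul]
    refine integral_congr_ae (.of_forall fun u => ?_)
    beta_reduce
    rw [map_mul, inner_conj_symm]
    ring
  rw [hinner, hself, inner_self_eq_norm_sq_to_K, inner_self_eq_norm_sq_to_K, norm_pow, norm_pow,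
    RCLike.norm_ofReal, RCLike.norm_ofReal, abs_norm, abs_norm, ← mul_pow]
  exact pow_le_pow_left₀ (norm_nonneg _) (norm_inner_le_norm _ _) 2

end Gram

namespace PolynomialGrowth

variable {h : ℂ → ℂ}

theorem tendsto_integral_mul_comp (hh : PolynomialGrowth h) {ι : Type*} {l : Filter ι}
    [l.IsCountablyGenerated] {g : ℝ → ℂ} (hg : Integrable g) {w : ι → ℝ → ℂ} {w₀ : ℝ → ℂ}
    {η : ℝ} (hη : 0 < η)
    (hw : ∀ᶠ i in l, Continuous (w i))
    (him : ∀ᶠ i in l, ∀ t, -1 ≤ (w i t).im ∧ (w i t).im ≤ -η) (him₀ : ∀ t, (w₀ t).im < 0)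
    (hlim : ∀ t, Filter.Tendsto (w · t) l (𝓝 (w₀ t))) :
    Filter.Tendsto (fun i => ∫ t, g t * h (w i t)) l (𝓝 (∫ t, g t * h (w₀ t))) := by
  obtain ⟨B, hB⟩ := hh.exists_bound hη
  refine tendsto_integral_filter_of_dominated_convergence (fun t => ‖g t‖ * B) ?_ ?_
    (hg.norm.mul_const B)
    (.of_forall fun t => ((hh.continuousAt (him₀ t)).tendsto.comp (hlim t)).const_mul _)
  · filter_upwards [hw, him] with i hwi himi
    exact hg.aestronglyMeasurable.mul (hh.differentiableOn.continuousOn.comp_continuous hwi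
      fun t => (himi t).2.trans_lt (neg_lt_zero.mpr hη)).aestronglyMeasurable
  · filter_upwards [him] with i himi
    refine .of_forall fun t => ?_
    rw [norm_mul]
    gcongr
    exact hB _ (himi t).1 (himi t).2

variable {g : Test} {η : ℝ}

theorem norm_integral_mul_sq_le_of_pos (hh : PolynomialGrowth h)
    (hpos : (stripKernel h).PosSemidef) (hg : ∀ t, conj (g t) = g t) (hη : 0 < η)
    (hη' : η < 1 / 2) {y : ℝ} (hy : 0 < y) (hy' : y < 1 / 2) :
    ‖∫ t : ℝ, g t * h (-t - (η + y : ℝ) * Complex.I)‖ ^ 2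
      ≤ ‖h (-(2 * η : ℝ) * Complex.I)‖ *
        ‖∫ t : ℝ, ∫ u : ℝ, g u * g t * h ((u - t : ℝ) - (2 * y : ℝ) * Complex.I)‖ := by
  obtain ⟨V, _, _, _, v, hv⟩ := exists_eq_gram_of_posSemidef hpos
  have hinner (a b : Strip) : ⟪v a, v b⟫_ℂ = h (conj a.1 - b.1) := (congrFun₂ hv a b).symm
  let a : Strip := ⟨η * Complex.I, by simpa using hη, by simpa using hη'⟩
  let q (t : ℝ) : Strip := ⟨t + y * Complex.I, by simpa using hy, by simpa using hy'⟩
  have hqq (u t : ℝ) : ⟪v (q u), v (q t)⟫_ℂ = h ((u - t : ℝ) - (2 * y : ℝ) * Complex.I) := by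
    rw [hinner]
    congr 1
    simp [q]
    ring
  have haq (t : ℝ) : ⟪v a, v (q t)⟫_ℂ = h (-t - (η + y : ℝ) * Complex.I) := by
    rw [hinner]
    congr 1
    simp [q, a]
    ring
  have haa : ⟪v a, v a⟫_ℂ = h (-(2 * η : ℝ) * Complex.I) := by
    rw [hinner]
    congr 1
    simp [a]
    ring
  have hcont : Continuous fun t => v (q t) := by
    refine continuous_of_continuous_inner ?_
    simp only [hqq]
    exact (continuous_horizontal hh.differentiableOn.continuousOn (by positivity : 0 < 2 * y)).comp
      (by fun_prop : Continuous fun p : ℝ × ℝ => p.1 - p.2)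
  have hint : Integrable fun t => g t • v (q t) :=
    (g.continuous.smul hcont).integrable_of_hasCompactSupport g.hasCompactSupport.smul_right
  simpa only [haq, haa, hqq, hg] using norm_integral_mul_inner_sq_le hint (v a)

theorem norm_integral_mul_sq_le (hh : PolynomialGrowth h)
    (hpos : (stripKernel h).PosSemidef) (hg : ∀ t, conj (g t) = g t) (hη : 0 < η)
    (hη' : η < 1 / 2) {T : ℝ → ℂ}
    (hT : ∀ t, HasBoundaryValue h (diamond g g t) (T t)) :
    ‖∫ t : ℝ, g t * h (-t - η * Complex.I)‖ ^ 2 ≤ ‖h (-(2 * η : ℝ) * Complex.I)‖ * ‖∫ t, T t‖ := by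
  have hsmall : Set.Ioo (0 : ℝ) (1 / 2) ∈ 𝓝[>] 0 := Ioo_mem_nhdsGT one_half_pos
  have hleft : Filter.Tendsto (fun y : ℝ => ∫ t : ℝ, g t * h (-t - (η + y : ℝ) * Complex.I))
      (𝓝[>] 0) (𝓝 (∫ t : ℝ, g t * h (-t - η * Complex.I))) := by
    refine hh.tendsto_integral_mul_comp
      (g.continuous.integrable_of_hasCompactSupport g.hasCompactSupport) hη
      (.of_forall fun y => by fun_prop) ?_ (fun t => by simpa using hη) fun t => ?_
    · filter_upwards [hsmall] with y hy t
      obtain ⟨hy0, hy1⟩ := hy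
      simp only [Complex.sub_im, Complex.neg_im, Complex.ofReal_im, Complex.im_ofReal_mul,
        Complex.I_im]
      constructor <;> linarith
    · have hcont : Continuous fun y : ℝ => (-t - (η + y : ℝ) * Complex.I : ℂ) := by fun_prop
      simpa using (hcont.tendsto 0).mono_left nhdsWithin_le_nhds
  have hdouble : Filter.Tendsto (fun y : ℝ => 2 * y) (𝓝[>] 0) (𝓝[>] 0) :=
    tendsto_nhdsWithin_iff.mpr
      ⟨(by simpa using (continuous_const_mul (2 : ℝ)).tendsto 0 : Filter.Tendsto _ (𝓝 (0 : ℝ)) _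
        ).mono_left nhdsWithin_le_nhds,
      eventually_mem_nhdsWithin.mono fun y hy => mul_pos two_pos (Set.mem_Ioi.mp hy)⟩
  refine le_of_tendsto_of_tendsto (hleft.norm.pow 2)
    (((hh.tendsto_integral_diamond hT).comp hdouble).norm.const_mul _) ?_
  filter_upwards [hsmall] with y hy
  rw [Function.comp_apply, integral_integral_diamond_mul g g
    (continuous_horizontal hh.differentiableOn.continuousOn (mul_pos two_pos hy.1))]
  exact hh.norm_integral_mul_sq_le_of_pos hpos hg hη hη' hy.1 hy.2

end PolynomialGrowth

/-! ### Scaling of test functions -/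

/-- The test function `t ↦ d⁻¹ g(t / d)`, which approximates a multiple of the delta function as
`d → 0` while its norm `sobNorm d m` does not depend on `d`. -/
def rescale (g : Test) {d : ℝ} (hd : 0 < d) : Test where
  toFun t := (d⁻¹ : ℂ) * g (d⁻¹ * t)
  contDiff' := contDiff_const.mul (g.contDiff.comp (by fun_prop : ContDiff ℝ _ fun t => d⁻¹ * t))
  hasCompactSupport' := HasCompactSupport.mul_left
    (g.hasCompactSupport.comp_homeomorph (Homeomorph.mulLeft₀ d⁻¹ (by positivity)))
  tsupport_subset' := by simp

section Rescale

variable {g : Test} {d : ℝ} (hd : 0 < d)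

theorem supportedIn_rescale (hg : SupportedIn 1 g) : SupportedIn d (rescale g hd) := by
  intro t ht
  have hscaled : t ∈ tsupport ((g : ℝ → ℂ) ∘ fun t => d⁻¹ * t) :=
    tsupport_mul_subset_right (f := fun _ => (d⁻¹ : ℂ)) ht
  have hmem : -1 < d⁻¹ * t ∧ d⁻¹ * t < 1 :=
    hg (tsupport_comp_subset_preimage (g : ℝ → ℂ) (continuous_const_mul d⁻¹) hscaled)
  rw [← div_eq_inv_mul, lt_div_iff₀ hd, div_lt_iff₀ hd] at hmem
  exact ⟨by linarith [hmem.1], by linarith [hmem.2]⟩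

theorem conj_rescale (hg : ∀ t, conj (g t) = g t) (t : ℝ) :
    conj (rescale g hd t) = rescale g hd t := by
  change conj ((d⁻¹ : ℂ) * g (d⁻¹ * t)) = (d⁻¹ : ℂ) * g (d⁻¹ * t)
  rw [map_mul, hg, ← Complex.ofReal_inv, Complex.conj_ofReal]

theorem integral_rescale_mul (k : ℝ → ℂ) :
    ∫ t, rescale g hd t * k t = ∫ t, g t * k (d * t) := by
  have hsubst := Measure.integral_comp_mul_left (fun t => g t * k (d * t)) d⁻¹
  have hpoint (t : ℝ) : rescale g hd t * k t = (d⁻¹ : ℂ) * (g (d⁻¹ * t) * k (d * (d⁻¹ * t))) := by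
    rw [mul_inv_cancel_left₀ hd.ne', ← mul_assoc]
    rfl
  simp only [hpoint]
  rw [integral_const_mul, hsubst, inv_inv, abs_of_pos hd, Complex.real_smul,
    inv_mul_cancel_left₀ (by exact_mod_cast hd.ne')]

theorem norm_iteratedDeriv_rescale (n : ℕ) (x : ℝ) :
    ‖iteratedDeriv n (rescale g hd) x‖ = d⁻¹ * (d⁻¹ ^ n * ‖iteratedDeriv n g (d⁻¹ * x)‖) := by
  change ‖iteratedDeriv n (fun t => (d⁻¹ : ℂ) * g (d⁻¹ * t)) x‖ = _
  rw [iteratedDeriv_const_mul_field, iteratedDeriv_comp_const_smul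
    (g.contDiff.of_le (by exact_mod_cast le_top)), norm_mul, norm_smul, norm_pow,
    ← Complex.ofReal_inv, Complex.norm_real, Real.norm_of_nonneg (by positivity)]

variable (g) in
theorem sobNorm_rescale (m : ℕ) : sobNorm d m (rescale g hd) = sobNorm 1 m g := by
  unfold sobNorm
  congr 1
  funext n
  simp only [norm_iteratedDeriv_rescale, integral_const_mul]
  rw [Measure.integral_comp_mul_left (fun x => ‖iteratedDeriv n (g : ℝ → ℂ) x‖), inv_inv,
    abs_of_pos hd, smul_eq_mul, one_pow, one_mul, inv_pow]
  field_simp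

end Rescale

theorem exists_test_supportedIn_one_integral_eq_one :
    ∃ g : Test, SupportedIn 1 g ∧ (∀ t, conj (g t) = g t) ∧ ∫ t, g t = 1 := by
  let f : ContDiffBump (0 : ℝ) := ⟨1 / 4, 1 / 2, by norm_num, by norm_num⟩
  have hsupp : tsupport (fun t => ((f.normed volume t : ℝ) : ℂ)) ⊆ Metric.closedBall 0 (1 / 2) := by
    rw [← f.tsupport_normed_eq (μ := volume)]
    exact closure_mono fun t ht hz => ht (by simp only [hz, Complex.ofReal_zero])
  refine ⟨⟨fun t => ((f.normed volume t : ℝ) : ℂ),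
    Complex.ofRealCLM.contDiff.comp f.contDiff_normed,
    (isCompact_closedBall (0 : ℝ) (1 / 2)).of_isClosed_subset (isClosed_tsupport _) hsupp,
    by simp⟩, fun t ht => ?_, fun t => Complex.conj_ofReal _, ?_⟩
  · have hball := hsupp ht
    rw [Metric.mem_closedBall, dist_zero_right, Real.norm_eq_abs, abs_le] at hball
    exact ⟨by linarith [hball.1], by linarith [hball.2]⟩
  · change ∫ t, ((f.normed volume t : ℝ) : ℂ) = 1
    rw [integral_complex_ofReal, f.integral_normed, Complex.ofReal_one]

theorem PolynomialGrowth.tendsto_integral_rescale_mul {h : ℂ → ℂ} (hh : PolynomialGrowth h)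
    (g : Test) {η : ℝ} (hη : 0 < η) (hη' : η ≤ 1) :
    Filter.Tendsto (fun d : ℝ => ∫ t : ℝ, g t * h (-(d * t : ℝ) - η * Complex.I)) (𝓝 0)
      (𝓝 ((∫ t, g t) * h (-η * Complex.I))) := by
  rw [← integral_mul_const]
  refine hh.tendsto_integral_mul_comp
    (g.continuous.integrable_of_hasCompactSupport g.hasCompactSupport) hη
    (.of_forall fun d => by fun_prop)
    (.of_forall fun _ _ => by simpa using hη') (fun _ => by simpa using hη) fun t => ?_
  have hcont : Continuous fun d : ℝ => (-(d * t : ℝ) - η * Complex.I : ℂ) := by fun_prop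
  simpa using hcont.tendsto 0

theorem PolynomialGrowth.eq_zero_of_boundaryValue {h : ℂ → ℂ} (hh : PolynomialGrowth h)
    (hpos : (stripKernel h).PosSemidef) {T : Test → ℂ} (hT : ∀ f : Test, HasBoundaryValue h f (T f))
    {ε : ℝ → ℝ} (hε : Filter.Tendsto ε (𝓝[>] 0) (𝓝 0)) {m : ℕ}
    (hbound : ∀ d, 0 < d → ∀ g : Test, SupportedIn d g →
      ‖∫ t, T (diamond g g t)‖ ≤ ε d * sobNorm d m g * sobNorm d m g)
    {η : ℝ} (hη : 0 < η) (hη' : η < 1 / 2) : h (-η * Complex.I) = 0 := by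
  obtain ⟨g, hsupp, hreal, hone⟩ := exists_test_supportedIn_one_integral_eq_one
  have hleft := (hh.tendsto_integral_rescale_mul g hη (by linarith)).mono_left
    (nhdsWithin_le_nhds (s := Set.Ioi 0))
  rw [hone, one_mul] at hleft
  have hright : Filter.Tendsto (fun d => ‖h (-(2 * η : ℝ) * Complex.I)‖
      * (ε d * sobNorm 1 m g * sobNorm 1 m g)) (𝓝[>] 0) (𝓝 0) := by
    simpa using ((hε.mul_const (sobNorm 1 m g)).mul_const (sobNorm 1 m g)).const_mul
      ‖h (-(2 * η : ℝ) * Complex.I)‖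
  refine norm_eq_zero.mp (pow_eq_zero_iff two_ne_zero |>.mp (le_antisymm
    (le_of_tendsto_of_tendsto (hleft.norm.pow 2) hright ?_) (by positivity)))
  filter_upwards [self_mem_nhdsWithin] with d (hd : 0 < d)
  rw [← integral_rescale_mul hd fun t => h (-t - η * Complex.I)]
  refine (hh.norm_integral_mul_sq_le hpos (conj_rescale hd hreal) hη hη' fun t => hT _).trans ?_
  gcongr
  simpa only [sobNorm_rescale] using hbound d hd _ (supportedIn_rescale hd hsupp)

theorem tendsto_zero_of_isLittleO_rpow {ε : ℝ → ℝ} {α : ℝ} (hα : 0 ≤ α)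
    (hε : ε =o[𝓝[>] 0] fun d => d ^ α) : Filter.Tendsto ε (𝓝[>] 0) (𝓝 0) := by
  have hone : (fun d : ℝ => d ^ α) =O[𝓝[>] 0] fun _ => (1 : ℝ) := by
    refine Asymptotics.IsBigO.of_bound 1 ?_
    filter_upwards [Ioo_mem_nhdsGT (zero_lt_one (α := ℝ))] with d hd
    rw [norm_one, mul_one, Real.norm_of_nonneg (Real.rpow_nonneg hd.1.le _)]
    exact Real.rpow_le_one hd.1.le hd.2.le hα
  exact (Asymptotics.isLittleO_one_iff ℝ).mp (hε.trans_isBigO hone)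

theorem exists_kernel_ne_zero {K : Kernel} (hK : K ≠ 0) {δ : ℝ} (hδ : 0 < δ) :
    ∃ η, 0 < η ∧ η < δ ∧ K.1 (-(η : ℂ) * Complex.I) ≠ 0 := by
  by_contra! hcon
  obtain ⟨hdiff, hupper, -⟩ := K.2
  have haxis : Filter.Tendsto (fun η : ℝ => -(η : ℂ) * Complex.I) (𝓝[≠] (δ / 2))
      (𝓝[≠] (-(δ / 2 : ℝ) * Complex.I)) := by
    have hcont : Continuous fun η : ℝ => -(η : ℂ) * Complex.I := by fun_prop
    refine tendsto_nhdsWithin_iff.mpr ⟨(hcont.tendsto _).mono_left nhdsWithin_le_nhds, ?_⟩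
    filter_upwards [self_mem_nhdsWithin] with η hη heq
    exact hη (by simpa using congrArg Complex.im heq)
  have hzero : ∀ᶠ η : ℝ in 𝓝[≠] (δ / 2), K.1 (-(η : ℂ) * Complex.I) = 0 := by
    filter_upwards [nhdsWithin_le_nhds (Ioo_mem_nhds (half_pos hδ) (half_lt_self hδ))] with η hη
    exact hcon η hη.1 hη.2
  have hlower := (hdiff.analyticOnNhd isOpen_im_neg).eqOn_zero_of_preconnected_of_frequently_eq_zero
    (convex_halfSpace_im_lt 0).isPreconnected (z₀ := -(δ / 2 : ℝ) * Complex.I)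
    (by simpa using hδ) (haxis.frequently hzero.frequently)
  refine hK (Subtype.ext (funext fun z => ?_))
  rcases lt_or_ge z.im 0 with hz | hz
  · exact hlower hz
  · exact hupper z hz

/-! ### Vector functionals -/

section VectorFunctional

variable {E : Type*} [NormedAddCommGroup E] [InnerProductSpace ℂ E]

/-- The functional `A ↦ ⟨x, A y⟩`. -/
def vectorFunctional (x y : E) : StrongDual ℂ (E →L[ℂ] E) :=
  (innerSL ℂ x).comp (ContinuousLinearMap.apply ℂ E y)

theorem vectorFunctional_apply (x y : E) (A : E →L[ℂ] E) :
    vectorFunctional x y A = ⟪x, A y⟫_ℂ := rfl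

theorem isNormalFunctional_vectorFunctional (x y : E) :
    IsNormalFunctional (vectorFunctional x y) := by
  have summable_single (z : E) : Summable fun n => ‖(Pi.single 0 z : ℕ → E) n‖ ^ 2 :=
    summable_of_ne_finset_zero (s := {0}) fun n hn => by
      rw [Pi.single_eq_of_ne (Finset.notMem_singleton.mp hn), norm_zero, zero_pow two_ne_zero]
  refine ⟨Pi.single 0 x, Pi.single 0 y, summable_single x, summable_single y, fun A => ?_⟩
  rw [vectorFunctional_apply]
  have h := hasSum_single (f := fun n => ⟪(Pi.single 0 x : ℕ → E) n,
    A ((Pi.single 0 y : ℕ → E) n)⟫_ℂ) 0 fun n hn => by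
      rw [Pi.single_eq_of_ne hn, inner_zero_left]
  rwa [Pi.single_eq_same, Pi.single_eq_same] at h

end VectorFunctional

/-! ### Functional calculus of the Hamiltonian -/

/-- Measurable functions that are bounded on `[0, ∞)`: the functions `b` for which `b(H)` is a
bounded operator, whatever the net. -/
def BoundedOnSpectrum (b : ℝ → ℂ) : Prop := Measurable b ∧ ∃ C : ℝ, ∀ e, 0 ≤ e → ‖b e‖ ≤ C

theorem BoundedOnSpectrum.mul {b c : ℝ → ℂ} (hb : BoundedOnSpectrum b) (hc : BoundedOnSpectrum c) :
    BoundedOnSpectrum fun e => b e * c e := by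
  obtain ⟨hb_meas, C, hC⟩ := hb
  obtain ⟨hc_meas, C', hC'⟩ := hc
  refine ⟨hb_meas.mul hc_meas, C * C', fun e he => ?_⟩
  rw [norm_mul]
  exact mul_le_mul (hC e he) (hC' e he) (norm_nonneg _) ((norm_nonneg _).trans (hC e he))

theorem BoundedOnSpectrum.sub {b c : ℝ → ℂ} (hb : BoundedOnSpectrum b) (hc : BoundedOnSpectrum c) :
    BoundedOnSpectrum fun e => b e - c e := by
  obtain ⟨hb_meas, C, hC⟩ := hb
  obtain ⟨hc_meas, C', hC'⟩ := hc
  exact ⟨hb_meas.sub hc_meas, C + C', fun e he => norm_sub_le_of_le (hC e he) (hC' e he)⟩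

theorem BoundedOnSpectrum.conj {b : ℝ → ℂ} (hb : BoundedOnSpectrum b) :
    BoundedOnSpectrum fun e => conj (b e) := by
  obtain ⟨hb_meas, C, hC⟩ := hb
  refine ⟨Complex.continuous_conj.measurable.comp hb_meas, C, fun e he => ?_⟩
  rw [RCLike.norm_conj]
  exact hC e he

theorem boundedOnSpectrum_const (c : ℂ) : BoundedOnSpectrum fun _ => c :=
  ⟨measurable_const, ‖c‖, fun _ _ => le_rfl⟩

theorem boundedOnSpectrum_wave (t : ℝ) : BoundedOnSpectrum (wave t) :=
  ⟨measurable_wave t, 1, fun e _ => (norm_wave t e).le⟩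

theorem boundedOnSpectrum_indicator_Icc {b : ℝ → ℂ} (hb : Continuous b) (E : ℝ) :
    BoundedOnSpectrum ((Set.Icc 0 E).indicator b) := by
  obtain ⟨C, hC⟩ := isCompact_Icc.exists_bound_of_continuousOn (s := Set.Icc 0 E) hb.continuousOn
  refine ⟨hb.measurable.indicator measurableSet_Icc, max C 0, fun e _ => ?_⟩
  by_cases he : e ∈ Set.Icc 0 E
  · rw [Set.indicator_of_mem he]
    exact le_max_of_le_left (hC e he)
  · rw [Set.indicator_of_notMem he, norm_zero]
    exact le_max_right _ _

theorem norm_resolvent_le_one {ℓ : ℝ} (hℓ : 0 ≤ ℓ) {e : ℝ} (he : 0 ≤ e) :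
    ‖(((1 + e) ^ (-ℓ) : ℝ) : ℂ)‖ ≤ 1 := by
  rw [Complex.norm_real, Real.norm_of_nonneg (by positivity)]
  exact Real.rpow_le_one_of_one_le_of_nonpos (by linarith) (by linarith)

theorem boundedOnSpectrum_resolvent {ℓ : ℝ} (hℓ : 0 ≤ ℓ) :
    BoundedOnSpectrum fun e => (((1 + e) ^ (-ℓ) : ℝ) : ℂ) :=
  ⟨by fun_prop, 1, fun _ he => norm_resolvent_le_one hℓ he⟩

/-- The function `e ↦ exp (c e)`, so that `exp (c H)` is `expFn c` of the Hamiltonian. -/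
def expFn (c : ℂ) (e : ℝ) : ℂ := Complex.exp (c * e)

theorem norm_expFn (c : ℂ) (e : ℝ) : ‖expFn c e‖ = Real.exp (c.re * e) := by
  rw [expFn, Complex.norm_exp, Complex.re_mul_ofReal]

theorem norm_expFn_le {c : ℂ} (hc : c.re ≤ 0) {e : ℝ} (he : 0 ≤ e) : ‖expFn c e‖ ≤ 1 := by
  rw [norm_expFn]
  exact Real.exp_le_one_iff.mpr (mul_nonpos_of_nonpos_of_nonneg hc he)

theorem boundedOnSpectrum_expFn {c : ℂ} (hc : c.re ≤ 0) : BoundedOnSpectrum (expFn c) :=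
  ⟨by unfold expFn; fun_prop, 1, fun _ he => norm_expFn_le hc he⟩

theorem expFn_mul_expFn (c d : ℂ) : (fun e => expFn c e * expFn d e) = expFn (c + d) := by
  funext e
  rw [expFn, expFn, expFn, ← Complex.exp_add, add_mul]

theorem conj_expFn (c : ℂ) : (fun e => conj (expFn c e)) = expFn (conj c) := by
  funext e
  rw [expFn, expFn, ← Complex.exp_conj, map_mul, Complex.conj_ofReal]

theorem expFn_zero_right (c : ℂ) : expFn c 0 = 1 := by
  rw [expFn, Complex.ofReal_zero, mul_zero, Complex.exp_zero]

theorem differentiableAt_integral_expFn {ν : Measure ℝ} [IsFiniteMeasure ν]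
    (hν : ∀ᵐ e ∂ν, 0 ≤ e) {c : ℂ} (hc : c.re < 0) :
    DifferentiableAt ℂ (fun c => ∫ e, expFn c e ∂ν) c := by
  have hsub : Set.Iio (0 : ℝ) ⊆ interior (ProbabilityTheory.integrableExpSet id ν) := by
    refine interior_maximal (fun t ht => ?_) isOpen_Iio
    refine Integrable.of_bound (Measurable.aestronglyMeasurable (by fun_prop)) 1 ?_
    filter_upwards [hν] with e he
    rw [Real.norm_of_nonneg (Real.exp_pos _).le, Real.exp_le_one_iff]
    exact mul_nonpos_of_nonpos_of_nonneg ht.le he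
  exact (ProbabilityTheory.hasDerivAt_complexMGF (X := id) (hsub hc)).differentiableAt

theorem re_neg_ofReal_nonpos {ε : ℝ} (hε : 0 ≤ ε) : (-(ε : ℂ)).re ≤ 0 := by
  rwa [Complex.neg_re, Complex.ofReal_re, neg_nonpos]

/-- The function `e ↦ (1 + e)^ℓ exp (-ε e)`: of the Hamiltonian, it is `R^{-ℓ} e^{-εH}`. -/
def dampedPower (ε ℓ : ℝ) (e : ℝ) : ℂ := ((((1 + e) ^ ℓ * Real.exp (-(ε * e)) : ℝ)) : ℂ)

theorem norm_dampedPower_le {ε : ℝ} (hε : 0 < ε) {n : ℕ} {ℓ : ℝ} (hn : ℓ ≤ n) {e : ℝ}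
    (he : 0 ≤ e) : ‖dampedPower ε ℓ e‖ ≤ n.factorial * Real.exp ε / ε ^ n := by
  have hpow : (1 + e) ^ ℓ ≤ (1 + e) ^ n := by
    rw [← Real.rpow_natCast]
    exact Real.rpow_le_rpow_of_exponent_le (by linarith) hn
  have hexp : ε ^ n * (1 + e) ^ n ≤ Real.exp (ε * (1 + e)) * n.factorial := by
    have := Real.pow_div_factorial_le_exp (ε * (1 + e)) (by positivity) n
    rwa [div_le_iff₀ (by positivity), mul_pow] at this
  rw [dampedPower, Complex.norm_real, Real.norm_of_nonneg (by positivity),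
    le_div_iff₀ (by positivity)]
  calc (1 + e) ^ ℓ * Real.exp (-(ε * e)) * ε ^ n
      ≤ (1 + e) ^ n * Real.exp (-(ε * e)) * ε ^ n := by gcongr
    _ = (ε ^ n * (1 + e) ^ n) * Real.exp (-(ε * e)) := by ring
    _ ≤ (Real.exp (ε * (1 + e)) * n.factorial) * Real.exp (-(ε * e)) := by gcongr
    _ = n.factorial * Real.exp (ε * (1 + e) + -(ε * e)) := by rw [Real.exp_add]; ring
    _ = n.factorial * Real.exp ε := by ring_nf

theorem boundedOnSpectrum_dampedPower {ε : ℝ} (hε : 0 < ε) (ℓ : ℝ) :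
    BoundedOnSpectrum (dampedPower ε ℓ) := by
  obtain ⟨n, hn⟩ := exists_nat_ge ℓ
  exact ⟨by unfold dampedPower; fun_prop, _, fun e he => norm_dampedPower_le hε hn he⟩

namespace LocalNet

variable {s : ℕ} {H : Type*} [NormedAddCommGroup H] [InnerProductSpace ℂ H] [CompleteSpace H]
variable (N : LocalNet s H)

theorem exists_isEnergyMeasure_ae_nonneg (ψ : H) :
    ∃ μ, N.IsEnergyMeasure ψ μ ∧ ∀ᵐ e ∂μ, 0 ≤ e := by
  obtain ⟨μ, hfin, hcone, hμ⟩ := N.positiveEnergy ψ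
  have hm : Measurable fun p : Spacetime s => p 0 := measurable_pi_apply 0
  refine ⟨μ.map fun p => p 0, ⟨inferInstance, fun t => ?_⟩, ?_⟩
  · rw [timeU, hμ, integral_map hm.aemeasurable (Measurable.aestronglyMeasurable (by fun_prop))]
    refine integral_congr_ae (.of_forall fun p => ?_)
    beta_reduce
    congr 3
    rw [Finset.sum_eq_single 0] <;> simp +contextual [mul_comm]
  · have hcone' : ∀ᵐ p ∂μ, p ∈ forwardCone s := ae_iff.mpr hcone
    rw [ae_map_iff hm.aemeasurable measurableSet_Ici]
    filter_upwards [hcone'] with p hp using hp.1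

/-- The spectral measure of the Hamiltonian in the vector `ψ`, carried by `[0, ∞)`. -/
def energyMeasure (ψ : H) : Measure ℝ := (N.exists_isEnergyMeasure_ae_nonneg ψ).choose

theorem isEnergyMeasure_energyMeasure (ψ : H) : N.IsEnergyMeasure ψ (N.energyMeasure ψ) :=
  (N.exists_isEnergyMeasure_ae_nonneg ψ).choose_spec.1

theorem energyMeasure_ae_nonneg (ψ : H) : ∀ᵐ e ∂N.energyMeasure ψ, 0 ≤ e :=
  (N.exists_isEnergyMeasure_ae_nonneg ψ).choose_spec.2

instance (ψ : H) : IsFiniteMeasure (N.energyMeasure ψ) := (N.isEnergyMeasure_energyMeasure ψ).1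

variable {N} in
theorem IsEnergyMeasure.eq {ψ : H} {μ ν : Measure ℝ} (hμ : N.IsEnergyMeasure ψ μ)
    (hν : N.IsEnergyMeasure ψ ν) : μ = ν := by
  have := hμ.1
  have := hν.1
  refine Measure.ext_of_charFun (funext fun t => ?_)
  rw [charFun_eq_integral_wave, charFun_eq_integral_wave]
  exact (hμ.2 t).symm.trans (hν.2 t)

theorem inner_timeU_eq_integral (ψ : H) (t : ℝ) :
    ⟪ψ, N.timeU t ψ⟫_ℂ = ∫ e, wave t e ∂N.energyMeasure ψ :=
  (N.isEnergyMeasure_energyMeasure ψ).2 t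

theorem timeU_zero : N.timeU 0 = 1 := by
  have h := N.timeU_mul 0 0
  rw [add_zero] at h
  calc N.timeU 0 = star (N.timeU 0) * (N.timeU 0 * N.timeU 0) := by
        rw [← mul_assoc, timeU_star_mul, one_mul]
    _ = 1 := by rw [h, timeU_star_mul]

theorem star_timeU (t : ℝ) : star (N.timeU t) = N.timeU (-t) := by
  calc star (N.timeU t) = star (N.timeU t) * (N.timeU t * N.timeU (-t)) := by
        rw [timeU_mul, add_neg_cancel, timeU_zero, mul_one]
    _ = N.timeU (-t) := by rw [← mul_assoc, timeU_star_mul, one_mul]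

theorem energyMeasure_univ (ψ : H) : (N.energyMeasure ψ).real Set.univ = ‖ψ‖ ^ 2 := by
  have h := N.inner_timeU_eq_integral ψ 0
  simp only [timeU_zero, wave, zero_mul, Complex.ofReal_zero, mul_zero, Complex.exp_zero,
    integral_const, one_apply_eq_self, inner_self_eq_norm_sq_to_K, Complex.real_smul,
    mul_one] at h
  exact Complex.ofReal_injective (h.symm.trans (Complex.ofReal_pow _ _).symm)

theorem norm_integral_energyMeasure_le {b : ℝ → ℂ} {C : ℝ} (hC : ∀ e, 0 ≤ e → ‖b e‖ ≤ C)
    (ψ : H) : ‖∫ e, b e ∂N.energyMeasure ψ‖ ≤ C * ‖ψ‖ ^ 2 := by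
  rw [← N.energyMeasure_univ]
  refine norm_integral_le_of_norm_le_const ?_
  filter_upwards [N.energyMeasure_ae_nonneg ψ] with e he using hC e he

theorem integrable_energyMeasure {b : ℝ → ℂ} (hb : BoundedOnSpectrum b) (ψ : H) :
    Integrable b (N.energyMeasure ψ) := by
  obtain ⟨hb_meas, C, hC⟩ := hb
  refine Integrable.of_bound hb_meas.aestronglyMeasurable C ?_
  filter_upwards [N.energyMeasure_ae_nonneg ψ] with e he using hC e he

/-- The combination `∑ cᵢ ⟨ψᵢ, b(H) ψᵢ⟩ = ∑ cᵢ ∫ b dμ_{ψᵢ}` of diagonal matrix elements of `b(H)`,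
for a formal linear combination `∑ cᵢ ψᵢ` of vectors. -/
def spectralSum (b : ℝ → ℂ) : (H →₀ ℂ) →ₗ[ℂ] ℂ :=
  Finsupp.linearCombination ℂ fun ψ => ∫ e, b e ∂N.energyMeasure ψ

theorem spectralSum_eq_sum {v : H →₀ ℂ} {S : Finset H} (hv : v.support ⊆ S) (b : ℝ → ℂ) :
    N.spectralSum b v = ∑ ψ ∈ S, v ψ * ∫ e, b e ∂N.energyMeasure ψ := by
  rw [spectralSum, Finsupp.linearCombination_apply, Finsupp.sum_of_support_subset v hv]
  · simp only [smul_eq_mul]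
  · simp only [zero_smul, implies_true]

theorem spectralSum_sub_spectralSum_mul {c : ℝ → ℂ} (hc : BoundedOnSpectrum c) {v w : H →₀ ℂ}
    {S : Finset H} (hv : v.support ⊆ S) (hw : w.support ⊆ S) {b : ℝ → ℂ}
    (hb : BoundedOnSpectrum b) :
    N.spectralSum b w - N.spectralSum (fun e => b e * c e) v
      = ∑ ψ ∈ S, ∫ e, b e * (w ψ - v ψ * c e) ∂N.energyMeasure ψ := by
  rw [N.spectralSum_eq_sum hw, N.spectralSum_eq_sum hv, ← Finset.sum_sub_distrib]
  refine Finset.sum_congr rfl fun ψ _ => ?_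
  rw [← integral_const_mul, ← integral_const_mul,
    ← integral_sub ((N.integrable_energyMeasure hb ψ).const_mul _)
      ((N.integrable_energyMeasure (hb.mul hc) ψ).const_mul _)]
  refine integral_congr_ae (.of_forall fun e => ?_)
  ring

theorem spectralSum_eq_of_wave {c : ℝ → ℂ} (hc : BoundedOnSpectrum c) {v w : H →₀ ℂ}
    (h : ∀ t, N.spectralSum (wave t) w = N.spectralSum (fun e => wave t e * c e) v)
    {b : ℝ → ℂ} (hb : BoundedOnSpectrum b) :
    N.spectralSum b w = N.spectralSum (fun e => b e * c e) v := by
  classical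
  have hv : v.support ⊆ v.support ∪ w.support := Finset.subset_union_left
  have hw : w.support ⊆ v.support ∪ w.support := Finset.subset_union_right
  have hF (ψ : H) : BoundedOnSpectrum fun e => w ψ - v ψ * c e :=
    (boundedOnSpectrum_const _).sub ((boundedOnSpectrum_const _).mul hc)
  rw [← sub_eq_zero, N.spectralSum_sub_spectralSum_mul hc hv hw hb]
  refine sum_integral_mul_eq_zero_of_wave (fun ψ _ => N.integrable_energyMeasure (hF ψ) ψ)
    (fun t => ?_) fun ψ _ => N.integrable_energyMeasure (hb.mul (hF ψ)) ψ
  rw [← N.spectralSum_sub_spectralSum_mul hc hv hw (boundedOnSpectrum_wave t), h t, sub_self]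

theorem spectralSum_congr_of_wave {v w : H →₀ ℂ}
    (h : ∀ t, N.spectralSum (wave t) w = N.spectralSum (wave t) v)
    {b : ℝ → ℂ} (hb : BoundedOnSpectrum b) : N.spectralSum b w = N.spectralSum b v := by
  simpa only [mul_one] using N.spectralSum_eq_of_wave (boundedOnSpectrum_const 1) (v := v) (w := w)
    (by simpa only [mul_one] using h) hb

/-- The combination of diagonal terms `⟨ψ, · ψ⟩` that gives the off-diagonal term `⟨x, · y⟩`. -/
def polarization (x y : H) : H →₀ ℂ :=
  (4⁻¹ : ℂ) • (Finsupp.single (x + y) 1 - Finsupp.single (x - y) 1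
    - Complex.I • Finsupp.single (x + Complex.I • y) 1
    + Complex.I • Finsupp.single (x - Complex.I • y) 1)

theorem spectralSum_polarization (b : ℝ → ℂ) (x y : H) :
    N.spectralSum b (polarization x y) = 4⁻¹ * ((∫ e, b e ∂N.energyMeasure (x + y))
      - (∫ e, b e ∂N.energyMeasure (x - y))
      - Complex.I * (∫ e, b e ∂N.energyMeasure (x + Complex.I • y))
      + Complex.I * (∫ e, b e ∂N.energyMeasure (x - Complex.I • y))) := by
  simp only [polarization, spectralSum, map_smul, map_add, map_sub,
    Finsupp.linearCombination_single, smul_eq_mul, one_mul]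

theorem spectralSum_polarization_eq_inner {b : ℝ → ℂ} {B : H →L[ℂ] H}
    (h : ∀ ψ, ⟪ψ, B ψ⟫_ℂ = ∫ e, b e ∂N.energyMeasure ψ) (x y : H) :
    N.spectralSum b (polarization x y) = ⟪x, B y⟫_ℂ := by
  rw [spectralSum_polarization, ← h, ← h, ← h, ← h]
  simp only [map_add, map_sub, map_smul, inner_add_left, inner_add_right, inner_sub_left,
    inner_sub_right, inner_smul_left, inner_smul_right, Complex.conj_I]
  linear_combination (-(4⁻¹ : ℂ) * (2 * ⟪x, B y⟫_ℂ - 2 * ⟪y, B x⟫_ℂ)) * Complex.I_sq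

theorem spectralSum_wave_polarization (t : ℝ) (x y : H) :
    N.spectralSum (wave t) (polarization x y) = ⟪x, N.timeU t y⟫_ℂ :=
  N.spectralSum_polarization_eq_inner (fun ψ => N.inner_timeU_eq_integral ψ t) x y

theorem norm_spectralSum_polarization_le {b : ℝ → ℂ} {C : ℝ} (hC : ∀ e, 0 ≤ e → ‖b e‖ ≤ C)
    (x y : H) : ‖N.spectralSum b (polarization x y)‖ ≤ C * (‖x‖ ^ 2 + ‖y‖ ^ 2) := by
  have parallelogram : ‖x + y‖ ^ 2 + ‖x - y‖ ^ 2 = 2 * (‖x‖ ^ 2 + ‖y‖ ^ 2) :=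
    parallelogram_law_with_norm ℂ x y
  have parallelogram_I : ‖x + Complex.I • y‖ ^ 2 + ‖x - Complex.I • y‖ ^ 2
      = 2 * (‖x‖ ^ 2 + ‖y‖ ^ 2) := by
    simpa only [norm_smul, Complex.norm_I, one_mul]
      using parallelogram_law_with_norm ℂ x (Complex.I • y)
  have triangle (p q r u : ℂ) :
      ‖p - q - Complex.I * r + Complex.I * u‖ ≤ ‖p‖ + ‖q‖ + ‖r‖ + ‖u‖ := by
    have hr : ‖Complex.I * r‖ ≤ ‖r‖ := by rw [norm_mul, Complex.norm_I, one_mul]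
    have hu : ‖Complex.I * u‖ ≤ ‖u‖ := by rw [norm_mul, Complex.norm_I, one_mul]
    exact norm_add_le_of_le (norm_sub_le_of_le (norm_sub_le p q) hr) hu
  have hμ (ψ : H) := N.norm_integral_energyMeasure_le hC ψ
  rw [spectralSum_polarization, norm_mul, norm_inv, RCLike.norm_ofNat]
  calc _ ≤ 4⁻¹ * (C * ‖x + y‖ ^ 2 + C * ‖x - y‖ ^ 2 + C * ‖x + Complex.I • y‖ ^ 2
          + C * ‖x - Complex.I • y‖ ^ 2) := by
        gcongr
        refine (triangle _ _ _ _).trans ?_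
        gcongr <;> exact hμ _
    _ = C * (‖x‖ ^ 2 + ‖y‖ ^ 2) := by
        linear_combination (4⁻¹ * C) * (parallelogram + parallelogram_I)

/-- The sesquilinear form `⟨x, b(H) y⟩`, defined by polarization of `⟨ψ, b(H) ψ⟩ = ∫ b dμ_ψ`. -/
def spectralForm (b : ℝ → ℂ) (hb : BoundedOnSpectrum b) : H →ₗ⋆[ℂ] H →ₗ[ℂ] ℂ :=
  LinearMap.mk₂'ₛₗ (starRingEnd ℂ) (RingHom.id ℂ)
    (fun x y => N.spectralSum b (polarization x y))
    (fun x x' y => by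
      rw [← map_add]
      exact N.spectralSum_congr_of_wave (fun t => by simp [spectralSum_wave_polarization]) hb)
    (fun c x y => by
      rw [← map_smul]
      exact N.spectralSum_congr_of_wave
        (fun t => by simp [spectralSum_wave_polarization, mul_comm]) hb)
    (fun x y y' => by
      rw [← map_add]
      exact N.spectralSum_congr_of_wave (fun t => by simp [spectralSum_wave_polarization]) hb)
    (fun c x y => by
      rw [← map_smul]
      exact N.spectralSum_congr_of_wave (fun t => by simp [spectralSum_wave_polarization]) hb)

theorem isEnergyFunction_iff {b : ℝ → ℂ} {B : H →L[ℂ] H} :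
    N.IsEnergyFunction b B ↔ ∀ ψ, ⟪ψ, B ψ⟫_ℂ = ∫ e, b e ∂N.energyMeasure ψ := by
  refine ⟨fun h ψ => h ψ _ (N.isEnergyMeasure_energyMeasure ψ), fun h ψ μ hμ => ?_⟩
  rw [h, (N.isEnergyMeasure_energyMeasure ψ).eq hμ]

theorem exists_isEnergyFunction {b : ℝ → ℂ} (hb : BoundedOnSpectrum b) :
    ∃ B, N.IsEnergyFunction b B := by
  obtain ⟨C, hC⟩ := hb.2
  obtain ⟨B, hB⟩ := exists_operator_of_sesquilinear (N.spectralForm b hb)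
    (norm_sesquilinear_le_of_sq _ fun x y => N.norm_spectralSum_polarization_le hC x y)
  have single (a : ℝ → ℂ) (ψ : H) :
      N.spectralSum a (Finsupp.single ψ 1) = ∫ e, a e ∂N.energyMeasure ψ := by
    rw [spectralSum, Finsupp.linearCombination_single, one_smul]
  refine ⟨B, N.isEnergyFunction_iff.mpr fun ψ => ?_⟩
  rw [hB, ← single]
  refine N.spectralSum_congr_of_wave (fun t => ?_) hb
  rw [spectralSum_wave_polarization, inner_timeU_eq_integral, single]

theorem isEnergyFunction_energyFunction {b : ℝ → ℂ} (hb : BoundedOnSpectrum b) :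
    N.IsEnergyFunction b (N.energyFunction b) := by
  rw [energyFunction, dif_pos (N.exists_isEnergyFunction hb)]
  exact (N.exists_isEnergyFunction hb).choose_spec

theorem energyFunction_eq {b : ℝ → ℂ} {B : H →L[ℂ] H} (hb : BoundedOnSpectrum b)
    (h : ∀ ψ, ⟪ψ, B ψ⟫_ℂ = ∫ e, b e ∂N.energyMeasure ψ) : N.energyFunction b = B :=
  IsEnergyFunction.unique N (N.isEnergyFunction_energyFunction hb) (N.isEnergyFunction_iff.mpr h)

theorem inner_energyFunction_self {b : ℝ → ℂ} (hb : BoundedOnSpectrum b) (ψ : H) :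
    ⟪ψ, N.energyFunction b ψ⟫_ℂ = ∫ e, b e ∂N.energyMeasure ψ :=
  N.isEnergyFunction_iff.mp (N.isEnergyFunction_energyFunction hb) ψ

theorem inner_energyFunction {b : ℝ → ℂ} (hb : BoundedOnSpectrum b) (x y : H) :
    ⟪x, N.energyFunction b y⟫_ℂ = N.spectralSum b (polarization x y) :=
  (N.spectralSum_polarization_eq_inner (N.inner_energyFunction_self hb) x y).symm

theorem energyFunction_wave (t : ℝ) : N.energyFunction (wave t) = N.timeU t :=
  N.energyFunction_eq (boundedOnSpectrum_wave t) fun ψ => N.inner_timeU_eq_integral ψ t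

theorem energyFunction_const (c : ℂ) : N.energyFunction (fun _ => c) = c • 1 := by
  refine N.energyFunction_eq (boundedOnSpectrum_const c) fun ψ => ?_
  rw [integral_const, N.energyMeasure_univ, smul_apply, inner_smul_right, one_apply_eq_self,
    inner_self_eq_norm_sq_to_K, Complex.real_smul, Complex.ofReal_pow, mul_comm]
  rfl

theorem energyFunction_congr {b c : ℝ → ℂ} (hb : BoundedOnSpectrum b) (hc : BoundedOnSpectrum c)
    (h : ∀ e, 0 ≤ e → b e = c e) : N.energyFunction b = N.energyFunction c := by
  refine N.energyFunction_eq hb fun ψ => ?_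
  rw [N.inner_energyFunction_self hc]
  refine integral_congr_ae ?_
  filter_upwards [N.energyMeasure_ae_nonneg ψ] with e he using (h e he).symm

theorem energyFunction_sub {b c : ℝ → ℂ} (hb : BoundedOnSpectrum b) (hc : BoundedOnSpectrum c) :
    N.energyFunction (fun e => b e - c e) = N.energyFunction b - N.energyFunction c := by
  refine N.energyFunction_eq (hb.sub hc) fun ψ => ?_
  rw [sub_apply, inner_sub_right, N.inner_energyFunction_self hb, N.inner_energyFunction_self hc,
    integral_sub (N.integrable_energyMeasure hb ψ) (N.integrable_energyMeasure hc ψ)]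

theorem star_energyFunction {b : ℝ → ℂ} (hb : BoundedOnSpectrum b) :
    star (N.energyFunction b) = N.energyFunction fun e => conj (b e) := by
  refine (N.energyFunction_eq hb.conj fun ψ => ?_).symm
  rw [ContinuousLinearMap.star_eq_adjoint, ContinuousLinearMap.adjoint_inner_right,
    ← inner_conj_symm, N.inner_energyFunction_self hb, integral_conj]

theorem inner_timeU_energyFunction {b : ℝ → ℂ} (hb : BoundedOnSpectrum b) (t : ℝ) (x y : H) :
    ⟪x, N.timeU t (N.energyFunction b y)⟫_ℂ
      = N.spectralSum (fun e => wave t e * b e) (polarization x y) := by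
  simp only [mul_comm (wave t _)]
  rw [← clm_mul_app, timeU_commute_energyFunction, clm_mul_app, N.inner_energyFunction hb]
  refine N.spectralSum_eq_of_wave (boundedOnSpectrum_wave t) (fun t' => ?_) hb
  simp only [wave_mul]
  rw [spectralSum_wave_polarization, spectralSum_wave_polarization, ← clm_mul_app, timeU_mul]

theorem energyFunction_mul {b c : ℝ → ℂ} (hb : BoundedOnSpectrum b) (hc : BoundedOnSpectrum c) :
    N.energyFunction b * N.energyFunction c = N.energyFunction fun e => b e * c e := by
  refine ContinuousLinearMap.ext fun y => ext_inner_left ℂ fun x => ?_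
  rw [clm_mul_app, N.inner_energyFunction hb, N.inner_energyFunction (hb.mul hc)]
  refine N.spectralSum_eq_of_wave hc (fun t => ?_) hb
  rw [spectralSum_wave_polarization, N.inner_timeU_energyFunction hc]

theorem energyFunction_mul_apply {b c : ℝ → ℂ} (hb : BoundedOnSpectrum b)
    (hc : BoundedOnSpectrum c) (x : H) :
    N.energyFunction b (N.energyFunction c x) = N.energyFunction (fun e => b e * c e) x := by
  rw [← N.energyFunction_mul hb hc, clm_mul_app]

theorem inner_energyFunction_energyFunction {b c : ℝ → ℂ} (hb : BoundedOnSpectrum b)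
    (hc : BoundedOnSpectrum c) (x y : H) :
    ⟪N.energyFunction b x, N.energyFunction c y⟫_ℂ
      = ⟪x, N.energyFunction (fun e => conj (b e) * c e) y⟫_ℂ := by
  rw [← ContinuousLinearMap.adjoint_inner_right, ← ContinuousLinearMap.star_eq_adjoint,
    N.star_energyFunction hb, N.energyFunction_mul_apply hb.conj hc]

theorem norm_energyFunction_le {b : ℝ → ℂ} (hb : BoundedOnSpectrum b) {C : ℝ}
    (hC : ∀ e, 0 ≤ e → ‖b e‖ ≤ C) : ‖N.energyFunction b‖ ≤ C := by
  have hC0 : 0 ≤ C := (norm_nonneg _).trans (hC 0 le_rfl)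
  refine ContinuousLinearMap.opNorm_le_bound _ hC0 fun x => ?_
  refine le_of_sq_le_sq ?_ (by positivity)
  have hsq (e : ℝ) (he : 0 ≤ e) : ‖conj (b e) * b e‖ ≤ C ^ 2 := by
    rw [norm_mul, RCLike.norm_conj, ← sq]
    exact pow_le_pow_left₀ (norm_nonneg _) (hC e he) 2
  calc ‖N.energyFunction b x‖ ^ 2 = ‖⟪N.energyFunction b x, N.energyFunction b x⟫_ℂ‖ := by
        rw [inner_self_eq_norm_sq_to_K, norm_pow, RCLike.norm_ofReal, abs_norm]
    _ = ‖∫ e, conj (b e) * b e ∂N.energyMeasure x‖ := by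
        rw [N.inner_energyFunction_energyFunction hb hb,
          N.inner_energyFunction_self (hb.conj.mul hb)]
    _ ≤ C ^ 2 * ‖x‖ ^ 2 := N.norm_integral_energyMeasure_le hsq x
    _ = (C * ‖x‖) ^ 2 := (mul_pow _ _ _).symm

theorem energyMeasure_vacuum : N.energyMeasure N.Ω = Measure.dirac 0 := by
  refine (N.isEnergyMeasure_energyMeasure N.Ω).eq ⟨inferInstance, fun t => ?_⟩
  rw [timeU, N.U_vacuum, inner_self_eq_norm_sq_to_K, N.norm_vacuum]
  simp

theorem energyFunction_vacuum {b : ℝ → ℂ} (hb : BoundedOnSpectrum b) :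
    N.energyFunction b N.Ω = b 0 • N.Ω := by
  have hd := hb.sub (boundedOnSpectrum_const (b 0))
  have hzero : N.energyFunction (fun e => b e - b 0) N.Ω = 0 := by
    rw [← inner_self_eq_zero (𝕜 := ℂ), N.inner_energyFunction_energyFunction hd hd,
      N.inner_energyFunction_self (hd.conj.mul hd), energyMeasure_vacuum, integral_dirac,
      sub_self, mul_zero]
  rwa [N.energyFunction_sub hb (boundedOnSpectrum_const _), energyFunction_const, sub_apply,
    sub_eq_zero, smul_apply, one_apply_eq_self] at hzero

theorem inner_vacuum_energyFunction {b : ℝ → ℂ} (hb : BoundedOnSpectrum b) (x : H) :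
    ⟪N.Ω, N.energyFunction b x⟫_ℂ = b 0 * ⟪N.Ω, x⟫_ℂ := by
  rw [← ContinuousLinearMap.adjoint_inner_left, ← ContinuousLinearMap.star_eq_adjoint,
    N.star_energyFunction hb, N.energyFunction_vacuum hb.conj, inner_smul_left, Complex.conj_conj]

/-- The operator `exp (c H)`, meaningful for `Re c ≤ 0`. -/
def expH (c : ℂ) : H →L[ℂ] H := N.energyFunction (expFn c)

theorem expH_expH {c d : ℂ} (hc : c.re ≤ 0) (hd : d.re ≤ 0) (x : H) :
    N.expH c (N.expH d x) = N.expH (c + d) x := by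
  rw [expH, expH, N.energyFunction_mul_apply (boundedOnSpectrum_expFn hc)
    (boundedOnSpectrum_expFn hd), expFn_mul_expFn, expH]

theorem inner_expH_left {c : ℂ} (hc : c.re ≤ 0) (x y : H) :
    ⟪N.expH c x, y⟫_ℂ = ⟪x, N.expH (conj c) y⟫_ℂ := by
  rw [← ContinuousLinearMap.adjoint_inner_right, ← ContinuousLinearMap.star_eq_adjoint, expH,
    N.star_energyFunction (boundedOnSpectrum_expFn hc), conj_expFn, expH]

theorem inner_expH_expH {c d : ℂ} (hc : c.re ≤ 0) (hd : d.re ≤ 0) (x y : H) :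
    ⟪N.expH c x, N.expH d y⟫_ℂ = ⟪x, N.expH (conj c + d) y⟫_ℂ := by
  rw [N.inner_expH_left hc, N.expH_expH ((Complex.conj_re c).trans_le hc) hd]

theorem expH_vacuum {c : ℂ} (hc : c.re ≤ 0) : N.expH c N.Ω = N.Ω := by
  rw [expH, N.energyFunction_vacuum (boundedOnSpectrum_expFn hc), expFn_zero_right, one_smul]

theorem norm_expH_le {c : ℂ} (hc : c.re ≤ 0) : ‖N.expH c‖ ≤ 1 :=
  N.norm_energyFunction_le (boundedOnSpectrum_expFn hc) fun _ he => norm_expFn_le hc he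

theorem R_mul {ℓ ℓ' : ℝ} (hℓ : 0 ≤ ℓ) (hℓ' : 0 ≤ ℓ') : N.R ℓ * N.R ℓ' = N.R (ℓ + ℓ') := by
  have hb := boundedOnSpectrum_resolvent hℓ
  have hb' := boundedOnSpectrum_resolvent hℓ'
  rw [R, R, N.energyFunction_mul hb hb']
  refine N.energyFunction_congr (hb.mul hb') (boundedOnSpectrum_resolvent (by positivity))
    fun e he => ?_
  rw [← Complex.ofReal_mul, ← Real.rpow_add (by linarith), neg_add]

theorem norm_R_le {ℓ : ℝ} (hℓ : 0 ≤ ℓ) : ‖N.R ℓ‖ ≤ 1 :=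
  N.norm_energyFunction_le (boundedOnSpectrum_resolvent hℓ) fun _ he => norm_resolvent_le_one hℓ he

theorem inner_R_left (ℓ : ℝ) (x y : H) : ⟪N.R ℓ x, y⟫_ℂ = ⟪x, N.R ℓ y⟫_ℂ := by
  rw [← ContinuousLinearMap.adjoint_inner_right, ← ContinuousLinearMap.star_eq_adjoint, star_R]

theorem R_mul_dampedPower {ε ℓ : ℝ} (hε : 0 < ε) (hℓ : 0 ≤ ℓ) :
    N.R ℓ * N.energyFunction (dampedPower ε ℓ) = N.expH (-(ε : ℂ)) := by
  have hb := boundedOnSpectrum_resolvent hℓ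
  have hb' := boundedOnSpectrum_dampedPower hε ℓ
  rw [R, N.energyFunction_mul hb hb', expH]
  refine N.energyFunction_congr (hb.mul hb')
    (boundedOnSpectrum_expFn (re_neg_ofReal_nonpos hε.le)) fun e he => ?_
  rw [dampedPower, ← Complex.ofReal_mul, ← mul_assoc, ← Real.rpow_add (by linarith),
    neg_add_cancel, Real.rpow_zero, one_mul, expFn, Complex.ofReal_exp, Complex.ofReal_neg,
    Complex.ofReal_mul, neg_mul]

/-! ### Smooth functionals and damped fields -/

theorem energyNorm_nonneg {ℓ : ℝ} (hℓ : 0 < ℓ) (σ : N.Smooth) : 0 ≤ N.energyNorm ℓ σ :=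
  (N.energyBound_energyNorm hℓ σ).1

theorem norm_R_mul_mul_R_anti {ℓ ℓ' : ℝ} (hℓ : 0 ≤ ℓ) (h : ℓ ≤ ℓ') (A : H →L[ℂ] H) :
    ‖N.R ℓ' * A * N.R ℓ'‖ ≤ ‖N.R ℓ * A * N.R ℓ‖ := by
  have hd : 0 ≤ ℓ' - ℓ := sub_nonneg.mpr h
  calc ‖N.R ℓ' * A * N.R ℓ'‖ = ‖N.R (ℓ' - ℓ) * (N.R ℓ * A * N.R ℓ) * N.R (ℓ' - ℓ)‖ := by
        rw [← mul_assoc, ← mul_assoc, N.R_mul hd hℓ, mul_assoc _ (N.R ℓ), N.R_mul hℓ hd,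
          sub_add_cancel, add_sub_cancel]
    _ ≤ ‖N.R (ℓ' - ℓ)‖ * ‖N.R ℓ * A * N.R ℓ‖ * ‖N.R (ℓ' - ℓ)‖ := norm_mul₃_le
    _ ≤ 1 * ‖N.R ℓ * A * N.R ℓ‖ * 1 := by gcongr <;> exact N.norm_R_le hd
    _ = ‖N.R ℓ * A * N.R ℓ‖ := by rw [one_mul, mul_one]

theorem energyNorm_mono {ℓ ℓ' : ℝ} (hℓ : 0 < ℓ) (h : ℓ ≤ ℓ') (σ : N.Smooth) :
    N.energyNorm ℓ σ ≤ N.energyNorm ℓ' σ := by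
  obtain ⟨h0, hb⟩ := N.energyBound_energyNorm (hℓ.trans_le h) σ
  exact N.energyNorm_le ⟨h0, fun A => (hb A).trans
    (mul_le_mul_of_nonneg_left (N.norm_R_mul_mul_R_anti hℓ.le h A) h0)⟩

theorem exists_dual_bound (φ : N.SmoothDual) :
    ∃ n : ℕ, 0 < n ∧ ∃ C : ℝ, 0 ≤ C ∧ ∀ σ : N.Smooth, ‖φ σ‖ ≤ C * N.energyNorm n σ := by
  have hcont : Continuous ((normSeminorm ℂ ℂ).comp
      ((WeakDual.toStrongDual φ : StrongDual ℂ N.Smooth) : N.Smooth →ₗ[ℂ] ℂ)) :=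
    continuous_norm.comp (map_continuous φ)
  obtain ⟨S, C, -, hSC⟩ := Seminorm.bound_of_continuous N.withSeminorms _ hcont
  obtain ⟨n, hn⟩ : ∃ n : ℕ, ∀ ℓ ∈ S, ℓ.1 ≤ n := by
    obtain ⟨M, hM⟩ := (S.finite_toSet.image fun ℓ => (ℓ.1 : ℝ)).bddAbove
    obtain ⟨n, hn⟩ := exists_nat_ge M
    exact ⟨n, fun ℓ hℓ => (hM ⟨ℓ, hℓ, rfl⟩).trans hn⟩
  refine ⟨n + 1, n.succ_pos, C, C.2, fun σ => ?_⟩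
  have hσ : ‖φ σ‖ ≤ C * (S.sup N.seminormFamily) σ := hSC σ
  refine hσ.trans (mul_le_mul_of_nonneg_left ?_ C.2)
  have hpos : (0 : ℝ) < ((n + 1 : ℕ) : ℝ) := Nat.cast_pos.mpr n.succ_pos
  refine Seminorm.finset_sup_apply_le (N.energyNorm_nonneg hpos σ) fun ℓ hℓ => ?_
  exact N.energyNorm_mono ℓ.2 ((hn ℓ hℓ).trans (Nat.cast_le.mpr n.le_succ)) σ

theorem energyBound_vectorFunctional {ε ℓ : ℝ} (hε : 0 < ε) (hℓ : 0 < ℓ) (χ ξ : H) {C : ℝ}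
    (hC : ∀ e, 0 ≤ e → ‖dampedPower ε ℓ e‖ ≤ C) :
    N.EnergyBound ℓ (vectorFunctional (N.expH (-(ε : ℂ)) χ) (N.expH (-(ε : ℂ)) ξ))
      (C ^ 2 * ‖χ‖ * ‖ξ‖) := by
  refine ⟨by positivity, fun A => ?_⟩
  have hC0 : 0 ≤ C := (norm_nonneg _).trans (hC 0 le_rfl)
  have hD (x : H) : ‖N.energyFunction (dampedPower ε ℓ) x‖ ≤ C * ‖x‖ :=
    ContinuousLinearMap.le_of_opNorm_le _
      (N.norm_energyFunction_le (boundedOnSpectrum_dampedPower hε ℓ) hC) x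
  rw [vectorFunctional_apply, ← N.R_mul_dampedPower hε hℓ.le, clm_mul_app, clm_mul_app,
    inner_R_left]
  calc ‖⟪N.energyFunction (dampedPower ε ℓ) χ,
        (N.R ℓ * A * N.R ℓ) (N.energyFunction (dampedPower ε ℓ) ξ)⟫_ℂ‖
      ≤ ‖N.energyFunction (dampedPower ε ℓ) χ‖ *
        (‖N.R ℓ * A * N.R ℓ‖ * ‖N.energyFunction (dampedPower ε ℓ) ξ‖) :=
        (norm_inner_le_norm _ _).trans (by gcongr; exact ContinuousLinearMap.le_opNorm _ _)
    _ ≤ (C * ‖χ‖) * (‖N.R ℓ * A * N.R ℓ‖ * (C * ‖ξ‖)) := by gcongr <;> exact hD _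
    _ = C ^ 2 * ‖χ‖ * ‖ξ‖ * ‖N.R ℓ * A * N.R ℓ‖ := by ring

/-- The functional `A ↦ ⟨e^{-εH} χ, A e^{-εH} ξ⟩` in `𝒞^∞(Σ)`, the prototype of a smooth
functional. -/
def dampedFunctional (ε : ℝ) (hε : 0 < ε) (χ ξ : H) : N.Smooth :=
  ⟨vectorFunctional (N.expH (-(ε : ℂ)) χ) (N.expH (-(ε : ℂ)) ξ),
    isNormalFunctional_vectorFunctional _ _, fun ℓ hℓ => by
      obtain ⟨C, hC⟩ := (boundedOnSpectrum_dampedPower hε ℓ).2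
      exact ⟨_, N.energyBound_vectorFunctional hε hℓ χ ξ hC⟩⟩

theorem dampedFunctional_apply (ε : ℝ) (hε : 0 < ε) (χ ξ : H) (A : H →L[ℂ] H) :
    (N.dampedFunctional ε hε χ ξ).1 A = ⟪N.expH (-(ε : ℂ)) χ, A (N.expH (-(ε : ℂ)) ξ)⟫_ℂ := rfl

variable {N} in
theorem Smooth.ext {σ τ : N.Smooth} (h : ∀ A, σ.1 A = τ.1 A) : σ = τ :=
  Subtype.ext (ContinuousLinearMap.ext h)

theorem Smooth.add_apply (σ τ : N.Smooth) (A : H →L[ℂ] H) : (σ + τ).1 A = σ.1 A + τ.1 A := rfl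

theorem Smooth.sub_apply (σ τ : N.Smooth) (A : H →L[ℂ] H) : (σ - τ).1 A = σ.1 A - τ.1 A := rfl

theorem Smooth.smul_apply (c : ℂ) (σ : N.Smooth) (A : H →L[ℂ] H) : (c • σ).1 A = c * σ.1 A := rfl

/-- The sesquilinear form of `e^{-εH} φ e^{-εH}`. -/
def dampedForm (ε : ℝ) (hε : 0 < ε) (φ : N.SmoothDual) : H →ₗ⋆[ℂ] H →ₗ[ℂ] ℂ :=
  LinearMap.mk₂'ₛₗ (starRingEnd ℂ) (RingHom.id ℂ)
    (fun χ ξ => φ (N.dampedFunctional ε hε χ ξ))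
    (fun x x' y => by
      rw [← map_add]
      exact congrArg φ (Smooth.ext fun A => by simp [dampedFunctional_apply, Smooth.add_apply]))
    (fun c x y => by
      rw [← map_smul]
      exact congrArg φ (Smooth.ext fun A => by
        simp [dampedFunctional_apply, Smooth.smul_apply, mul_comm]))
    (fun x y y' => by
      rw [← map_add]
      exact congrArg φ (Smooth.ext fun A => by simp [dampedFunctional_apply, Smooth.add_apply]))
    (fun c x y => by
      rw [RingHom.id_apply, ← map_smul]
      exact congrArg φ (Smooth.ext fun A => by
        simp [dampedFunctional_apply, Smooth.smul_apply]))

theorem norm_dual_dampedFunctional_le {φ : N.SmoothDual} {n : ℕ} (hn : 0 < n) {C : ℝ}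
    (hC0 : 0 ≤ C) (hC : ∀ σ : N.Smooth, ‖φ σ‖ ≤ C * N.energyNorm n σ) {ε : ℝ} (hε : 0 < ε)
    (χ ξ : H) : ‖φ (N.dampedFunctional ε hε χ ξ)‖
      ≤ C * (n.factorial * Real.exp ε / ε ^ n) ^ 2 * ‖χ‖ * ‖ξ‖ := by
  have hnorm : N.energyNorm n (N.dampedFunctional ε hε χ ξ)
      ≤ (n.factorial * Real.exp ε / ε ^ n) ^ 2 * ‖χ‖ * ‖ξ‖ :=
    N.energyNorm_le (N.energyBound_vectorFunctional hε (Nat.cast_pos.mpr hn) χ ξ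
      fun _ he => norm_dampedPower_le hε le_rfl he)
  calc _ ≤ C * ((n.factorial * Real.exp ε / ε ^ n) ^ 2 * ‖χ‖ * ‖ξ‖) := (hC _).trans (by gcongr)
    _ = _ := by ring

theorem exp_neg_ofReal_eq_expFn (ε : ℝ) :
    (fun e : ℝ => Complex.exp (-((ε * e : ℝ) : ℂ))) = expFn (-(ε : ℂ)) := by
  funext e
  rw [expFn, Complex.ofReal_mul, neg_mul]

theorem isDamped_iff {ε : ℝ} (hε : 0 < ε) {φ : N.SmoothDual} {B : H →L[ℂ] H} :
    N.IsDamped ε φ B ↔ ∀ χ ξ, ⟪χ, B ξ⟫_ℂ = φ (N.dampedFunctional ε hε χ ξ) := by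
  unfold IsDamped
  rw [exp_neg_ofReal_eq_expFn]
  exact ⟨fun h χ ξ => h χ ξ _ fun A => rfl, fun h χ ξ σ hσ =>
    (h χ ξ).trans (congrArg φ (Smooth.ext fun A => (hσ A).symm))⟩

theorem exists_isDamped {ε : ℝ} (hε : 0 < ε) (φ : N.SmoothDual) : ∃ B, N.IsDamped ε φ B := by
  obtain ⟨n, hn, C, hC0, hC⟩ := N.exists_dual_bound φ
  obtain ⟨B, hB⟩ := exists_operator_of_sesquilinear (N.dampedForm ε hε φ)
    (N.norm_dual_dampedFunctional_le hn hC0 hC hε)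
  exact ⟨B, (N.isDamped_iff hε).mpr hB⟩

theorem inner_damped {ε : ℝ} (hε : 0 < ε) (φ : N.SmoothDual) (χ ξ : H) :
    ⟪χ, N.damped ε φ ξ⟫_ℂ = φ (N.dampedFunctional ε hε χ ξ) := by
  rw [damped, dif_pos (N.exists_isDamped hε φ)]
  exact (N.isDamped_iff hε).mp (N.exists_isDamped hε φ).choose_spec χ ξ

theorem damped_add {ε δ : ℝ} (hε : 0 < ε) (hδ : 0 ≤ δ) (φ : N.SmoothDual) :
    N.damped (ε + δ) φ = N.expH (-(δ : ℂ)) * N.damped ε φ * N.expH (-(δ : ℂ)) := by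
  have hδ_re := re_neg_ofReal_nonpos hδ
  have hε_re := re_neg_ofReal_nonpos hε.le
  refine ContinuousLinearMap.ext fun ξ => ext_inner_left ℂ fun χ => ?_
  have hself : ⟪χ, N.expH (-(δ : ℂ)) (N.damped ε φ (N.expH (-(δ : ℂ)) ξ))⟫_ℂ
      = ⟪N.expH (-(δ : ℂ)) χ, N.damped ε φ (N.expH (-(δ : ℂ)) ξ)⟫_ℂ := by
    rw [N.inner_expH_left hδ_re, map_neg, Complex.conj_ofReal]
  rw [clm_mul_app, clm_mul_app, hself, N.inner_damped (by positivity), N.inner_damped hε]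
  refine congrArg φ (Smooth.ext fun A => ?_)
  rw [dampedFunctional_apply, dampedFunctional_apply, N.expH_expH hε_re hδ_re,
    N.expH_expH hε_re hδ_re, Complex.ofReal_add, neg_add]

theorem damped_starDual {ε : ℝ} (hε : 0 < ε) (φ : N.SmoothDual) :
    N.damped ε (N.starDual φ) = star (N.damped ε φ) := by
  refine ContinuousLinearMap.ext fun ξ => ext_inner_left ℂ fun χ => ?_
  rw [N.inner_damped hε, ContinuousLinearMap.star_eq_adjoint,
    ContinuousLinearMap.adjoint_inner_right, ← inner_conj_symm, N.inner_damped hε]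
  change conj (φ (N.starSmooth (N.dampedFunctional ε hε χ ξ))) = _
  refine congrArg (fun τ => conj (φ τ)) (Smooth.ext fun A => ?_)
  change conj ((N.dampedFunctional ε hε χ ξ).1 (star A)) = _
  rw [dampedFunctional_apply, dampedFunctional_apply, inner_conj_symm,
    ContinuousLinearMap.star_eq_adjoint, ContinuousLinearMap.adjoint_inner_left]

/-! ### The two-point function in the vacuum -/

/-- The vector `e^{-εH} φ Ω`. -/
def fieldVector (φ : N.SmoothDual) (ε : ℝ) : H := N.damped ε φ N.Ω

theorem fieldVector_add {ε δ : ℝ} (hε : 0 < ε) (hδ : 0 ≤ δ) (φ : N.SmoothDual) :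
    N.fieldVector φ (ε + δ) = N.expH (-(δ : ℂ)) (N.fieldVector φ ε) := by
  rw [fieldVector, N.damped_add hε hδ, clm_mul_app, clm_mul_app,
    N.expH_vacuum (re_neg_ofReal_nonpos hδ), fieldVector]

theorem exists_norm_fieldVector_le (φ : N.SmoothDual) : ∃ (n : ℕ) (C : ℝ),
    ∀ ε, 0 < ε → ε ≤ 1 → ‖N.fieldVector φ ε‖ ≤ C / ε ^ n := by
  obtain ⟨n, hn, C, hC0, hC⟩ := N.exists_dual_bound φ
  refine ⟨2 * n, C * (n.factorial * Real.exp 1) ^ 2, fun ε hε hε1 => ?_⟩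
  set B := C * (n.factorial * Real.exp ε / ε ^ n) ^ 2
  have hsq : ‖N.fieldVector φ ε‖ * ‖N.fieldVector φ ε‖ ≤ B * ‖N.fieldVector φ ε‖ := by
    have h := N.norm_dual_dampedFunctional_le hn hC0 hC hε (N.fieldVector φ ε) N.Ω
    rw [← N.inner_damped hε, N.norm_vacuum, mul_one] at h
    rwa [← inner_self_eq_norm_mul_norm (𝕜 := ℂ), inner_self_re_eq_norm]
  have hB : ‖N.fieldVector φ ε‖ ≤ B := by
    rcases (norm_nonneg (N.fieldVector φ ε)).eq_or_lt with h0 | hpos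
    · rw [← h0]
      positivity
    · exact le_of_mul_le_mul_right hsq hpos
  calc ‖N.fieldVector φ ε‖ ≤ C * (n.factorial * Real.exp ε / ε ^ n) ^ 2 := hB
    _ ≤ C * (n.factorial * Real.exp 1 / ε ^ n) ^ 2 := by gcongr
    _ = C * (n.factorial * Real.exp 1) ^ 2 / ε ^ (2 * n) := by
        rw [div_pow, ← mul_div_assoc, ← pow_mul, mul_comm n 2]

/-- The vacuum functional `⟨Ω, · Ω⟩`. -/
def vacuum : N.Smooth := N.dampedFunctional 1 one_pos N.Ω N.Ω

theorem vacuum_apply (A : H →L[ℂ] H) : N.vacuum.1 A = ⟪N.Ω, A N.Ω⟫_ℂ := by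
  rw [vacuum, dampedFunctional_apply, N.expH_vacuum (re_neg_ofReal_nonpos zero_le_one)]

theorem vacuum_energyFunction_mul_mul {b c : ℝ → ℂ} (hb : BoundedOnSpectrum b)
    (hc : BoundedOnSpectrum c) (A : H →L[ℂ] H) :
    N.vacuum.1 (N.energyFunction b * A * N.energyFunction c) = b 0 * c 0 * N.vacuum.1 A := by
  rw [vacuum_apply, vacuum_apply, clm_mul_app, clm_mul_app, N.inner_vacuum_energyFunction hb,
    N.energyFunction_vacuum hc, map_smul, inner_smul_right, mul_assoc]

theorem timeU_vacuum (t : ℝ) : N.timeU t N.Ω = N.Ω := N.U_vacuum _ _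

theorem translate_vacuum (t : ℝ) : N.translate t N.vacuum = N.vacuum := by
  refine Smooth.ext fun A => ?_
  change conjFunctional (N.timeU t) N.vacuum.1 A = _
  rw [conjFunctional_apply, star_timeU, ← energyFunction_wave, ← energyFunction_wave,
    N.vacuum_energyFunction_mul_mul (boundedOnSpectrum_wave _) (boundedOnSpectrum_wave _)]
  simp [wave]

theorem isEnergyBounded_vacuum {E : ℝ} (hE : 0 ≤ E) : N.IsEnergyBounded E N.vacuum.1 := by
  have hb := boundedOnSpectrum_indicator_Icc (b := 1) continuous_one E
  refine ⟨N.vacuum.1, N.vacuum.2.1, fun A => ?_⟩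
  rw [P, N.vacuum_energyFunction_mul_mul hb hb, Set.indicator_of_mem (Set.left_mem_Icc.mpr hE),
    Pi.one_apply, one_mul, one_mul]

/-- The two-point function `⟨φ Ω, exp (-i z H) φ Ω⟩`, for `Im z < 0`; as in `LocalNet.twoPoint`,
factors `e^{εH} e^{-εH}` with `ε = -Im z / 4` are inserted. -/
def vacuumTwoPoint (φ : N.SmoothDual) (z : ℂ) : ℂ :=
  ⟪N.fieldVector φ (-z.im / 4), N.expH (-(Complex.I * z) + 2 * ((-z.im / 4 : ℝ) : ℂ))
    (N.fieldVector φ (-z.im / 4))⟫_ℂ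

theorem twoPoint_vacuum {E : ℝ} (hE : 0 ≤ E) (φ : N.SmoothDual) {z : ℂ} (hz : z.im < 0) :
    N.twoPoint E N.vacuum.1 (N.starDual φ) φ z = N.vacuumTwoPoint φ z := by
  set W := (Set.Icc 0 E).indicator (expFn (Complex.I * z / 2 + ((-z.im / 4 : ℝ) : ℂ)))
  have hW : BoundedOnSpectrum W :=
    boundedOnSpectrum_indicator_Icc (by unfold expFn; fun_prop) E
  have hW0 : W 0 = 1 :=
    (Set.indicator_of_mem (Set.left_mem_Icc.mpr hE) _).trans (expFn_zero_right _)
  set M := N.expH (-(Complex.I * z) + 2 * ((-z.im / 4 : ℝ) : ℂ))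
  set D := N.damped (-z.im / 4) φ
  calc N.twoPoint E N.vacuum.1 (N.starDual φ) φ z
      = N.vacuum.1 (N.energyFunction W * (star D * M * D) * N.energyFunction W) := by
        rw [← N.damped_starDual (by linarith)]
        rfl
    _ = ⟪N.Ω, star D (M (D N.Ω))⟫_ℂ := by
        rw [N.vacuum_energyFunction_mul_mul hW hW, hW0, one_mul, one_mul, vacuum_apply,
          clm_mul_app, clm_mul_app]
    _ = N.vacuumTwoPoint φ z := by
        rw [ContinuousLinearMap.star_eq_adjoint, ContinuousLinearMap.adjoint_inner_right]
        rfl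

theorem re_neg_I_mul_add_two_mul (z : ℂ) (ε : ℝ) :
    (-(Complex.I * z) + 2 * (ε : ℂ)).re = z.im + 2 * ε := by
  simp

theorem re_I_mul_add (a : ℂ) (ε : ℝ) : (Complex.I * a + (ε : ℂ)).re = -a.im + ε := by
  simp

theorem vacuumTwoPoint_eq (φ : N.SmoothDual) {ε : ℝ} (hε : 0 < ε) {z : ℂ} (hz : 4 * ε ≤ -z.im) :
    N.vacuumTwoPoint φ z = ⟪N.fieldVector φ ε,
      N.expH (-(Complex.I * z) + 2 * ε) (N.fieldVector φ ε)⟫_ℂ := by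
  set δ : ℝ := -z.im / 4 - ε with hδ_def
  have hδ : 0 ≤ δ := by linarith
  have hδ_re := re_neg_ofReal_nonpos hδ
  have hε_add : -z.im / 4 = ε + δ := by ring
  have hM : (-(Complex.I * z) + 2 * ((ε + δ : ℝ) : ℂ)).re ≤ 0 := by
    rw [re_neg_I_mul_add_two_mul]
    linarith
  rw [vacuumTwoPoint, hε_add, N.fieldVector_add hε hδ, N.expH_expH hM hδ_re,
    N.inner_expH_expH hδ_re (by rw [Complex.add_re]; exact add_nonpos hM hδ_re)]
  congr 3
  rw [map_neg, Complex.conj_ofReal, Complex.ofReal_add]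
  ring

theorem vacuumTwoPoint_eq_integral (φ : N.SmoothDual) {ε : ℝ} (hε : 0 < ε) {z : ℂ}
    (hz : 4 * ε ≤ -z.im) : N.vacuumTwoPoint φ z =
      ∫ e, expFn (-(Complex.I * z) + 2 * ε) e ∂N.energyMeasure (N.fieldVector φ ε) := by
  have hre : (-(Complex.I * z) + 2 * (ε : ℂ)).re ≤ 0 := by
    rw [re_neg_I_mul_add_two_mul]
    linarith
  rw [N.vacuumTwoPoint_eq φ hε hz, expH,
    N.inner_energyFunction_self (boundedOnSpectrum_expFn hre)]

theorem norm_vacuumTwoPoint_le (φ : N.SmoothDual) {z : ℂ} (hz : z.im < 0) :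
    ‖N.vacuumTwoPoint φ z‖ ≤ ‖N.fieldVector φ (-z.im / 4)‖ ^ 2 := by
  have hre : (-(Complex.I * z) + 2 * ((-z.im / 4 : ℝ) : ℂ)).re ≤ 0 := by
    rw [re_neg_I_mul_add_two_mul]
    linarith
  rw [sq]
  refine (norm_inner_le_norm _ _).trans (mul_le_mul_of_nonneg_left ?_ (norm_nonneg _))
  simpa only [one_mul] using ContinuousLinearMap.le_of_opNorm_le _ (N.norm_expH_le hre) _

theorem differentiableOn_vacuumTwoPoint (φ : N.SmoothDual) :
    DifferentiableOn ℂ (N.vacuumTwoPoint φ) {z | z.im < 0} := by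
  intro z (hz : z.im < 0)
  refine DifferentiableAt.differentiableWithinAt ?_
  have hε : 0 < -z.im / 8 := by linarith
  have heq : N.vacuumTwoPoint φ =ᶠ[𝓝 z] fun w =>
      ∫ e, expFn (-(Complex.I * w) + 2 * (-z.im / 8 : ℝ)) e
        ∂N.energyMeasure (N.fieldVector φ (-z.im / 8)) := by
    have hopen : IsOpen {w : ℂ | w.im < z.im / 2} :=
      isOpen_lt Complex.continuous_im continuous_const
    filter_upwards [hopen.mem_nhds (show z.im < z.im / 2 by linarith)] with w (hw : w.im < z.im / 2)
    exact N.vacuumTwoPoint_eq_integral φ hε (by linarith)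
  refine DifferentiableAt.congr_of_eventuallyEq ?_ heq
  refine (differentiableAt_integral_expFn (N.energyMeasure_ae_nonneg _) ?_).comp z
    (f := fun w : ℂ => -(Complex.I * w) + 2 * (-z.im / 8 : ℝ)) (by fun_prop)
  rw [re_neg_I_mul_add_two_mul]
  linarith

/-- The vector `exp (i a H) φ Ω`, for `Im a > 0`. -/
def translatedFieldVector (φ : N.SmoothDual) (a : ℂ) : H :=
  N.expH (Complex.I * a + (a.im / 2 : ℝ)) (N.fieldVector φ (a.im / 2))

theorem translatedFieldVector_eq (φ : N.SmoothDual) {a : ℂ} {ε : ℝ} (hε : 0 < ε)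
    (ha : 2 * ε ≤ a.im) :
    N.translatedFieldVector φ a = N.expH (Complex.I * a + ε) (N.fieldVector φ ε) := by
  set δ : ℝ := a.im / 2 - ε with hδ_def
  have hδ : 0 ≤ δ := by linarith
  have hε_add : a.im / 2 = ε + δ := by ring
  have hre : (Complex.I * a + ((ε + δ : ℝ) : ℂ)).re ≤ 0 := by
    rw [re_I_mul_add]
    linarith
  rw [translatedFieldVector, hε_add, N.fieldVector_add hε hδ,
    N.expH_expH hre (re_neg_ofReal_nonpos hδ)]
  congr 2
  rw [Complex.ofReal_add]
  ring

theorem vacuumTwoPoint_eq_inner (φ : N.SmoothDual) {a b : ℂ} (ha : 0 < a.im) (hb : 0 < b.im) :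
    N.vacuumTwoPoint φ (conj a - b)
      = ⟪N.translatedFieldVector φ a, N.translatedFieldVector φ b⟫_ℂ := by
  obtain ⟨ε, hε, hεa, hεb⟩ : ∃ ε : ℝ, 0 < ε ∧ 4 * ε ≤ a.im ∧ 4 * ε ≤ b.im :=
    ⟨min a.im b.im / 4, div_pos (lt_min ha hb) four_pos, by linarith [min_le_left a.im b.im],
      by linarith [min_le_right a.im b.im]⟩
  have him : (conj a - b).im = -a.im - b.im := by rw [Complex.sub_im, Complex.conj_im]
  rw [N.translatedFieldVector_eq φ hε (by linarith), N.translatedFieldVector_eq φ hε (by linarith),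
    N.inner_expH_expH (by rw [re_I_mul_add]; linarith) (by rw [re_I_mul_add]; linarith),
    N.vacuumTwoPoint_eq φ hε (by linarith)]
  congr 3
  rw [map_add, map_mul, Complex.conj_I, Complex.conj_ofReal]
  ring

theorem translatedFieldVector_I_mul (φ : N.SmoothDual) {ε : ℝ} (hε : 0 < ε) :
    N.translatedFieldVector φ (Complex.I * ε) = N.fieldVector φ ε := by
  have him : (Complex.I * (ε : ℂ)).im = ε := by rw [Complex.I_mul_im, Complex.ofReal_re]
  have hc : Complex.I * (Complex.I * (ε : ℂ)) + ((ε / 2 : ℝ) : ℂ) = -((ε / 2 : ℝ) : ℂ) := by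
    rw [← mul_assoc, Complex.I_mul_I]
    push_cast
    ring
  rw [translatedFieldVector, him, hc, ← N.fieldVector_add (half_pos hε) (half_pos hε).le,
    add_halves]

/-! ### The vacuum as a separating vector -/

theorem norm_R_one_mul_energyFunction_le {b : ℝ → ℂ} (hb : BoundedOnSpectrum b) {β : ℝ}
    (hβ : ∀ e, 0 ≤ e → ‖b e‖ ≤ β * (1 + e)) : ‖N.R 1 * N.energyFunction b‖ ≤ β := by
  have hR := boundedOnSpectrum_resolvent zero_le_one
  rw [R, N.energyFunction_mul hR hb]
  refine N.norm_energyFunction_le (hR.mul hb) fun e he => ?_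
  rw [norm_mul, Complex.norm_real, Real.norm_of_nonneg (by positivity), Real.rpow_neg_one,
    inv_mul_le_iff₀ (by positivity), mul_comm]
  exact hβ e he

theorem R_mul_energyFunction_comm {b : ℝ → ℂ} (hb : BoundedOnSpectrum b) {ℓ : ℝ} (hℓ : 0 ≤ ℓ) :
    N.R ℓ * N.energyFunction b = N.energyFunction b * N.R ℓ := by
  have hR := boundedOnSpectrum_resolvent hℓ
  rw [R, N.energyFunction_mul hR hb, N.energyFunction_mul hb hR]
  simp only [mul_comm]

theorem norm_apply_energyFunction_mul_mul_le (σ : N.Smooth) {ℓ : ℝ} (hℓ : 0 < ℓ) {b c : ℝ → ℂ}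
    (hb : BoundedOnSpectrum b) (hc : BoundedOnSpectrum c) {β γ : ℝ}
    (hβ : ∀ e, 0 ≤ e → ‖b e‖ ≤ β * (1 + e)) (hγ : ∀ e, 0 ≤ e → ‖c e‖ ≤ γ * (1 + e))
    (A : H →L[ℂ] H) :
    ‖σ.1 (N.energyFunction b * A * N.energyFunction c)‖
      ≤ N.energyNorm (ℓ + 1) σ * (β * γ) * ‖N.R ℓ * A * N.R ℓ‖ := by
  have hfactor : N.R (ℓ + 1) * (N.energyFunction b * A * N.energyFunction c) * N.R (ℓ + 1)
      = (N.R 1 * N.energyFunction b) * (N.R ℓ * A * N.R ℓ) * (N.R 1 * N.energyFunction c) := by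
    calc _ = (N.R 1 * N.R ℓ) * (N.energyFunction b * A * N.energyFunction c)
          * (N.R ℓ * N.R 1) := by
          rw [N.R_mul zero_le_one hℓ.le, N.R_mul hℓ.le zero_le_one, add_comm 1 ℓ]
      _ = N.R 1 * (N.R ℓ * N.energyFunction b) * A * (N.energyFunction c * N.R ℓ) * N.R 1 := by
          simp only [mul_assoc]
      _ = (N.R 1 * N.energyFunction b) * (N.R ℓ * A * N.R ℓ)
          * (N.energyFunction c * N.R 1) := by
          rw [N.R_mul_energyFunction_comm hb hℓ.le, ← N.R_mul_energyFunction_comm hc hℓ.le]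
          simp only [mul_assoc]
      _ = _ := by rw [N.R_mul_energyFunction_comm hc zero_le_one]
  have hβ0 := (norm_nonneg _).trans (N.norm_R_one_mul_energyFunction_le hb hβ)
  obtain ⟨hσ0, hσ⟩ := N.energyBound_energyNorm (by positivity : 0 < ℓ + 1) σ
  calc _ ≤ N.energyNorm (ℓ + 1) σ * (‖N.R 1 * N.energyFunction b‖ * ‖N.R ℓ * A * N.R ℓ‖
        * ‖N.R 1 * N.energyFunction c‖) := by
        refine (hσ _).trans (mul_le_mul_of_nonneg_left ?_ hσ0)
        rw [hfactor]
        exact norm_mul₃_le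
    _ ≤ N.energyNorm (ℓ + 1) σ * (β * ‖N.R ℓ * A * N.R ℓ‖ * γ) := by
        gcongr
        · exact N.norm_R_one_mul_energyFunction_le hb hβ
        · exact N.norm_R_one_mul_energyFunction_le hc hγ
    _ = _ := by ring

theorem norm_one_sub_expFn_le {ε : ℝ} (hε : 0 ≤ ε) {e : ℝ} (he : 0 ≤ e) :
    ‖1 - expFn (-(ε : ℂ)) e‖ ≤ ε * (1 + e) := by
  have hexp : 1 - expFn (-(ε : ℂ)) e = ((1 - Real.exp (-(ε * e)) : ℝ) : ℂ) := by
    simp [expFn]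
  have hle : Real.exp (-(ε * e)) ≤ 1 :=
    Real.exp_le_one_iff.mpr (neg_nonpos.mpr (mul_nonneg hε he))
  rw [hexp, Complex.norm_real, Real.norm_of_nonneg (sub_nonneg.mpr hle)]
  linarith [Real.add_one_le_exp (-(ε * e))]

theorem energyNorm_sub_dampedFunctional_le {ℓ : ℝ} (hℓ : 0 < ℓ) {ε : ℝ} (hε : 0 < ε) {χ : H}
    {σ : N.Smooth} (hσ : ∀ A : H →L[ℂ] H, σ.1 A = ⟪χ, A N.Ω⟫_ℂ) :
    N.energyNorm ℓ (σ - N.dampedFunctional ε hε χ N.Ω) ≤ N.energyNorm (ℓ + 1) σ * ε := by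
  have hre := re_neg_ofReal_nonpos hε.le
  have h1 := boundedOnSpectrum_const 1
  have hexp := boundedOnSpectrum_expFn hre
  refine N.energyNorm_le ⟨mul_nonneg (N.energyNorm_nonneg (by positivity) σ) hε.le, fun A => ?_⟩
  have hvalue : (σ - N.dampedFunctional ε hε χ N.Ω).1 A
      = σ.1 (N.energyFunction (fun e => 1 - expFn (-(ε : ℂ)) e) * A
        * N.energyFunction fun _ => 1) := by
    rw [Smooth.sub_apply, dampedFunctional_apply, N.expH_vacuum hre, N.inner_expH_left hre,
      map_neg, Complex.conj_ofReal, N.energyFunction_sub h1 hexp, energyFunction_const, one_smul,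
      mul_one, sub_mul, one_mul, map_sub, hσ, hσ, clm_mul_app, expH]
  rw [hvalue]
  refine (N.norm_apply_energyFunction_mul_mul_le σ hℓ (h1.sub hexp) h1
    (fun e he => norm_one_sub_expFn_le hε.le he) (γ := 1) (fun e he => ?_) A).trans_eq ?_
  · rw [norm_one]
    linarith
  · rw [mul_one]

theorem eq_zero_of_fieldVector_eq_zero {φ : N.SmoothDual} (h : ∀ ε, 0 < ε → N.fieldVector φ ε = 0)
    (χ : H) (σ : N.Smooth) (hσ : ∀ A : H →L[ℂ] H, σ.1 A = ⟪χ, A N.Ω⟫_ℂ) : φ σ = 0 := by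
  obtain ⟨n, hn, C, hC0, hC⟩ := N.exists_dual_bound φ
  have hbound : ∀ ε, 0 < ε → ‖φ σ‖ ≤ C * (N.energyNorm (n + 1) σ * ε) := by
    intro ε hε
    have hφ : φ (N.dampedFunctional ε hε χ N.Ω) = 0 := by
      rw [← N.inner_damped hε, ← fieldVector, h ε hε, inner_zero_right]
    calc ‖φ σ‖ = ‖φ (σ - N.dampedFunctional ε hε χ N.Ω)‖ := by rw [map_sub, hφ, sub_zero]
      _ ≤ C * N.energyNorm n (σ - N.dampedFunctional ε hε χ N.Ω) := hC _
      _ ≤ C * (N.energyNorm (n + 1) σ * ε) := by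
          gcongr
          exact N.energyNorm_sub_dampedFunctional_le (Nat.cast_pos.mpr hn) hε hσ
  have hlim : Filter.Tendsto (fun ε : ℝ => C * (N.energyNorm (n + 1) σ * ε)) (𝓝[>] 0)
      (𝓝 (C * (N.energyNorm (n + 1) σ * 0))) :=
    ((Filter.tendsto_id.mono_left nhdsWithin_le_nhds).const_mul _).const_mul _
  rw [mul_zero, mul_zero] at hlim
  refine norm_le_zero_iff.mp (ge_of_tendsto hlim ?_)
  filter_upwards [self_mem_nhdsWithin] with ε hε using hbound ε hε

theorem norm_wave_sub_wave_le (p q : ℝ) {e : ℝ} (he : 0 ≤ e) :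
    ‖wave p e - wave q e‖ ≤ |p - q| * (1 + e) := by
  have hfactor : wave p e - wave q e = wave q e * (wave (p - q) e - 1) := by
    rw [mul_sub, wave_mul, add_sub_cancel, mul_one]
  calc ‖wave p e - wave q e‖ = ‖wave (p - q) e - 1‖ := by
        rw [hfactor, norm_mul, norm_wave, one_mul]
    _ ≤ |p - q| * e := by
        refine Real.norm_exp_I_mul_ofReal_sub_one_le.trans_eq ?_
        rw [Real.norm_eq_abs, abs_mul, abs_of_nonneg he]
    _ ≤ |p - q| * (1 + e) := by gcongr; linarith

theorem translate_apply (t : ℝ) (σ : N.Smooth) (A : H →L[ℂ] H) :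
    (N.translate t σ).1 A
      = σ.1 (N.energyFunction (wave t) * A * N.energyFunction (wave (-t))) := by
  rw [energyFunction_wave, energyFunction_wave, ← star_timeU, ← conjFunctional_apply]
  rfl

theorem energyNorm_translate_sub_translate_le {ℓ : ℝ} (hℓ : 0 < ℓ) (σ : N.Smooth) (t t' : ℝ) :
    N.energyNorm ℓ (N.translate t σ - N.translate t' σ)
      ≤ N.energyNorm (ℓ + 1) σ * (2 * |t - t'|) := by
  have hσ0 := N.energyNorm_nonneg (by positivity : 0 < ℓ + 1) σ
  refine N.energyNorm_le ⟨by positivity, fun A => ?_⟩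
  have hdiff (p q : ℝ) := (boundedOnSpectrum_wave p).sub (boundedOnSpectrum_wave q)
  have hwave (p e : ℝ) (he : 0 ≤ e) : ‖wave p e‖ ≤ 1 * (1 + e) := by
    rw [norm_wave]
    linarith
  have hvalue : (N.translate t σ - N.translate t' σ).1 A
      = σ.1 (N.energyFunction (fun e => wave t e - wave t' e) * A * N.energyFunction (wave (-t)))
        + σ.1 (N.energyFunction (wave t') * A
          * N.energyFunction fun e => wave (-t) e - wave (-t') e) := by
    rw [Smooth.sub_apply, translate_apply, translate_apply, ← map_sub, ← map_add,
      N.energyFunction_sub (boundedOnSpectrum_wave _) (boundedOnSpectrum_wave _),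
      N.energyFunction_sub (boundedOnSpectrum_wave _) (boundedOnSpectrum_wave _)]
    congr 1
    noncomm_ring
  have hleft := N.norm_apply_energyFunction_mul_mul_le σ hℓ (hdiff t t')
    (boundedOnSpectrum_wave (-t)) (fun _ he => norm_wave_sub_wave_le t t' he) (hwave _) A
  have hright := N.norm_apply_energyFunction_mul_mul_le σ hℓ (boundedOnSpectrum_wave t')
    (hdiff (-t) (-t')) (hwave _) (fun _ he => norm_wave_sub_wave_le (-t) (-t') he) A
  have habs : |-t - -t'| = |t - t'| := by rw [neg_sub_neg, abs_sub_comm]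
  rw [habs] at hright
  rw [hvalue]
  exact (norm_add_le_of_le hleft hright).trans_eq (by ring)

theorem continuous_translate (φ : N.SmoothDual) (σ : N.Smooth) :
    Continuous fun t => φ (N.translate t σ) := by
  obtain ⟨n, hn, C, hC0, hC⟩ := N.exists_dual_bound φ
  have hσ0 : 0 ≤ N.energyNorm (n + 1) σ := N.energyNorm_nonneg (by positivity) σ
  refine (LipschitzWith.of_dist_le_mul (K := (C * (N.energyNorm (n + 1) σ * 2)).toNNReal)
    fun t t' => ?_).continuous
  rw [dist_eq_norm, Real.dist_eq, ← map_sub, Real.coe_toNNReal _ (by positivity)]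
  calc _ ≤ C * N.energyNorm n (N.translate t σ - N.translate t' σ) := hC _
    _ ≤ C * (N.energyNorm (n + 1) σ * (2 * |t - t'|)) := by
        gcongr
        exact N.energyNorm_translate_sub_translate_le (Nat.cast_pos.mpr hn) σ t t'
    _ = _ := by ring

theorem smear_eq_zero_of_fieldVector_eq_zero (hsep : N.VacuumSeparating) {φ : N.SmoothDual}
    (hφ : φ ∈ N.Fields) (h : ∀ ε, 0 < ε → N.fieldVector φ ε = 0) (f : Test) (σ : N.Smooth) :
    N.smear φ f σ = 0 := by
  refine hsep φ hφ f (fun χ σ hσ => ?_) σ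
  have hzero (t : ℝ) : φ (N.translate t σ) = 0 := by
    refine N.eq_zero_of_fieldVector_eq_zero h (N.timeU (-t) χ) _ fun A => ?_
    rw [translate_apply, energyFunction_wave, energyFunction_wave]
    refine (hσ _).trans ?_
    rw [clm_mul_app, clm_mul_app, timeU_vacuum, ← star_timeU,
      ContinuousLinearMap.star_eq_adjoint, ContinuousLinearMap.adjoint_inner_left]
  simp only [smear, hzero, mul_zero, integral_zero]

theorem translate_zero (σ : N.Smooth) : N.translate 0 σ = σ := by
  refine Smooth.ext fun A => ?_
  rw [translate_apply, neg_zero, energyFunction_wave, timeU_zero, one_mul, mul_one]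

theorem eq_zero_of_smear_eq_zero {φ : N.SmoothDual} (h : ∀ f σ, N.smear φ f σ = 0) : φ = 0 := by
  refine DFunLike.ext _ _ fun σ => ?_
  have hcont := N.continuous_translate φ σ
  have hae : (fun t => φ (N.translate t σ)) =ᵐ[volume] fun _ => 0 := by
    refine ae_eq_zero_of_integral_contDiff_smul_eq_zero hcont.locallyIntegrable fun g hg hgc => ?_
    let f : Test := ⟨fun x => (g x : ℂ), Complex.ofRealCLM.contDiff.comp hg,
      hgc.comp_left (g := fun x : ℝ => (x : ℂ)) Complex.ofReal_zero, fun _ _ => trivial⟩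
    simp only [Complex.real_smul]
    exact h f σ
  have hzero := congrFun ((hcont.ae_eq_iff_eq volume continuous_const).mp hae) 0
  rwa [translate_zero] at hzero

theorem field_eq_zero_of_fieldVector_eq_zero (hsep : N.VacuumSeparating) {φ : N.SmoothDual}
    (hφ : φ ∈ N.Fields) (h : ∀ ε, 0 < ε → N.fieldVector φ ε = 0) : φ = 0 :=
  N.eq_zero_of_smear_eq_zero (N.smear_eq_zero_of_fieldVector_eq_zero hsep hφ h)

/-! ### Positivity of the vacuum expectation -/

theorem polynomialGrowth_vacuumTwoPoint (φ : N.SmoothDual) :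
    PolynomialGrowth (N.vacuumTwoPoint φ) := by
  obtain ⟨n, C, hC⟩ := N.exists_norm_fieldVector_le φ
  refine ⟨N.differentiableOn_vacuumTwoPoint φ, n * 2, (C * 4 ^ n) ^ 2, by positivity,
    fun z h1 h2 => (N.norm_vacuumTwoPoint_le φ h2).trans ?_⟩
  rw [pow_mul, ← div_pow, abs_of_neg h2]
  refine pow_le_pow_left₀ (norm_nonneg _) ((hC _ (by linarith) (by linarith)).trans_eq ?_) 2
  rw [div_pow]
  field_simp

theorem posSemidef_stripKernel_vacuumTwoPoint (φ : N.SmoothDual) :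
    (stripKernel (N.vacuumTwoPoint φ)).PosSemidef := by
  convert posSemidef_gram fun a : Strip => N.translatedFieldVector φ a.1 using 1
  ext a b
  exact N.vacuumTwoPoint_eq_inner φ a.2.1 b.2.1

theorem vacuumTwoPoint_neg_mul_I (φ : N.SmoothDual) {η : ℝ} (hη : 0 < η) :
    N.vacuumTwoPoint φ (-η * Complex.I) = (‖N.fieldVector φ (η / 2)‖ : ℂ) ^ 2 := by
  have him : 0 < (Complex.I * ((η / 2 : ℝ) : ℂ)).im := by simpa using hη
  have hconj : conj (Complex.I * ((η / 2 : ℝ) : ℂ)) - Complex.I * ((η / 2 : ℝ) : ℂ)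
      = -η * Complex.I := by
    rw [map_mul, Complex.conj_I, Complex.conj_ofReal]
    push_cast
    ring
  rw [← hconj, N.vacuumTwoPoint_eq_inner φ him him, N.translatedFieldVector_I_mul φ (half_pos hη)]
  exact inner_self_eq_norm_sq_to_K _

theorem fieldVector_eq_zero_of_le {φ : N.SmoothDual} {δ ε : ℝ} (hδ : 0 < δ) (hle : δ ≤ ε)
    (hzero : N.fieldVector φ δ = 0) : N.fieldVector φ ε = 0 := by
  have hadd := N.fieldVector_add hδ (sub_nonneg.mpr hle) φ
  rwa [add_sub_cancel, hzero, map_zero] at hadd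

/-- The analytic function `K(z) ⟨φ Ω, exp (-izH) φ Ω⟩`, which is the vacuum expectation of the
product `K ⊗ φ* ⊗ φ`. -/
def vacuumExpectation (K : Kernel) (φ : N.SmoothDual) (z : ℂ) : ℂ := K.1 z * N.vacuumTwoPoint φ z

theorem polynomialGrowth_vacuumExpectation (K : Kernel) (φ : N.SmoothDual) :
    PolynomialGrowth (N.vacuumExpectation K φ) :=
  (RegularAtBoundary.polynomialGrowth K.2).mul (N.polynomialGrowth_vacuumTwoPoint φ)

theorem posSemidef_stripKernel_vacuumExpectation {K : Kernel} (hK : IsPositiveType K)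
    (φ : N.SmoothDual) : (stripKernel (N.vacuumExpectation K φ)).PosSemidef :=
  hK.posSemidef.hadamard (N.posSemidef_stripKernel_vacuumTwoPoint φ)

theorem vacuumExpectation_neg_mul_I_nonneg {K : Kernel} (hK : IsPositiveType K) (φ : N.SmoothDual)
    {η : ℝ} (hη : 0 < η) (hη' : η < 1) : 0 ≤ N.vacuumExpectation K φ (-η * Complex.I) := by
  let a : Strip := ⟨(η / 2 : ℝ) * Complex.I, by simpa using hη, by
    simpa using (by linarith : η / 2 < 1 / 2)⟩
  have hconj : conj a.1 - a.1 = -η * Complex.I := by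
    simp only [a, map_mul, Complex.conj_I, Complex.conj_ofReal]
    push_cast
    ring
  rw [← hconj]
  exact (N.posSemidef_stripKernel_vacuumExpectation hK φ).diag_nonneg (i := a)

theorem field_eq_zero_of_vacuumExpectation_eq_zero (hsep : N.VacuumSeparating) {K : Kernel}
    (hK : K ≠ 0) {φ : N.SmoothDual} (hφ : φ ∈ N.Fields) {δ : ℝ} (hδ : 0 < δ)
    (hzero : ∀ η : ℝ, 0 < η → η < δ → N.vacuumExpectation K φ (-η * Complex.I) = 0) : φ = 0 := by
  refine N.field_eq_zero_of_fieldVector_eq_zero hsep hφ fun ε hε => ?_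
  obtain ⟨η, hη, hlt, hne⟩ := exists_kernel_ne_zero hK (lt_min hδ (mul_pos two_pos hε))
  obtain ⟨hηδ, hηε⟩ := lt_min_iff.mp hlt
  refine N.fieldVector_eq_zero_of_le (half_pos hη) (by linarith) ?_
  have htwo := (mul_eq_zero.mp (hzero η hη hηδ)).resolve_left hne
  rwa [N.vacuumTwoPoint_neg_mul_I φ hη, sq_eq_zero_iff, Complex.ofReal_eq_zero,
    norm_eq_zero] at htwo

section FiniteSum

variable {n : ℕ} {K : Fin n → Kernel} {φ : Fin n → N.SmoothDual}

theorem posSemidef_stripKernel_sum_vacuumExpectation (hK : ∀ j, IsPositiveType (K j)) :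
    (stripKernel (∑ j, N.vacuumExpectation (K j) (φ j))).PosSemidef := by
  have hsum : stripKernel (∑ j, N.vacuumExpectation (K j) (φ j))
      = ∑ j, stripKernel (N.vacuumExpectation (K j) (φ j)) := by
    ext a b
    simp only [stripKernel, Matrix.sum_apply, Matrix.of_apply, Finset.sum_apply]
  rw [hsum]
  exact Matrix.posSemidef_sum _ fun j _ =>
    N.posSemidef_stripKernel_vacuumExpectation (hK j) (φ j)

variable {T : Test →ₗ[ℂ] N.SmoothDual}

theorem IsProductDistribution.hasBoundaryValue_vacuum
    (hT : N.IsProductDistribution (∑ j, K j ⊗ₜ[ℂ] (N.starDual (φ j) ⊗ₜ[ℂ] φ j)) T) (f : Test) :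
    HasBoundaryValue (∑ j, N.vacuumExpectation (K j) (φ j)) f (T f N.vacuum) := by
  refine (hT.2 n K (fun j => N.starDual (φ j)) φ rfl 1 N.vacuum one_pos
    (N.isEnergyBounded_vacuum zero_le_one) f).congr' ?_
  filter_upwards [self_mem_nhdsWithin] with y (hy : 0 < y)
  congr 1
  funext x
  have him : ((x : ℂ) - y * Complex.I).im < 0 := by simpa using hy
  simp only [N.twoPoint_vacuum zero_le_one _ him, Finset.sum_apply, vacuumExpectation]

theorem sum_vacuumExpectation_eq_zero {α : ℝ} (hα : 0 ≤ α) (hK : ∀ j, IsPositiveType (K j))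
    (happrox : N.IsApproximating α (∑ j, K j ⊗ₜ[ℂ] (N.starDual (φ j) ⊗ₜ[ℂ] φ j)) 0)
    {η : ℝ} (hη : 0 < η) (hη' : η < 1 / 2) :
    ∑ j, N.vacuumExpectation (K j) (φ j) (-η * Complex.I) = 0 := by
  obtain ⟨-, T, hT, ℓ, -, m, ε, hε, hbound⟩ := happrox
  rw [← Finset.sum_apply]
  refine (PolynomialGrowth.sum _ fun j _ =>
    N.polynomialGrowth_vacuumExpectation (K j) (φ j)).eq_zero_of_boundaryValue
    (N.posSemidef_stripKernel_sum_vacuumExpectation hK) hT.hasBoundaryValue_vacuum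
    (ε := fun d => ε d * N.energyNorm ℓ N.vacuum) (m := m) ?_ (fun d hd g hg => ?_) hη hη'
  · simpa only [zero_mul] using (tendsto_zero_of_isLittleO_rpow hα hε).mul_const _
  · -- the vacuum functional is translation invariant, so the weak integral is `∫ T (diamond g g t)`
    have hvac := hbound d hd g g hg hg N.vacuum
    simp only [convolutionIntegral, N.translate_vacuum, zero_apply, sub_zero] at hvac
    exact hvac.trans_eq (by ring)

theorem vacuumExpectation_eq_zero {α : ℝ} (hα : 0 ≤ α) (hK : ∀ j, IsPositiveType (K j))
    (happrox : N.IsApproximating α (∑ j, K j ⊗ₜ[ℂ] (N.starDual (φ j) ⊗ₜ[ℂ] φ j)) 0)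
    (j : Fin n) {η : ℝ} (hη : 0 < η) (hη' : η < 1 / 2) :
    N.vacuumExpectation (K j) (φ j) (-η * Complex.I) = 0 :=
  (Finset.sum_eq_zero_iff_of_nonneg fun i _ =>
    N.vacuumExpectation_neg_mul_I_nonneg (hK i) (φ i) hη (by linarith)).mp
    (N.sum_vacuumExpectation_eq_zero hα hK happrox hη hη') j (Finset.mem_univ j)

end FiniteSum

end LocalNet

end

end PointlikeQFT

theorem mainTheorem5_general {s : ℕ} {H : Type*} [NormedAddCommGroup H]
    [InnerProductSpace ℂ H] [CompleteSpace H] (N : PointlikeQFT.LocalNet s H)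
    (hsep : N.VacuumSeparating) (α : ℝ) (hα : 0 ≤ α) (Q : N.Products)
    (hQ : Q ∈ N.PositiveProducts) (hQ0 : Q ≠ 0)
    (p : N.SmoothDual →L[ℂ] N.SmoothDual) (hp : N.IsApproximating α Q p) :
    p ≠ 0 := by
  rintro rfl
  obtain ⟨n, K, φ, hK, hφ, rfl⟩ := hQ
  have hvac : ∀ j (η : ℝ), 0 < η → η < 1 / 2 →
      N.vacuumExpectation (K j) (φ j) (-η * Complex.I) = 0 := fun j η =>
    N.vacuumExpectation_eq_zero hα hK hp j
  refine hQ0 (Finset.sum_eq_zero fun j _ => ?_)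
  by_cases hKj : K j = 0
  · rw [hKj, TensorProduct.zero_tmul]
  · have hφj : φ j = 0 :=
      N.field_eq_zero_of_vacuumExpectation_eq_zero hsep hKj (hφ j) one_half_pos (hvac j)
    rw [hφj, TensorProduct.tmul_zero, TensorProduct.tmul_zero]

theorem mainTheorem5 {s : ℕ} (hs : 2 ≤ s) {H : Type*} [NormedAddCommGroup H]
    [InnerProductSpace ℂ H] [CompleteSpace H] (N : PointlikeQFT.LocalNet s H)
    (hphase : N.MicroscopicPhaseSpaceCondition) (hsep : N.VacuumSeparating)
    (α : ℝ) (hα : 0 ≤ α) (Q : N.Products) (hQ : Q ∈ N.PositiveProducts) (hQ0 : Q ≠ 0)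
    (p : N.SmoothDual →L[ℂ] N.SmoothDual) (hp : N.IsApproximating α Q p) :
    p ≠ 0 :=
  mainTheorem5_general N hsep α hα Q hQ hQ0 p hp
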